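/- **Setting.** All matrices are real $2\times2$; $\|\cdot\|$ is the spectral norm, $\kappa(A)=\|A\|\,\|A^{-1}\|$, $|\cdot|$ acts elementwise on matrices, and $J=\begin{pmatrix}0&1\\-1&0\end{pmatrix}$. Floating-point arithmetic with unit roundoff $u>0$ follows the standard model: each computed $+,-,\cdot,/,\sqrt{\ }$ has relative error at most $u$; multiplication by $0,\pm1$, negation, absolute values and comparisons are exact; there is no overflow or underflow. Products of matrices are evaluated entrywise by the usual formula and from left to right, except that $\widehat H$ below is evaluated as $|\operatorname{adj}(A)|\,(|B|\,|U|)$. **Algorithm RSVD22-$\tau_\eta$.** Input: upper-triangular $A,B,C$ with $A$ nonsingular, and a tolerance $\tau_\eta\ge1$. 1. If $c_{11}=b_{22}=0$: compute (with the LAPACK rotation generator xLARTG) rotations $V$ with $(V^TC)_{22}=0$ and $U$ with $(BU)_{11}=0$, let $P=Q=J$, $A'=P^TAQ$, $B'=P^TBU$, $C'=V^TCQ$, set $b'_{21}=c'_{21}=0$, and return. 2. Otherwise compute $M=C\operatorname{adj}(A)B$ entrywise as $m_{11}=(c_{11}a_{22})b_{11}$, $m_{22}=c_{22}(a_{11}b_{22})$,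 $m_{12}=\big((c_{11}a_{22})b_{12}+c_{12}(a_{11}b_{22})\big)-(c_{11}a_{12})b_{22}$, $m_{21}=0$, and use the LAPACK routine xLASV2 (with machine epsilon $u$) to compute rotations $U,V$ for an SVD $M=V\Sigma U^T$. If $c_{11},c_{22},b_{11},b_{22}$ are all nonzero and $\max\{|u_{11}|,|v_{11}|\}<\max\{|u_{12}|,|v_{12}|\}$, replace $U,V$ by $UJ,VJ$. 3. Let $G=V^TC$ (optionally setting $g_{22}=0$ if $c_{11}=0$), $L=BU$ (optionally setting $l_{12}=0$ if $b_{22}=0$), $H=\operatorname{adj}(A)L$, $K=G\operatorname{adj}(A)$, $\widehat G=|V|^T|C|$, $\widehat H=|\operatorname{adj}(A)|\,|B|\,|U|$, $\widehat K=|V|^T|C|\,|\operatorname{adj}(A)|$, $\widehat L=|B|\,|U|$. 4. For $i=1,2$ and $j=3-i$ let $$\eta_g^{(i)}=\frac{\widehat g_{i1}+\widehat g_{i2}}{|g_{i1}|+|g_{i2}|},\quad \eta_k^{(i)}=\frac{\widehat k_{i1}+\widehat k_{i2}}{|k_{i1}|+|k_{i2}|},\quad \eta_h^{(i)}=\frac{\widehat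 h_{1j}+\widehat h_{2j}}{|h_{1j}|+|h_{2j}|},\quad \eta_l^{(i)}=\frac{\widehat l_{1j}+\widehat l_{2j}}{|l_{1j}|+|l_{2j}|},$$ where a quotient with denominator $0$ is $\infty$, and let $\eta_{\max}^{(i)}=\max\{1,\min\{\eta_g^{(i)},\eta_h^{(i)}\},\min\{\eta_k^{(i)},\eta_l^{(i)}\}\}$. 5. If $\eta_{\max}^{(1)}\le\tau_\eta$ and $\eta_{\max}^{(1)}\le\eta_{\max}^{(2)}$, let $\eta_\bullet=\eta_\bullet^{(1)}$; otherwise let $\eta_\bullet=\eta_\bullet^{(2)}$ and replace $U,V,G,H,K,L$ by $UJ,VJ,J^TG,HJ,J^TK,LJ$. 6. If $|h_{12}|+|h_{22}|=0$, or $|g_{11}|+|g_{12}|\ne0$ and $\eta_g\le\eta_h$, use xLARTG to compute a rotation $Q$ such that $GQ$ is lower triangular; otherwise compute $Q$ such that $Q^TH$ is lower triangular. If $|k_{11}|+|k_{12}|=0$, or $|l_{12}|+|l_{22}|\ne0$ and $\eta_l\le\eta_k$, use xLARTG to compute a rotation $P$ such that $P^TL$ is lower triangular; otherwise compute $P$ such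 that $KP$ is lower triangular. 7. Let $A'=P^TAQ$, $B'=P^TL$, $C'=GQ$, and set $a'_{12}=b'_{12}=c'_{12}=0$. **Theorem.** For every constant $c>0$ there are constants $\varepsilon_0>0$ and $K>0$, depending only on $c$, such that the following holds for every $0<\varepsilon\le\varepsilon_0$ and all upper-triangular real $2\times2$ matrices $A,B,C$ with $A$ nonsingular. Suppose that all floating-point operations in Algorithm RSVD22-$\tau_\eta$ are carried out in an arithmetic with unit roundoff $0<u\le c\,\varepsilon\,\kappa(A)^{-1}$, with tolerance $\tau_\eta=8\kappa(A)$, and with or without the optional zeroing in step 3. Then the computed $\overline A'$ is backward stable with respect to the precision $\varepsilon$: there are exactly orthogonal matrices $\mathcal P,\mathcal Q$, within $K\varepsilon$ of the computed $\overline P,\overline Q$ in norm, and a matrix $\delta A$, such that $$\overline A'=\mathcal P^T(A+\delta A)\mathcal Q,\qquad \|\delta A\|\le K\,\varepsilon\,\|A\|.$$ -/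

import Mathlib

open scoped Matrix Matrix.Norms.L2Operator

namespace RSVD

/-- Real `2 × 2` matrices. The norm in force is the spectral norm (operator 2-norm). -/
abbrev Mat2 := Matrix (Fin 2) (Fin 2) ℝ

/-- The 2-norm condition number `‖A‖ ‖A⁻¹‖`. -/
noncomputable def cond (A : Mat2) : ℝ := ‖A‖ * ‖A⁻¹‖

/-- The standard model of floating-point arithmetic with unit roundoff `u`: every elementary
operation is computed with a relative error of at most `u` (no overflow or underflow), and
multiplication by `±1` (and, by `mul_err`, by `0`) is exact. Negation, absolute values and
comparisons are exact and are written with the real operations. -/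
structure FlArith (u : ℝ) where
  add : ℝ → ℝ → ℝ
  sub : ℝ → ℝ → ℝ
  mul : ℝ → ℝ → ℝ
  div : ℝ → ℝ → ℝ
  sqrt : ℝ → ℝ
  add_err : ∀ a b, |add a b - (a + b)| ≤ u * |a + b|
  sub_err : ∀ a b, |sub a b - (a - b)| ≤ u * |a - b|
  mul_err : ∀ a b, |mul a b - a * b| ≤ u * |a * b|
  div_err : ∀ a b, b ≠ 0 → |div a b - a / b| ≤ u * |a / b|
  sqrt_err : ∀ a, 0 ≤ a → |sqrt a - Real.sqrt a| ≤ u * Real.sqrt a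
  one_mul : ∀ a, mul 1 a = a
  mul_one : ∀ a, mul a 1 = a
  neg_one_mul : ∀ a, mul (-1) a = -a
  mul_neg_one : ∀ a, mul a (-1) = -a

/-- The quarter period shift `rot(π/2)`. -/
def J : Mat2 := !![0, 1; -1, 0]

/-- Elementwise absolute value. -/
def mabs (X : Mat2) : Mat2 := X.map fun x => |x|

/-- The adjugate of an upper-triangular matrix. -/
def adjU (A : Mat2) : Mat2 := !![A 1 1, -A 0 1; 0, A 0 0]

/-- Explicit zeroing of the `(1,2)` entry. -/
def clear12 (X : Mat2) : Mat2 := !![X 0 0, 0; X 1 0, X 1 1]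

/-- Explicit zeroing of the `(2,1)` entry. -/
def clear21 (X : Mat2) : Mat2 := !![X 0 0, X 0 1; 0, X 1 1]

/-- Explicit zeroing of the `(2,2)` entry. -/
def clear22 (X : Mat2) : Mat2 := !![X 0 0, X 0 1; X 1 0, 0]

/-- `|a|` with the sign of `b` (Fortran's `SIGN`). -/
noncomputable def fsign (a b : ℝ) : ℝ := if 0 ≤ b then |a| else -|a|

section Arithmetic

variable {u : ℝ} (fl : FlArith u)

/-- The computed product of two `2 × 2` matrices. -/
def FlArith.mmul (X Y : Mat2) : Mat2 :=
  Matrix.of fun i j => fl.add (fl.mul (X i 0) (Y 0 j)) (fl.mul (X i 1) (Y 1 j))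

/-- The rotation generator of LAPACK (`xLARTG`, without the scaling that only serves to avoid
overflow and underflow): `(c, s)` with `c f + s g = r` and `-s f + c g = 0`. -/
noncomputable def lartg (f g : ℝ) : ℝ × ℝ :=
  if g = 0 then (1, 0)
  else if f = 0 then (0, 1)
  else
    let r := fl.sqrt (fl.add (fl.mul f f) (fl.mul g g))
    let c := fl.div f r
    let s := fl.div g r
    if |g| < |f| ∧ c < 0 then (-c, -s) else (c, s)

/-- The part of `xLASV2` that follows the initial ordering; here `|h| ≤ |f|`. The result is
`(clt, slt, crt, srt)`. -/
noncomputable def lasv2Core (f g h : ℝ) : ℝ × ℝ × ℝ × ℝ :=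
  if g = 0 then (1, 0, 1, 0)
  else if |f| < |g| ∧ fl.div |f| |g| < u then
    (1, fl.div h g, fl.div f g, 1)
  else
    let d := fl.sub |f| |h|
    let l := if d = |f| then 1 else fl.div d |f|
    let m := fl.div g f
    let t := fl.sub 2 l
    let mm := fl.mul m m
    let tt := fl.mul t t
    let s := fl.sqrt (fl.add tt mm)
    let r := if l = 0 then |m| else fl.sqrt (fl.add (fl.mul l l) mm)
    let a := fl.mul (1 / 2) (fl.add s r)
    let t' :=
      if mm = 0 then
        if l = 0 then fl.mul (fsign 2 f) (fsign 1 g)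
        else fl.add (fl.div g (fsign d f)) (fl.div m t)
      else
        fl.mul (fl.add (fl.div m (fl.add s t)) (fl.div m (fl.add r l))) (fl.add 1 a)
    let l' := fl.sqrt (fl.add (fl.mul t' t') 4)
    let crt := fl.div 2 l'
    let srt := fl.div t' l'
    let clt := fl.div (fl.add crt (fl.mul srt m)) a
    let slt := fl.div (fl.mul (fl.div h f) srt) a
    (clt, slt, crt, srt)

/-- The singular vectors computed by the LAPACK routine `xLASV2` for the upper-triangular matrix
`[f g; 0 h]`: the pair `(V, U)` for which `Vᵀ [f g; 0 h] U` is diagonal in exact arithmetic.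
(The singular values, which `xLASV2` also returns, are not used.) -/
noncomputable def lasv2 (f g h : ℝ) : Mat2 × Mat2 :=
  let w : ℝ × ℝ × ℝ × ℝ :=
    if |f| < |h| then
      let z := lasv2Core fl h g f
      (z.2.2.2, z.2.2.1, z.2.1, z.1)
    else lasv2Core fl f g h
  let csl := w.1
  let snl := w.2.1
  let csr := w.2.2.1
  let snr := w.2.2.2
  (!![csl, -snl; snl, csl], !![csr, -snr; snr, csr])

/-- The computed product `C adj(A) B` for upper-triangular `A`, `B`, `C`. -/
def prodM (A B C : Mat2) : Mat2 :=
  !![fl.mul (fl.mul (C 0 0) (A 1 1)) (B 0 0),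
     fl.sub
       (fl.add (fl.mul (fl.mul (C 0 0) (A 1 1)) (B 0 1))
               (fl.mul (C 0 1) (fl.mul (A 0 0) (B 1 1))))
       (fl.mul (fl.mul (C 0 0) (A 0 1)) (B 1 1));
     0,
     fl.mul (C 1 1) (fl.mul (A 0 0) (B 1 1))]

/-- The computed quotient `(n₁ + n₂) / (|d₁| + |d₂|)`, which is `∞` if the denominator is `0`. -/
noncomputable def eta (n₁ n₂ d₁ d₂ : ℝ) : EReal :=
  if fl.add |d₁| |d₂| = 0 then ⊤
  else ((fl.div (fl.add n₁ n₂) (fl.add |d₁| |d₂|) : ℝ) : EReal)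

/-- `max {1, min {η_g, η_h}, min {η_k, η_l}}`. -/
noncomputable def etaMax (ηg ηh ηk ηl : EReal) : EReal :=
  max 1 (max (min ηg ηh) (min ηk ηl))

/-- The matrices returned by the algorithm; `A'`, `B'`, `C'` are the computed `Pᵀ A Q`, `Pᵀ B U`,
`Vᵀ C Q`, with explicitly zeroed entries. -/
structure Output where
  P : Mat2
  Q : Mat2
  U : Mat2
  V : Mat2
  A' : Mat2
  B' : Mat2
  C' : Mat2

/-- The case `c₁₁ = b₂₂ = 0`. -/
noncomputable def rsvdZero (A B C : Mat2) : Output :=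
  let v := lartg fl (C 0 1) (C 1 1)
  let V : Mat2 := !![v.1, -v.2; v.2, v.1]
  let w := lartg fl (B 0 1) (B 0 0)
  let U : Mat2 := !![w.1, w.2; -w.2, w.1]
  { P := J, Q := J, U := U, V := V,
    A' := fl.mmul (fl.mmul Jᵀ A) J,
    B' := clear21 (fl.mmul (fl.mmul Jᵀ B) U),
    C' := clear21 (fl.mmul (fl.mmul Vᵀ C) J) }

/-- The choice and the computation of `Q` and `P`, followed by the computation of `A'`, `B'`,
`C'`. -/
noncomputable def rsvdFinish (A U V G H K L : Mat2) (ηg ηh ηk ηl : EReal) : Output :=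
  let Q : Mat2 :=
    if fl.add |H 0 1| |H 1 1| = 0 ∨ (fl.add |G 0 0| |G 0 1| ≠ 0 ∧ ηg ≤ ηh) then
      let q := lartg fl (G 0 0) (G 0 1)
      !![q.1, -q.2; q.2, q.1]
    else
      let q := lartg fl (H 1 1) (H 0 1)
      !![q.1, q.2; -q.2, q.1]
  let P : Mat2 :=
    if fl.add |K 0 0| |K 0 1| = 0 ∨ (fl.add |L 0 1| |L 1 1| ≠ 0 ∧ ηl ≤ ηk) then
      let p := lartg fl (L 1 1) (L 0 1)
      !![p.1, p.2; -p.2, p.1]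
    else
      let p := lartg fl (K 0 0) (K 0 1)
      !![p.1, -p.2; p.2, p.1]
  { P := P, Q := Q, U := U, V := V,
    A' := clear12 (fl.mmul (fl.mmul Pᵀ A) Q),
    B' := clear12 (fl.mmul Pᵀ L),
    C' := clear12 (fl.mmul G Q) }

/-- The `2 × 2` upper-triangular RSVD with tolerance `τ` (RSVD22-`τ_η`), carried out in the
arithmetic `fl`. The flags `zg`, `zl` tell whether the optional zeroing of `g₂₂` if `c₁₁ = 0`
and of `l₁₂` if `b₂₂ = 0` is performed. -/
noncomputable def rsvd22 (zg zl : Bool) (τ : EReal) (A B C : Mat2) : Output :=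
  if C 0 0 = 0 ∧ B 1 1 = 0 then rsvdZero fl A B C
  else
    let M := prodM fl A B C
    let VU := lasv2 fl (M 0 0) (M 0 1) (M 1 1)
    let V₀ := VU.1
    let U₀ := VU.2
    let cmax := max |U₀ 0 0| |V₀ 0 0|
    let smax := max |U₀ 0 1| |V₀ 0 1|
    let flip : Prop := C 0 0 ≠ 0 ∧ C 1 1 ≠ 0 ∧ B 0 0 ≠ 0 ∧ B 1 1 ≠ 0 ∧ cmax < smax
    let U : Mat2 := if flip then U₀ * J else U₀
    let V : Mat2 := if flip then V₀ * J else V₀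
    let G₀ := fl.mmul Vᵀ C
    let G : Mat2 := if zg = true ∧ C 0 0 = 0 then clear22 G₀ else G₀
    let L₀ := fl.mmul B U
    let L : Mat2 := if zl = true ∧ B 1 1 = 0 then clear12 L₀ else L₀
    let Gh := fl.mmul (mabs V)ᵀ (mabs C)
    let Lh := fl.mmul (mabs B) (mabs U)
    let H := fl.mmul (adjU A) L
    let Hh := fl.mmul (mabs (adjU A)) Lh
    let K := fl.mmul G (adjU A)
    let Kh := fl.mmul Gh (mabs (adjU A))
    let ηg₁ := eta fl (Gh 0 0) (Gh 0 1) (G 0 0) (G 0 1)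
    let ηh₁ := eta fl (Hh 0 1) (Hh 1 1) (H 0 1) (H 1 1)
    let ηk₁ := eta fl (Kh 0 0) (Kh 0 1) (K 0 0) (K 0 1)
    let ηl₁ := eta fl (Lh 0 1) (Lh 1 1) (L 0 1) (L 1 1)
    let ηg₂ := eta fl (Gh 1 0) (Gh 1 1) (G 1 0) (G 1 1)
    let ηh₂ := eta fl (Hh 0 0) (Hh 1 0) (H 0 0) (H 1 0)
    let ηk₂ := eta fl (Kh 1 0) (Kh 1 1) (K 1 0) (K 1 1)
    let ηl₂ := eta fl (Lh 0 0) (Lh 1 0) (L 0 0) (L 1 0)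
    let ηmax₁ := etaMax ηg₁ ηh₁ ηk₁ ηl₁
    let ηmax₂ := etaMax ηg₂ ηh₂ ηk₂ ηl₂
    if ηmax₁ ≤ τ ∧ ηmax₁ ≤ ηmax₂ then
      rsvdFinish fl A U V G H K L ηg₁ ηh₁ ηk₁ ηl₁
    else
      rsvdFinish fl A (U * J) (V * J) (Jᵀ * G) (H * J) (Jᵀ * K) (L * J) ηg₂ ηh₂ ηk₂ ηl₂

end Arithmetic

end RSVD

/-! Write a, b, d for the entries of A, so that adj(A) = (d, -b; 0, a). For a selected index let g
be the row of VᵀC, l the column of BU, k = g adj(A) and h = adj(A) l. The rounding errors of PᵀAQ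
are harmless. What matters is the (1,2) entry that is set to zero, which must be O(uκ)‖A‖ for exact
rotations near the computed ones (`backwardStable_of_small`).

The first column of P is parallel to k or to (l₂, -l₁), the second column of Q to h or to (-g₂, g₁).
If P comes from k and Q from g, the entry vanishes up to the rounding errors of k, since adj(A) A =
det(A) I. These errors are O(uκ) relative to k (`bilin_row`); the pair l, h is symmetric. If P comes
from l and Q from g, the entry is proportional to the residual g adj(A) l; if P comes from k and Q
from h, to det(A) g adj(A) l, up to rounding (`bilin_orig`, `bilin_adj`).

The residual is an off-diagonal entry of VᵀMU. Apart from harmless subtractions, xLASV2 combines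
quantities of equal sign, so its vectors are componentwise accurate (`lasv2Core_generic`), and the
residual is O(u) times the same expression in absolute values (`residual_of_fwd`). Relative to the
computed vectors, the majorants cost a factor X = min(η_g, η_h) for Q and Y = min(η_k, η_l) for P,
because the algorithm always takes the source with the smaller quotient. So XY = O(κ) suffices.

This holds because the two rows of VᵀC cannot both suffer cancellation: passing from (c, s) to (s,
-c) reverses the sign of the product of the two summands (`rowPair_of_fwd`). Columns of BU behave
alike. Without cancellation η_g is about 1 and η_k is at most 4κ (`Half.fine_le`). If the selected
index has such a g or l, XY is at most 1.03 · 4κ; otherwise the rejected index has both, its η_max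
is about 1, and minimality makes X and Y about 1 (`selected_of_le`). The tolerance 8κ exceeds 4κ, so
it never prevents the smaller η_max from being chosen. -/

namespace RSVD

/-! ### Calculus of relative errors -/

/-- `x = e * y` with `ρ ^ n ≤ e ≤ ρ ^ (-n)`: a relative error composed of `n` factors. -/
def Rel (ρ : ℝ) (n : ℕ) (x y : ℝ) : Prop :=
  ∃ e, 0 < e ∧ ρ ^ n ≤ e ∧ e * ρ ^ n ≤ 1 ∧ x = e * y

namespace Rel

variable {ρ : ℝ} {n m : ℕ} {x y x' y' : ℝ}

theorem refl (h1 : ρ ≤ 1) (h0 : 0 < ρ) (n : ℕ) (x : ℝ) : Rel ρ n x x :=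
  ⟨1, one_pos, pow_le_one₀ h0.le h1, by simpa using pow_le_one₀ h0.le h1, by simp⟩

theorem mono (h0 : 0 < ρ) (h1 : ρ ≤ 1) (h : Rel ρ n x y) (hnm : n ≤ m) : Rel ρ m x y := by
  obtain ⟨e, he, hl, hu, rfl⟩ := h
  have := pow_le_pow_of_le_one h0.le h1 hnm
  exact ⟨e, he, this.trans hl, (mul_le_mul_of_nonneg_left this he.le).trans hu, rfl⟩

theorem mul (h0 : 0 < ρ) (h : Rel ρ n x y) (h' : Rel ρ m x' y') :
    Rel ρ (n + m) (x * x') (y * y') := by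
  obtain ⟨e, he, hl, hu, rfl⟩ := h
  obtain ⟨e', he', hl', hu', rfl⟩ := h'
  refine ⟨e * e', by positivity, ?_, ?_, by ring⟩
  · rw [pow_add]; gcongr
  · calc e * e' * ρ ^ (n + m) = (e * ρ ^ n) * (e' * ρ ^ m) := by ring
      _ ≤ 1 * 1 := by gcongr
      _ = 1 := by norm_num

theorem inv (h0 : 0 < ρ) (h : Rel ρ n x y) : Rel ρ n x⁻¹ y⁻¹ := by
  obtain ⟨e, he, hl, hu, rfl⟩ := h
  have hp := pow_pos h0 n
  refine ⟨e⁻¹, by positivity, ?_, ?_, by rw [mul_inv]⟩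
  · rw [le_inv_comm₀ hp he, ← one_div, le_div_iff₀ hp]; exact hu
  · rw [inv_mul_le_iff₀ he]; simpa using hl

theorem div (h0 : 0 < ρ) (h : Rel ρ n x y) (h' : Rel ρ m x' y') :
    Rel ρ (n + m) (x / x') (y / y') := by
  rw [div_eq_mul_inv, div_eq_mul_inv]; exact h.mul h0 (h'.inv h0)

theorem trans (h0 : 0 < ρ) {z : ℝ} (h : Rel ρ n x y) (h' : Rel ρ m y z) : Rel ρ (n + m) x z := by
  obtain ⟨e, he, hl, hu, rfl⟩ := h
  obtain ⟨e', he', hl', hu', rfl⟩ := h'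
  refine ⟨e * e', by positivity, ?_, ?_, by ring⟩
  · rw [pow_add]; gcongr
  · calc e * e' * ρ ^ (n + m) = (e * ρ ^ n) * (e' * ρ ^ m) := by ring
      _ ≤ 1 * 1 := by gcongr
      _ = 1 := by norm_num

theorem add_of_nonneg (h0 : 0 < ρ) (h1 : ρ ≤ 1) (hy : 0 ≤ y) (hy' : 0 ≤ y')
    (h : Rel ρ n x y) (h' : Rel ρ n x' y') : Rel ρ n (x + x') (y + y') := by
  obtain ⟨e, he, hl, hu, rfl⟩ := h
  obtain ⟨e', he', hl', hu', rfl⟩ := h'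
  rcases (add_nonneg hy hy').eq_or_lt with hs | hs
  · have : y = 0 := by linarith
    have : y' = 0 := by linarith
    subst y y'
    simpa using refl h1 h0 n 0
  · have hp := pow_pos h0 n
    refine ⟨(e * y + e' * y') / (y + y'), ?_, ?_, ?_, by field_simp⟩
    · apply div_pos _ hs
      nlinarith [mul_le_mul_of_nonneg_right hl hy, mul_le_mul_of_nonneg_right hl' hy',
        mul_pos hp hs]
    · rw [le_div_iff₀ hs]
      nlinarith [mul_le_mul_of_nonneg_right hl hy, mul_le_mul_of_nonneg_right hl' hy']
    · rw [div_mul_eq_mul_div, div_le_one hs]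
      nlinarith [mul_le_mul_of_nonneg_right hu hy, mul_le_mul_of_nonneg_right hu' hy']

theorem neg (h : Rel ρ n x y) : Rel ρ n (-x) (-y) := by
  obtain ⟨e, he, hl, hu, rfl⟩ := h
  exact ⟨e, he, hl, hu, by ring⟩

theorem add (h0 : 0 < ρ) (h1 : ρ ≤ 1) (hy : 0 ≤ y * y')
    (h : Rel ρ n x y) (h' : Rel ρ m x' y') : Rel ρ (max n m) (x + x') (y + y') := by
  replace h := h.mono h0 h1 (le_max_left n m)
  replace h' := h'.mono h0 h1 (le_max_right n m)
  rcases mul_nonneg_iff.1 hy with ⟨a, b⟩ | ⟨a, b⟩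
  · exact add_of_nonneg h0 h1 a b h h'
  · have := (add_of_nonneg h0 h1 (neg_nonneg.2 a) (neg_nonneg.2 b) h.neg h'.neg).neg
    simpa [neg_add_rev, add_comm] using this

theorem sqrt (h0 : 0 < ρ) (h1 : ρ ≤ 1) (h : Rel ρ n x y) : Rel ρ n (√x) (√y) := by
  obtain ⟨e, he, hl, hu, rfl⟩ := h
  have hp := pow_pos h0 n
  have hp1 : ρ ^ n ≤ 1 := pow_le_one₀ h0.le h1
  refine ⟨√e, by positivity, ?_, ?_, Real.sqrt_mul he.le _⟩
  · apply Real.le_sqrt_of_sq_le; nlinarith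
  · have : √e * ρ ^ n = √(e * (ρ ^ n) ^ 2) := by
      rw [Real.sqrt_mul he.le, Real.sqrt_sq hp.le]
    rw [this, Real.sqrt_le_iff]; exact ⟨zero_le_one, by nlinarith [mul_pos he hp]⟩

theorem abs (h : Rel ρ n x y) : Rel ρ n |x| |y| := by
  obtain ⟨e, he, hl, hu, rfl⟩ := h
  exact ⟨e, he, hl, hu, by rw [abs_mul, abs_of_pos he]⟩

theorem ne_zero_iff (h : Rel ρ n x y) : x ≠ 0 ↔ y ≠ 0 := by
  obtain ⟨e, he, hl, hu, rfl⟩ := h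
  simp [he.ne']

theorem eq_zero_iff (h : Rel ρ n x y) : x = 0 ↔ y = 0 := not_iff_not.1 h.ne_zero_iff

/-- Closeness of a value that is at least one half of its range, after subtraction from `2`. -/
theorem two_sub (h0 : 4 / 5 ≤ ρ) (h1 : ρ ≤ 1) (hy : 0 ≤ y) (hy1 : y ≤ 1) (h : Rel ρ 2 x y) :
    Rel ρ 4 (2 - x) (2 - y) := by
  obtain ⟨e, he, hl, hu, rfl⟩ := h
  have hy2 : 0 < 2 - y := by linarith
  have hz : 0.64 ≤ ρ ^ 2 := by nlinarith
  have hz1 : ρ ^ 2 ≤ 1 := pow_le_one₀ (by linarith) h1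
  have e4 : ρ ^ 4 = (ρ ^ 2) ^ 2 := by ring
  set z := ρ ^ 2
  have hlow : z ^ 2 * (2 - y) ≤ 2 - e * y := by
    have h3 : e * y * z ≤ y := by nlinarith
    have h4 : z * (z ^ 2 * (2 - y)) ≤ z * (2 - e * y) := by
      nlinarith [mul_nonneg (sub_nonneg.2 hz1) (sub_nonneg.2 hy1), mul_nonneg (sub_nonneg.2 hz1) hy,
        mul_nonneg (mul_nonneg (sub_nonneg.2 hz1) (sub_nonneg.2 hz)) hy2.le,
        mul_nonneg (mul_nonneg (sub_nonneg.2 hz1) (sub_nonneg.2 hz1)) hy2.le]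
    exact le_of_mul_le_mul_left h4 (by linarith)
  refine ⟨(2 - e * y) / (2 - y), ?_, ?_, ?_, by field_simp⟩
  · apply div_pos _ hy2; nlinarith
  · rw [le_div_iff₀ hy2, e4]; exact hlow
  · rw [div_mul_eq_mul_div, div_le_one hy2, e4]
    have h3 : 2 - e * y ≤ 2 - z * y := by nlinarith
    have h4 : (2 - e * y) * z ^ 2 ≤ (2 - z * y) * z ^ 2 :=
      mul_le_mul_of_nonneg_right h3 (sq_nonneg z)
    have h5 : 0 ≤ (1 - y) * (2 * ((1 - z) * (1 + z))) :=
      mul_nonneg (by linarith) (mul_nonneg zero_le_two (mul_nonneg (by linarith) (by linarith)))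
    have h6 : 0 ≤ y * ((1 - z) * (1 + z * (1 - z))) :=
      mul_nonneg hy (mul_nonneg (by linarith)
        (add_nonneg zero_le_one (mul_nonneg (by linarith) (by linarith))))
    nlinarith [h4, h5, h6]

/-- Bernoulli's inequality turns factors into an absolute error. The bound refers to the computed
`x` because the smallness conditions on computed rotations are stated in terms of computed products.
-/
theorem abs_sub_le {u : ℝ} (hu : 0 ≤ u) (hn : n * u ≤ 1 / 2) (h : Rel (1 - u) n x y) :
    |x - y| ≤ 2 * n * u * |x| := by
  obtain ⟨e, he, hl, hh, rfl⟩ := h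
  have hb : 1 - n * u ≤ (1 - u) ^ n := by
    rcases Nat.eq_zero_or_pos n with rfl | hpos
    · simp
    have h1 : (1 : ℝ) ≤ n := by exact_mod_cast hpos
    have := one_add_mul_le_pow (a := -u) (by nlinarith) n
    simpa [sub_eq_add_neg] using this
  have hnu : 0 ≤ n * u := by positivity
  have : |e * y - y| = |e - 1| * |y| := by rw [← abs_mul]; ring_nf
  rw [this, abs_mul, abs_of_pos he, ← mul_assoc]
  gcongr
  rw [abs_le]
  constructor <;> nlinarith

end Rel

section
variable {u : ℝ} (fl : FlArith u)

theorem rel_of_abs_sub_le {x y : ℝ} (hu : 0 ≤ u) (hu1 : u ≤ 1 / 5) (h : |x - y| ≤ u * |y|) :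
    Rel (1 - u) 1 x y := by
  by_cases hy : y = 0
  · subst hy
    have : x = 0 := by simpa using h
    subst this
    exact Rel.refl (by linarith) (by linarith) 1 0
  · have hy' : 0 < |y| := abs_pos.2 hy
    have h2 : |x / y - 1| ≤ u := by
      rw [div_sub_one hy, abs_div, div_le_iff₀ hy']; exact h
    rw [abs_le] at h2
    exact ⟨x / y, by linarith, by simp; linarith, by rw [pow_one]; nlinarith, by field_simp⟩

variable {n m : ℕ} {x y x' y' : ℝ}

theorem FlArith.rel_mul (hu : 0 ≤ u) (hu1 : u ≤ 1 / 5) (h : Rel (1 - u) n x y)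
    (h' : Rel (1 - u) m x' y') : Rel (1 - u) (n + m + 1) (fl.mul x x') (y * y') := by
  rw [add_comm]
  exact (rel_of_abs_sub_le hu hu1 (fl.mul_err _ _)).trans (by linarith) (h.mul (by linarith) h')

theorem FlArith.rel_div (hu : 0 ≤ u) (hu1 : u ≤ 1 / 5) (hy : y' ≠ 0) (h : Rel (1 - u) n x y)
    (h' : Rel (1 - u) m x' y') : Rel (1 - u) (n + m + 1) (fl.div x x') (y / y') := by
  rw [add_comm]
  exact (rel_of_abs_sub_le hu hu1 (fl.div_err _ _ (h'.ne_zero_iff.2 hy))).trans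
    (by linarith) (h.div (by linarith) h')

theorem FlArith.rel_add (hu : 0 ≤ u) (hu1 : u ≤ 1 / 5) (hy : 0 ≤ y * y') (h : Rel (1 - u) n x y)
    (h' : Rel (1 - u) m x' y') : Rel (1 - u) (max n m + 1) (fl.add x x') (y + y') := by
  rw [add_comm]
  exact (rel_of_abs_sub_le hu hu1 (fl.add_err _ _)).trans
    (by linarith) (h.add (by linarith) (by linarith) hy h')

theorem FlArith.rel_sqrt (hu : 0 ≤ u) (hu1 : u ≤ 1 / 5) (hy : 0 ≤ y) (h : Rel (1 - u) n x y) :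
    Rel (1 - u) (n + 1) (fl.sqrt x) (√y) := by
  rw [add_comm]
  have hx : 0 ≤ x := by
    obtain ⟨e, he, -, -, rfl⟩ := h
    positivity
  refine (rel_of_abs_sub_le hu hu1 ?_).trans
    (by linarith) (h.sqrt (by linarith) (by linarith))
  rw [abs_of_nonneg (Real.sqrt_nonneg x)]
  exact fl.sqrt_err _ hx

end

/-! ### Componentwise accuracy of xLASV2 -/

/-- The off-diagonal entries of `!![c, -s; s, c]ᵀ * !![f, g; 0, h] * !![x, -y; y, x]` are small
relative to the sums of the absolute values of their terms. -/
def SmallOffDiag (δ f g h c s x y : ℝ) : Prop :=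
  |-(c * f * y) + c * g * x + s * h * x| ≤ δ * (|c * f * y| + |c * g * x| + |s * h * x|) ∧
  |s * f * x + s * g * y - c * h * y| ≤ δ * (|s * f * x| + |s * g * y| + |c * h * y|)

/-- Reflection in the antidiagonal exchanges `f` with `h` and left with right vectors. It covers the
case in which xLASV2 first reorders its input. -/
theorem SmallOffDiag.swap {δ f g h c s x y : ℝ} (H : SmallOffDiag δ f g h c s x y) :
    SmallOffDiag δ h g f y x s c := by
  obtain ⟨h1, h2⟩ := H
  constructor
  · convert h2 using 1
    · congr 1; ring
    · rw [mul_comm (y * h), mul_comm (y * g), mul_comm (x * f)]; ring_nf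
  · convert h1 using 1
    · congr 1; ring
    · ring_nf

/-- The tangent computed by `xLASV2` in exact arithmetic solves the quadratic equation for the
right singular vector. -/
theorem lasv2_quadratic {p m s r a t : ℝ} (hp : 0 ≤ p) (hp1 : p ≤ 1) (hm : m ≠ 0)
    (hs : s = √((2 - (1 - p)) * (2 - (1 - p)) + m * m)) (hr : r = √((1 - p) * (1 - p) + m * m))
    (ha : a = 1 / 2 * (s + r))
    (ht : t = (m / (s + (2 - (1 - p))) + m / (r + (1 - p))) * (1 + a)) :
    m * t ^ 2 + 2 * (1 - m ^ 2 - p ^ 2) * t - 4 * m = 0 := by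
  have hm2 : 0 < m * m := mul_self_pos.2 hm
  have hs2 : s ^ 2 = (1 + p) ^ 2 + m ^ 2 := by
    rw [hs, Real.sq_sqrt (add_nonneg (mul_self_nonneg _) hm2.le)]; ring
  have hr2 : r ^ 2 = (1 - p) ^ 2 + m ^ 2 := by
    rw [hr, Real.sq_sqrt (add_nonneg (mul_self_nonneg _) hm2.le)]; ring
  have hs0 : 0 < s := by
    rw [hs]; exact Real.sqrt_pos.2 (add_pos_of_nonneg_of_pos (mul_self_nonneg _) hm2)
  have hr0 : 0 < r := by
    rw [hr]; exact Real.sqrt_pos.2 (add_pos_of_nonneg_of_pos (mul_self_nonneg _) hm2)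
  have h1 : m / (s + (2 - (1 - p))) = (s - (1 + p)) / m := by
    rw [div_eq_div_iff (by linarith) hm]; nlinarith
  have h2 : m / (r + (1 - p)) = (r - (1 - p)) / m := by
    rw [div_eq_div_iff (by linarith) hm]; nlinarith
  have h3 : t * m = s * r - (1 - m ^ 2 - p ^ 2) := by
    rw [ht, h1, h2, ha]; field_simp; nlinarith
  have h4 : (s * r) ^ 2 = (1 - m ^ 2 - p ^ 2) ^ 2 + 4 * m ^ 2 := by
    rw [mul_pow, hs2, hr2]; ring
  have h5 : m * (m * t ^ 2 + 2 * (1 - m ^ 2 - p ^ 2) * t - 4 * m) = 0 := by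
    linear_combination h4 + (t * m + (s * r - (1 - m ^ 2 - p ^ 2)) + 2 * (1 - m^2 - p^2)) * h3
  exact (mul_eq_zero.1 h5).resolve_left hm

/-- In the generic branch the computed singular vectors are componentwise close to vectors that
diagonalize exactly. -/
theorem lasv2Core_generic {u : ℝ} (fl : FlArith u) (hu : 0 ≤ u) (hu1 : u ≤ 1 / 5) {f g h : ℝ}
    (hf : f ≠ 0) (hg : g ≠ 0) (hfh : |h| ≤ |f|) (hb : ¬ (|f| < |g| ∧ fl.div |f| |g| < u)) :
    ∃ c s x y, Rel (1 - u) 125 (lasv2Core fl f g h).1 c ∧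
      Rel (1 - u) 125 (lasv2Core fl f g h).2.1 s ∧ Rel (1 - u) 72 (lasv2Core fl f g h).2.2.1 x ∧
      Rel (1 - u) 106 (lasv2Core fl f g h).2.2.2 y ∧
      -(c * f * y) + c * g * x + s * h * x = 0 ∧ s * f * x + s * g * y - c * h * y = 0 ∧
      0 < c ∧ 0 < x ∧ 0 < y * (f * g) := by
  have h0 : 0 < 1 - u := by linarith
  have h1 : 1 - u ≤ 1 := by linarith
  have hf' : 0 < |f| := abs_pos.2 hf
  generalize hw : lasv2Core fl f g h = w
  unfold lasv2Core at hw
  rw [if_neg hg, if_neg hb] at hw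
  extract_lets d l m T mm tt s r a t L x y c z at hw
  subst hw
  obtain ⟨p, hp⟩ : ∃ p, p = |h| / |f| := ⟨_, rfl⟩
  have hp0 : 0 ≤ p := by rw [hp]; positivity
  have hp1 : p ≤ 1 := by rw [hp, div_le_one hf']; exact hfh
  obtain ⟨m', hm'⟩ : ∃ m', m' = g / f := ⟨_, rfl⟩
  have hm0 : m' ≠ 0 := by rw [hm']; positivity
  have hmm0 : 0 < m' * m' := mul_self_pos.2 hm0
  obtain ⟨s', hs'⟩ : ∃ s', s' = √((2 - (1 - p)) * (2 - (1 - p)) + m' * m') := ⟨_, rfl⟩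
  obtain ⟨r', hr'⟩ : ∃ r', r' = √((1 - p) * (1 - p) + m' * m') := ⟨_, rfl⟩
  obtain ⟨a', ha'⟩ : ∃ a', a' = 1 / 2 * (s' + r') := ⟨_, rfl⟩
  obtain ⟨t', ht'⟩ : ∃ t', t' = (m' / (s' + (2 - (1 - p))) + m' / (r' + (1 - p))) * (1 + a') :=
    ⟨_, rfl⟩
  have hquad := lasv2_quadratic hp0 hp1 hm0 hs' hr' ha' ht'
  have hs0 : 0 < s' := by
    rw [hs']; exact Real.sqrt_pos.2 (add_pos_of_nonneg_of_pos (mul_self_nonneg _) hmm0)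
  have hr0 : 0 < r' := by
    rw [hr']; exact Real.sqrt_pos.2 (add_pos_of_nonneg_of_pos (mul_self_nonneg _) hmm0)
  have ha0 : 0 < a' := by rw [ha']; positivity
  have hk : 0 < 1 / (s' + (2 - (1 - p))) + 1 / (r' + (1 - p)) := by
    have : 0 < s' + (2 - (1 - p)) := by linarith
    have : 0 < r' + (1 - p) := by linarith
    positivity
  have htm : t' = m' * ((1 / (s' + (2 - (1 - p))) + 1 / (r' + (1 - p))) * (1 + a')) := by
    rw [ht']; ring
  have htm0 : 0 < t' * m' := by
    rw [htm, mul_right_comm]; positivity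
  have hm : Rel (1 - u) 1 m m' := by
    rw [hm']; exact rel_of_abs_sub_le hu hu1 (fl.div_err _ _ hf)
  have hd : Rel (1 - u) 1 d (|f| - |h|) := rel_of_abs_sub_le hu hu1 (fl.sub_err _ _)
  have hpl : 1 - p = (|f| - |h|) / |f| := by rw [hp]; field_simp
  have hl : Rel (1 - u) 2 l (1 - p) := by
    rw [hpl]
    -- The shortcut `l = 1` agrees with the quotient `d / |f|`, so both cases carry the same error
    -- bound.
    by_cases hdf : d = |f|
    · have : l = d / |f| := by simp only [l, if_pos hdf, hdf]; field_simp
      rw [this]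
      exact (hd.div h0 (Rel.refl h1 h0 1 |f|))
    · have : l = fl.div d |f| := if_neg hdf
      rw [this]
      exact fl.rel_div hu hu1 hf'.ne' hd (Rel.refl h1 h0 0 |f|)
  have hT : Rel (1 - u) 5 T (2 - (1 - p)) := by
    have e1 : Rel (1 - u) 1 T (2 - l) := rel_of_abs_sub_le hu hu1 (fl.sub_err _ _)
    exact e1.trans h0 (hl.two_sub (by linarith) h1 (by linarith) (by linarith))
  have hmm : Rel (1 - u) 3 mm (m' * m') := fl.rel_mul hu hu1 hm hm
  have htt : Rel (1 - u) 11 tt _ := fl.rel_mul hu hu1 hT hT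
  have hs : Rel (1 - u) 13 s s' := by
    rw [hs']
    exact fl.rel_sqrt hu hu1 (add_nonneg (mul_self_nonneg _) hmm0.le)
      (fl.rel_add hu hu1 (mul_nonneg (mul_self_nonneg _) hmm0.le) htt hmm)
  have hr : Rel (1 - u) 7 r r' := by
    rw [hr']
    by_cases hl0 : l = 0
    · have e1 : 1 - p = 0 := hl.eq_zero_iff.1 hl0
      have : r = |m| := if_pos hl0
      rw [this, e1, zero_mul, zero_add, Real.sqrt_mul_self_eq_abs]
      exact hm.abs.mono h0 h1 (by norm_num)
    · have : r = fl.sqrt (fl.add (fl.mul l l) mm) := if_neg hl0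
      rw [this]
      exact fl.rel_sqrt hu hu1 (by positivity)
        (fl.rel_add hu hu1 (by positivity) (fl.rel_mul hu hu1 hl hl) hmm)
  have hp2 : 0 < 2 - (1 - p) := by linarith
  have hp3 : 0 ≤ 1 - p := by linarith
  have ha : Rel (1 - u) 15 a a' := by
    rw [ha']
    exact fl.rel_mul hu hu1 (Rel.refl h1 h0 0 _) (fl.rel_add hu hu1 (by positivity) hs hr)
  have ht : Rel (1 - u) 34 t t' := by
    -- Without underflow the computed square `mm` is nonzero when `g` is, so the fallback formula
    -- for `mm = 0` is never reached.
    have : t = fl.mul (fl.add (fl.div m (fl.add s T)) (fl.div m (fl.add r l))) (fl.add 1 a) :=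
      if_neg (hmm.ne_zero_iff.2 hmm0.ne')
    rw [this, ht']
    refine fl.rel_mul hu hu1 (n := 17) (m := 16) (fl.rel_add hu hu1 (n := 16) (m := 10) ?_ ?_ ?_) ?_
    · rw [div_mul_div_comm]; positivity
    · exact fl.rel_div hu hu1 (by positivity) hm (fl.rel_add hu hu1 (by positivity) hs hT)
    · exact fl.rel_div hu hu1 (by positivity) hm (fl.rel_add hu hu1 (by positivity) hr hl)
    · exact fl.rel_add hu hu1 (by positivity) (Rel.refl h1 h0 0 _) ha
  have ht4 : 0 < t' * t' + 4 := by have := mul_self_nonneg t'; linarith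
  have hL : Rel (1 - u) 71 L (√(t' * t' + 4)) :=
    fl.rel_sqrt hu hu1 ht4.le (fl.rel_add hu hu1 (by have := mul_self_nonneg t'; linarith)
      (fl.rel_mul hu hu1 ht ht) (Rel.refl h1 h0 0 _))
  set L' := √(t' * t' + 4)
  have hL0 : 0 < L' := Real.sqrt_pos.2 ht4
  have hx : Rel (1 - u) 72 x (2 / L') := fl.rel_div hu hu1 hL0.ne' (Rel.refl h1 h0 0 _) hL
  have hy : Rel (1 - u) 106 y (t' / L') := fl.rel_div hu hu1 hL0.ne' ht hL
  have hym : 0 < t' / L' * m' := by rw [div_mul_eq_mul_div]; positivity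
  have hx0 : 0 < 2 / L' := by positivity
  have hc : Rel (1 - u) 125 c ((2 / L' + t' / L' * m') / a') :=
    fl.rel_div hu hu1 ha0.ne' (fl.rel_add hu hu1 (by positivity) hx (fl.rel_mul hu hu1 hy hm)) ha
  have hz : Rel (1 - u) 124 z (h / f * (t' / L') / a') :=
    fl.rel_div hu hu1 ha0.ne'
      (fl.rel_mul hu hu1 (n := 1) (rel_of_abs_sub_le hu hu1 (fl.div_err _ _ hf)) hy) ha
  refine ⟨_, _, _, _, hc, hz.mono h0 h1 (by norm_num), hx, hy, ?_, ?_, ?_, hx0, ?_⟩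
  · have hg' : g = m' * f := by rw [hm']; field_simp
    have hh : h * h = p ^ 2 * f ^ 2 := by
      rw [hp, div_pow, sq_abs, sq_abs]; field_simp
    -- Up to the factor `f / a'` this is the first equation. Since the right vector has tangent `t'
    -- / 2`, it reduces to the quadratic equation for `t'`.
    have key : -((2 / L' + t' / L' * m') * (t' / L')) + (2 / L' + t' / L' * m') * m' * (2 / L')
        + p ^ 2 * (t' / L') * (2 / L') = 0 := by
      field_simp
      linear_combination -hquad
    have e2 : h / f * (t' / L') / a' * h * (2 / L') = f * (p ^ 2 * (t' / L') * (2 / L')) / a' := by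
      have : h / f * h = p ^ 2 * f := by rw [div_mul_eq_mul_div, hh]; field_simp
      calc _ = (h / f * h) * (t' / L') * (2 / L') / a' := by ring
        _ = _ := by rw [this]; ring
    rw [e2, hg']
    calc _ = f / a' * (-((2 / L' + t' / L' * m') * (t' / L'))
              + (2 / L' + t' / L' * m') * m' * (2 / L') + p ^ 2 * (t' / L') * (2 / L')) := by ring
      _ = 0 := by rw [key, mul_zero]
  · rw [hm']; field_simp; ring
  · positivity
  · have hfg : f * g = m' * (f * f) := by rw [hm']; field_simp
    rw [hfg, ← mul_assoc]
    have := mul_self_pos.2 hf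
    positivity

theorem abs_sum_le_of_rel {u : ℝ} (hu : 0 ≤ u) {n : ℕ} (hn : n * u ≤ 1 / 2)
    {x y z x' y' z' : ℝ} (hx : Rel (1 - u) n x x') (hy : Rel (1 - u) n y y')
    (hz : Rel (1 - u) n z z') (h : x' + y' + z' = 0) :
    |x + y + z| ≤ 2 * n * u * (|x| + |y| + |z|) := by
  have h1 := hx.abs_sub_le hu hn
  have h2 := hy.abs_sub_le hu hn
  have h3 := hz.abs_sub_le hu hn
  calc |x + y + z| = |(x - x') + (y - y') + (z - z')| := by
        congr 1; linarith
    _ ≤ |x - x'| + |y - y'| + |z - z'| := abs_add_three _ _ _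
    _ ≤ _ := by linarith

/-- The constant 480 is twice 240, a bound for the number of error factors in a product of one left
and one right component. The sign and nonvanishing conclusions survive rounding since relative
errors preserve signs; they are needed for singular `M`, where they exclude cancellation. -/
theorem lasv2Core_spec {u : ℝ} (fl : FlArith u) (hu : 0 < u) (hu1 : u ≤ 1 / 1000) {f g h : ℝ}
    (hfh : |h| ≤ |f|) {c s x y : ℝ} (hw : lasv2Core fl f g h = (c, s, x, y)) :
    SmallOffDiag (480 * u) f g h c s x y ∧ c ≠ 0 ∧ (x ≠ 0 ∨ y ≠ 0) ∧
      0 ≤ x * f * (y * g) ∧ (f ≠ 0 → x ≠ 0) ∧ (g ≠ 0 → y ≠ 0) := by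
  have h0 : 0 < 1 - u := by linarith
  have h1 : 1 - u ≤ 1 := by linarith
  by_cases hg : g = 0
  · simp only [lasv2Core, if_pos hg, Prod.mk.injEq] at hw
    obtain ⟨rfl, rfl, rfl, rfl⟩ := hw
    subst hg
    simp [SmallOffDiag]
  by_cases hb : |f| < |g| ∧ fl.div |f| |g| < u
  · simp only [lasv2Core, if_neg hg, if_pos hb, Prod.mk.injEq] at hw
    obtain ⟨rfl, rfl, rfl, rfl⟩ := hw
    have hg' := abs_pos.2 hg
    have rx : Rel (1 - u) 1 (fl.div f g) (f / g) :=
      rel_of_abs_sub_le hu.le (by linarith) (fl.div_err _ _ hg)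
    have rs : Rel (1 - u) 1 (fl.div h g) (h / g) :=
      rel_of_abs_sub_le hu.le (by linarith) (fl.div_err _ _ hg)
    refine ⟨?_, one_ne_zero, Or.inr one_ne_zero, ?_, ?_, fun _ => one_ne_zero⟩
    · have e1 := fl.div_err f g hg
      have e2 := fl.div_err h g hg
      have e3 := fl.div_err |f| |g| hg'.ne'
      set X := fl.div f g
      set S := fl.div h g
      -- The computed quotient is below `u`, and its own relative error at most doubles the bound.
      have hq : |f| / |g| ≤ 2 * u := by
        have hq0 : 0 ≤ |f| / |g| := by positivity
        rw [abs_of_nonneg hq0, abs_le] at e3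
        nlinarith [e3.1, hb.2]
      have hfg : |f| ≤ 2 * u * |g| := by rwa [div_le_iff₀ hg'] at hq
      have a1 : |X * g - f| ≤ u * |f| := by
        have : X * g - f = (X - f / g) * g := by field_simp
        rw [this, abs_mul]
        calc _ ≤ u * |f / g| * |g| := by gcongr
          _ = u * |f| := by rw [abs_div]; field_simp
      have a2 : |S * g - h| ≤ u * |h| := by
        have : S * g - h = (S - h / g) * g := by field_simp
        rw [this, abs_mul]
        calc _ ≤ u * |h / g| * |g| := by gcongr
          _ = u * |h| := by rw [abs_div]; field_simp
      have hX : |X| * |g| ≤ 2 * |f| := by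
        rw [← abs_mul]
        have := abs_sub_abs_le_abs_sub (X * g) f
        nlinarith [abs_nonneg f]
      have hS : |S| * |g| ≤ 2 * |h| := by
        rw [← abs_mul]
        have := abs_sub_abs_le_abs_sub (S * g) h
        nlinarith [abs_nonneg h]
      have hX1 : |X| ≤ 4 * u := by
        have : |X| * |g| ≤ 4 * u * |g| := by linarith
        exact le_of_mul_le_mul_right this hg'
      have hS1 : |S| ≤ 4 * u := by
        have : |S| * |g| ≤ 4 * u * |g| := by linarith
        exact le_of_mul_le_mul_right this hg'
      have hX2 : |X| ≤ 1 := by linarith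
      constructor
      · have b1 : |S * h * X| ≤ 4 * u * |f| := by
          rw [abs_mul, abs_mul]
          calc |S| * |h| * |X| ≤ 4 * u * |f| * 1 := by gcongr
            _ = _ := by ring
        have b2 : |(1 * f * 1 : ℝ)| = |f| := by simp
        calc _ = |(X * g - f) + S * h * X| := by congr 1; ring
          _ ≤ |X * g - f| + |S * h * X| := abs_add_le _ _
          _ ≤ 480 * u * |f| := by nlinarith [abs_nonneg f]
          _ ≤ _ := by
            rw [b2]
            gcongr
            linarith [abs_nonneg (1 * g * X), abs_nonneg (S * h * X)]
      · have b1 : |S * f * X| ≤ 16 * u * |h| := by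
          rw [abs_mul, abs_mul]
          calc |S| * |f| * |X| ≤ |S| * (2 * u * |g|) * 1 := by gcongr
            _ = 2 * u * (|S| * |g|) := by ring
            _ ≤ 2 * u * (2 * |h|) := by gcongr
            _ ≤ _ := by nlinarith [abs_nonneg h]
        have b2 : |(1 * h * 1 : ℝ)| = |h| := by simp
        calc _ = |(S * g - h) + S * f * X| := by congr 1; ring
          _ ≤ |S * g - h| + |S * f * X| := abs_add_le _ _
          _ ≤ 480 * u * |h| := by nlinarith [abs_nonneg h]
          _ ≤ _ := by
            rw [b2]
            gcongr
            linarith [abs_nonneg (S * f * X), abs_nonneg (S * g * 1)]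
    · obtain ⟨e, he, -, -, hX⟩ := rx
      rw [hX]
      have : e * (f / g) * f * (1 * g) = e * (f * f) := by field_simp
      rw [this]
      exact mul_nonneg he.le (mul_self_nonneg f)
    · intro hf
      exact rx.ne_zero_iff.2 (div_ne_zero hf hg)
  -- For `f = 0` the computed quotient is exactly 0, hence below `u`, and the previous branch
  -- applies; this is where `u > 0` enters.
  · have hf : f ≠ 0 := by
      rintro rfl
      apply hb
      have e3 := fl.div_err |0| |g| (abs_pos.2 hg).ne'
      rw [abs_zero, zero_div, sub_zero, abs_zero, mul_zero, abs_nonpos_iff] at e3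
      rw [abs_zero, e3]
      exact ⟨abs_pos.2 hg, hu⟩
    obtain ⟨c', s', x', y', hc, hs, hx, hy, z1, z2, hc0, hx0, hy0⟩ :=
      lasv2Core_generic fl hu.le (by linarith) hf hg hfh hb
    rw [hw] at hc hs hx hy
    have hfg : f * g ≠ 0 := mul_ne_zero hf hg
    have hy' : y' ≠ 0 := by rintro rfl; simp at hy0
    have t3 : ∀ {n m k : ℕ} {a b d a' b' : ℝ}, Rel (1 - u) n a a' → Rel (1 - u) m b b' →
        n + 0 + m ≤ k → Rel (1 - u) k (a * d * b) (a' * d * b') := fun ha hb hk =>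
      ((ha.mul h0 (Rel.refl h1 h0 0 _)).mul h0 hb).mono h0 h1 hk
    have hnu : ((240 : ℕ) : ℝ) * u ≤ 1 / 2 := by push_cast; linarith
    refine ⟨⟨?_, ?_⟩, hc.ne_zero_iff.2 hc0.ne', Or.inl (hx.ne_zero_iff.2 hx0.ne'), ?_,
      fun _ => hx.ne_zero_iff.2 hx0.ne', fun _ => hy.ne_zero_iff.2 hy'⟩
    · have := abs_sum_le_of_rel hu.le hnu (t3 hc hy (d := f) (by norm_num)).neg
        (t3 hc hx (d := g) (by norm_num)) (t3 hs hx (d := h) (by norm_num)) z1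
      rw [abs_neg] at this
      refine this.trans_eq ?_
      push_cast; ring
    · have := abs_sum_le_of_rel hu.le hnu (t3 hs hx (d := f) (by norm_num))
        (t3 hs hy (d := g) (by norm_num)) (t3 hc hy (d := h) (by norm_num)).neg (by linarith)
      rw [abs_neg, ← sub_eq_add_neg] at this
      refine this.trans_eq ?_
      push_cast; ring
    · obtain ⟨e, he, -, -, rfl⟩ := hx
      obtain ⟨e', he', -, -, rfl⟩ := hy
      have : e * x' * f * (e' * y' * g) = e * x' * e' * (y' * (f * g)) := by ring
      rw [this]
      positivity


/-- The matrix `!![c, -s; s, c]`, a rotation if `c ^ 2 + s ^ 2 = 1`. -/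
def rot (c s : ℝ) : Mat2 := !![c, -s; s, c]

theorem rot_mul_J (c s : ℝ) : rot c s * J = rot s (-c) := by
  ext i j; fin_cases i <;> fin_cases j <;> simp [rot, J, Matrix.mul_apply]

/-- A quarter turn of both `U` and `V` merely interchanges the two off-diagonal entries, up to sign.
It serves both the optional flip and the second index. -/
theorem SmallOffDiag.rot {δ f g h c s x y : ℝ} (H : SmallOffDiag δ f g h c s x y) :
    SmallOffDiag δ f g h s (-c) y (-x) := by
  obtain ⟨h1, h2⟩ := H
  constructor
  · convert h2 using 1
    · congr 1; ring
    · simp only [mul_neg, neg_mul, abs_neg]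
  · convert h1 using 1
    · congr 1; ring
    · simp only [mul_neg, neg_mul, abs_neg]

/-- For `f = 0` the first left vector follows the only nonzero column `(g, h)` in sign, and for `h =
0` the right vector follows the row `(f, g)`. This replaces the two-index argument when a row or
column is explicitly zeroed. -/
theorem lasv2_spec {u : ℝ} (fl : FlArith u) (hu : 0 < u) (hu1 : u ≤ 1 / 1000) (f g h : ℝ) :
    ∃ c s x y, lasv2 fl f g h = (rot c s, rot x y) ∧ SmallOffDiag (480 * u) f g h c s x y ∧
      (c ≠ 0 ∨ s ≠ 0) ∧ (x ≠ 0 ∨ y ≠ 0) ∧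
      (f = 0 → 0 ≤ c * g * (s * h) ∧ (g ≠ 0 → c ≠ 0) ∧ (h ≠ 0 → s ≠ 0)) ∧
      (h = 0 → 0 ≤ x * f * (y * g) ∧ (f ≠ 0 → x ≠ 0) ∧ (g ≠ 0 → y ≠ 0)) := by
  by_cases hfh : |f| < |h|
  · obtain ⟨c, s, x, y, hw⟩ : ∃ c s x y, lasv2Core fl h g f = (c, s, x, y) :=
      ⟨_, _, _, _, rfl⟩
    obtain ⟨h1, h2, h3, h4, h5, h6⟩ := lasv2Core_spec fl hu hu1 hfh.le hw
    refine ⟨y, x, s, c, ?_, h1.swap, h3.symm, Or.inr h2, fun _ => ⟨by linarith, h6, h5⟩, ?_⟩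
    · simp only [lasv2, if_pos hfh, hw, RSVD.rot]
    · rintro rfl
      simp only [abs_zero] at hfh
      exact absurd hfh (abs_nonneg f).not_gt
  · obtain ⟨c, s, x, y, hw⟩ : ∃ c s x y, lasv2Core fl f g h = (c, s, x, y) :=
      ⟨_, _, _, _, rfl⟩
    obtain ⟨h1, h2, h3, h4, h5, h6⟩ := lasv2Core_spec fl hu hu1 (not_lt.1 hfh) hw
    refine ⟨c, s, x, y, ?_, h1, Or.inl h2, h3, ?_, fun _ => ⟨h4, h5, h6⟩⟩
    · simp only [lasv2, if_neg hfh, hw, RSVD.rot]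
    · rintro rfl
      have : h = 0 := by simpa using hfh
      subst this
      exact ⟨by simp, fun _ => h2, fun h => absurd rfl h⟩

/-! ### Rounding errors in C adj(A) B -/

section
variable {u : ℝ} (fl : FlArith u)

theorem FlArith.mul_zero' (x : ℝ) : fl.mul x 0 = 0 := by
  have := fl.mul_err x 0
  simpa using this

theorem FlArith.zero_mul' (x : ℝ) : fl.mul 0 x = 0 := by
  have := fl.mul_err 0 x
  simpa using this

theorem FlArith.add_eq_zero_iff (hu1 : u ≤ 1 / 5) (x y : ℝ) : fl.add x y = 0 ↔ x + y = 0 := by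
  have h := fl.add_err x y
  constructor <;> intro h0
  · rw [h0, zero_sub, abs_neg] at h
    have := abs_nonneg (x + y)
    exact abs_eq_zero.1 (by nlinarith)
  · rw [h0, abs_zero, mul_zero, sub_zero] at h
    exact abs_nonpos_iff.1 h

/-- The error of a computed sum of two products. -/
theorem FlArith.dot_err (hu : 0 ≤ u) (hu1 : u ≤ 1 / 5) (a b c d : ℝ) :
    |fl.add (fl.mul a b) (fl.mul c d) - (a * b + c * d)| ≤ 3 * u * (|a * b| + |c * d|) := by
  have e1 := fl.mul_err a b
  have e2 := fl.mul_err c d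
  have e3 := fl.add_err (fl.mul a b) (fl.mul c d)
  set p := fl.mul a b
  set q := fl.mul c d
  have h1 : |p + q - (a * b + c * d)| ≤ u * (|a * b| + |c * d|) := by
    calc _ = |(p - a * b) + (q - c * d)| := by congr 1; ring
      _ ≤ |p - a * b| + |q - c * d| := abs_add_le _ _
      _ ≤ _ := by linarith
  have h2 : |p + q| ≤ (1 + u) * (|a * b| + |c * d|) := by
    have := abs_sub_abs_le_abs_sub (p + q) (a * b + c * d)
    have := abs_add_le (a * b) (c * d)
    linarith
  have h3 : 0 ≤ |a * b| + |c * d| := by positivity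
  calc _ = |(fl.add p q - (p + q)) + (p + q - (a * b + c * d))| := by congr 1; ring
    _ ≤ |fl.add p q - (p + q)| + |p + q - (a * b + c * d)| := abs_add_le _ _
    _ ≤ u * ((1 + u) * (|a * b| + |c * d|)) + u * (|a * b| + |c * d|) :=
      add_le_add (e3.trans (by gcongr)) h1
    _ ≤ _ := by nlinarith [mul_nonneg hu h3]

theorem FlArith.mul3_err (hu : 0 ≤ u) (hu1 : u ≤ 1 / 5) (a b c : ℝ) :
    |fl.mul (fl.mul a b) c - a * b * c| ≤ 3 * u * |a * b * c| := by
  have e1 := fl.mul_err a b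
  have e2 := fl.mul_err (fl.mul a b) c
  set p := fl.mul a b
  have h1 : |p * c - a * b * c| ≤ u * |a * b * c| := by
    rw [← sub_mul, abs_mul, abs_mul (a * b), ← mul_assoc]; gcongr
  have h2 : |p * c| ≤ (1 + u) * |a * b * c| := by
    have := abs_sub_abs_le_abs_sub (p * c) (a * b * c)
    linarith
  have h3 := abs_nonneg (a * b * c)
  calc _ = |(fl.mul p c - p * c) + (p * c - a * b * c)| := by congr 1; ring
    _ ≤ |fl.mul p c - p * c| + |p * c - a * b * c| := abs_add_le _ _
    _ ≤ u * ((1 + u) * |a * b * c|) + u * |a * b * c| :=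
      add_le_add (e2.trans (by gcongr)) h1
    _ ≤ _ := by nlinarith [mul_nonneg hu h3]

theorem FlArith.mul3_err' (hu : 0 ≤ u) (hu1 : u ≤ 1 / 5) (a b c : ℝ) :
    |fl.mul a (fl.mul b c) - a * b * c| ≤ 3 * u * |a * b * c| := by
  have e1 := fl.mul_err b c
  have e2 := fl.mul_err a (fl.mul b c)
  set p := fl.mul b c
  have h1 : |a * p - a * b * c| ≤ u * |a * b * c| := by
    rw [mul_assoc, ← mul_sub, abs_mul, abs_mul a, mul_left_comm]; gcongr
  have h2 : |a * p| ≤ (1 + u) * |a * b * c| := by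
    have := abs_sub_abs_le_abs_sub (a * p) (a * b * c)
    linarith
  have h3 := abs_nonneg (a * b * c)
  calc _ = |(fl.mul a p - a * p) + (a * p - a * b * c)| := by congr 1; ring
    _ ≤ |fl.mul a p - a * p| + |a * p - a * b * c| := abs_add_le _ _
    _ ≤ u * ((1 + u) * |a * b * c|) + u * |a * b * c| :=
      add_le_add (e2.trans (by gcongr)) h1
    _ ≤ _ := by nlinarith [mul_nonneg hu h3]

/-- The error of the computed off-diagonal entry of `C adj(A) B`. -/
theorem FlArith.prodM_err (hu : 0 ≤ u) (hu1 : u ≤ 1 / 1000) (A B C : Mat2) :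
    |prodM fl A B C 0 1 -
      (C 0 0 * A 1 1 * B 0 1 + C 0 1 * A 0 0 * B 1 1 - C 0 0 * A 0 1 * B 1 1)| ≤
    6 * u * (|C 0 0 * A 1 1 * B 0 1| + |C 0 1 * A 0 0 * B 1 1| + |C 0 0 * A 0 1 * B 1 1|) := by
  have e1 := fl.mul3_err hu (by linarith) (C 0 0) (A 1 1) (B 0 1)
  have e2 := fl.mul3_err' hu (by linarith) (C 0 1) (A 0 0) (B 1 1)
  have e3 := fl.mul3_err hu (by linarith) (C 0 0) (A 0 1) (B 1 1)
  have hM : prodM fl A B C 0 1 = fl.sub (fl.add (fl.mul (fl.mul (C 0 0) (A 1 1)) (B 0 1))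
    (fl.mul (C 0 1) (fl.mul (A 0 0) (B 1 1)))) (fl.mul (fl.mul (C 0 0) (A 0 1)) (B 1 1)) := by
    simp [prodM]
  rw [hM]
  generalize fl.mul (fl.mul (C 0 0) (A 1 1)) (B 0 1) = p at *
  generalize fl.mul (C 0 1) (fl.mul (A 0 0) (B 1 1)) = q at *
  generalize fl.mul (fl.mul (C 0 0) (A 0 1)) (B 1 1) = r at *
  generalize C 0 0 * A 1 1 * B 0 1 = p' at *
  generalize C 0 1 * A 0 0 * B 1 1 = q' at *
  generalize C 0 0 * A 0 1 * B 1 1 = r' at *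
  have e4 := fl.add_err p q
  set w := fl.add p q
  have e5 := fl.sub_err w r
  have hp := abs_sub_abs_le_abs_sub p p'
  have hq := abs_sub_abs_le_abs_sub q q'
  have hr := abs_sub_abs_le_abs_sub r r'
  have hpq := abs_add_le p q
  have hw := abs_sub_abs_le_abs_sub w (p + q)
  have hwr := abs_sub w r
  have p0 := abs_nonneg p'
  have q0 := abs_nonneg q'
  have r0 := abs_nonneg r'
  have k1 : |p + q| ≤ 1.003 * (|p'| + |q'|) := by nlinarith
  have k2 : |w| + |r| ≤ 1.01 * (|p'| + |q'| + |r'|) := by nlinarith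
  calc |fl.sub w r - (p' + q' - r')|
      = |(fl.sub w r - (w - r)) + (w - (p + q)) + ((p - p') + (q - q') - (r - r'))| := by
        congr 1; ring
    _ ≤ |fl.sub w r - (w - r)| + |w - (p + q)| + (|p - p'| + |q - q'| + |r - r'|) := by
        refine (abs_add_three _ _ _).trans ?_
        gcongr
        exact (abs_sub _ _).trans (by gcongr; exact abs_add_le _ _)
    _ ≤ u * (1.01 * (|p'| + |q'| + |r'|)) + u * (1.003 * (|p'| + |q'|)) +
        (3 * u * |p'| + 3 * u * |q'| + 3 * u * |r'|) := by
        gcongr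
        · exact e5.trans (by gcongr; linarith)
        · exact e4.trans (by gcongr)
    _ ≤ _ := by nlinarith [mul_nonneg hu p0, mul_nonneg hu q0, mul_nonneg hu r0]

/-- The exact entry `g'` may suffer cancellation, so its error is measured against the majorant `G`,
which replaces `|g'|` in the conclusion. The constant absorbs 480 · 1.01 plus the entry errors of at
most 6. -/
theorem SmallOffDiag.perturb {u f g h f' g' h' G c s x y : ℝ} (hu : 0 ≤ u) (hu1 : u ≤ 1 / 1000)
    (H : SmallOffDiag (480 * u) f g h c s x y) (e1 : |f - f'| ≤ 3 * u * |f'|)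
    (e2 : |h - h'| ≤ 3 * u * |h'|) (e3 : |g - g'| ≤ 6 * u * G) (hG : |g'| ≤ G) :
    |-(c * f' * y) + c * g' * x + s * h' * x| ≤
      500 * u * (|c * f' * y| + |c| * G * |x| + |s * h' * x|) := by
  have d1 : |c * f * y - c * f' * y| ≤ 3 * u * |c * f' * y| := by
    have : c * f * y - c * f' * y = c * (f - f') * y := by ring
    rw [this, abs_mul, abs_mul, abs_mul, abs_mul]
    calc |c| * |f - f'| * |y| ≤ |c| * (3 * u * |f'|) * |y| := by gcongr
      _ = _ := by ring
  have d2 : |s * h * x - s * h' * x| ≤ 3 * u * |s * h' * x| := by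
    have : s * h * x - s * h' * x = s * (h - h') * x := by ring
    rw [this, abs_mul, abs_mul, abs_mul, abs_mul]
    calc |s| * |h - h'| * |x| ≤ |s| * (3 * u * |h'|) * |x| := by gcongr
      _ = _ := by ring
  have d3 : |c * g * x - c * g' * x| ≤ 6 * u * (|c| * G * |x|) := by
    have : c * g * x - c * g' * x = c * (g - g') * x := by ring
    rw [this, abs_mul, abs_mul]
    calc |c| * |g - g'| * |x| ≤ |c| * (6 * u * G) * |x| := by gcongr
      _ = _ := by ring
  have d4 : |c * g' * x| ≤ |c| * G * |x| := by
    rw [abs_mul, abs_mul]; gcongr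
  have H' := H.1
  generalize c * f * y = F at *
  generalize c * f' * y = F' at *
  generalize s * h * x = E at *
  generalize s * h' * x = E' at *
  generalize c * g * x = D at *
  generalize c * g' * x = D' at *
  generalize |c| * G * |x| = Dh at *
  have t1 := abs_sub_abs_le_abs_sub F F'
  have t2 := abs_sub_abs_le_abs_sub E E'
  have t3 := abs_sub_abs_le_abs_sub D D'
  have n1 := abs_nonneg F'
  have n2 := abs_nonneg E'
  have n3 : 0 ≤ Dh := (abs_nonneg _).trans d4
  have m1 := mul_le_mul_of_nonneg_right hu1 n1
  have m2 := mul_le_mul_of_nonneg_right hu1 n2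
  have m3 := mul_le_mul_of_nonneg_right hu1 n3
  have s1 : |F| + |D| + |E| ≤ 1.01 * (|F'| + Dh + |E'|) := by linarith
  calc |-F' + D' + E'| = |(-F + D + E) + ((F - F') - (D - D') - (E - E'))| := by congr 1; ring
    _ ≤ |-F + D + E| + (|F - F'| + |D - D'| + |E - E'|) := by
        refine (abs_add_le _ _).trans ?_
        gcongr
        exact (abs_sub _ _).trans (by gcongr; exact abs_sub _ _)
    _ ≤ 480 * u * (1.01 * (|F'| + Dh + |E'|)) + (3 * u * |F'| + 6 * u * Dh + 3 * u * |E'|) := by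
        gcongr
        exact H'.trans (by gcongr)
    _ ≤ _ := by
        have := mul_nonneg hu n1
        have := mul_nonneg hu n2
        have := mul_nonneg hu n3
        linarith

/-- The `(1,2)` entry of `!![c, -s; s, c]ᵀ * C * adj(A) * B * !![x, -y; y, x]` is small relative to
the sum of the absolute values of its terms. -/
theorem residual_of_smallOffDiag (hu : 0 ≤ u) (hu1 : u ≤ 1 / 1000) {A B C : Mat2} {c s x y : ℝ}
    (H : SmallOffDiag (480 * u) (prodM fl A B C 0 0) (prodM fl A B C 0 1) (prodM fl A B C 1 1)
      c s x y) :
    |c * C 0 0 * A 1 1 * (B 0 1 * x - B 0 0 * y) - c * C 0 0 * A 0 1 * (B 1 1 * x) +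
        (c * C 0 1 + s * C 1 1) * A 0 0 * (B 1 1 * x)| ≤
      500 * u * (|c * C 0 0| * |A 1 1| * (|B 0 1 * x| + |B 0 0 * y|) +
        |c * C 0 0| * |A 0 1| * |B 1 1 * x| +
        (|c * C 0 1| + |s * C 1 1|) * |A 0 0| * |B 1 1 * x|) := by
  have e1 := fl.mul3_err hu (by linarith) (C 0 0) (A 1 1) (B 0 0)
  have e2 := fl.mul3_err' hu (by linarith) (C 1 1) (A 0 0) (B 1 1)
  have e3 := fl.prodM_err hu hu1 A B C
  have h1 : prodM fl A B C 0 0 = fl.mul (fl.mul (C 0 0) (A 1 1)) (B 0 0) := by simp [prodM]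
  have h2 : prodM fl A B C 1 1 = fl.mul (C 1 1) (fl.mul (A 0 0) (B 1 1)) := by simp [prodM]
  rw [← h1] at e1
  rw [← h2] at e2
  have key := H.perturb hu hu1 e1 e2 e3 (by
    exact (abs_sub _ _).trans (by gcongr; exact abs_add_le _ _))
  convert key using 1
  · congr 1; ring
  · simp only [abs_mul]; ring

/-- If `c₁₁ = 0`, the computed second column of `C adj(A) B` is nearly proportional to that of
`C`. -/
theorem prodM_rel_of_C_eq_zero (hu : 0 ≤ u) (hu1 : u ≤ 1 / 1000) {A B C : Mat2} (h : C 0 0 = 0) :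
    prodM fl A B C 0 0 = 0 ∧ Rel (1 - u) 4 (prodM fl A B C 0 1) (C 0 1 * (A 0 0 * B 1 1)) ∧
      Rel (1 - u) 4 (prodM fl A B C 1 1) (C 1 1 * (A 0 0 * B 1 1)) := by
  have h0 : 0 < 1 - u := by linarith
  have h1 : 1 - u ≤ 1 := by linarith
  have r := fun x : ℝ => Rel.refl h1 h0 0 x
  have key := fun x => fl.rel_mul hu (by linarith) (r x)
    (fl.rel_mul hu (by linarith) (r (A 0 0)) (r (B 1 1)))
  refine ⟨by simp [prodM, h, fl.zero_mul'], ?_, ?_⟩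
  · simp only [prodM, h, fl.zero_mul', Matrix.cons_val', Matrix.cons_val_zero, Matrix.cons_val_one,
      Matrix.of_apply, Matrix.cons_val_fin_one]
    have e1 := rel_of_abs_sub_le hu (by linarith)
      (fl.add_err 0 (fl.mul (C 0 1) (fl.mul (A 0 0) (B 1 1))))
    rw [zero_add] at e1
    have e2 := rel_of_abs_sub_le hu (by linarith)
      (fl.sub_err (fl.add 0 (fl.mul (C 0 1) (fl.mul (A 0 0) (B 1 1)))) 0)
    rw [sub_zero] at e2
    exact e2.trans h0 (e1.trans h0 (key _))
  · simp only [prodM, Matrix.cons_val', Matrix.cons_val_one,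
      Matrix.of_apply, Matrix.cons_val_fin_one]
    exact (key _).mono h0 h1 (by norm_num)

/-- If `b₂₂ = 0`, the computed first row of `C adj(A) B` is nearly proportional to that of
`B`. -/
theorem prodM_rel_of_B_eq_zero (hu : 0 ≤ u) (hu1 : u ≤ 1 / 1000) {A B C : Mat2} (h : B 1 1 = 0) :
    prodM fl A B C 1 1 = 0 ∧ Rel (1 - u) 4 (prodM fl A B C 0 1) (C 0 0 * A 1 1 * B 0 1) ∧
      Rel (1 - u) 4 (prodM fl A B C 0 0) (C 0 0 * A 1 1 * B 0 0) := by
  have h0 : 0 < 1 - u := by linarith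
  have h1 : 1 - u ≤ 1 := by linarith
  have r := fun x : ℝ => Rel.refl h1 h0 0 x
  have key := fun x => fl.rel_mul hu (by linarith)
    (fl.rel_mul hu (by linarith) (r (C 0 0)) (r (A 1 1))) (r x)
  refine ⟨by simp [prodM, h, fl.mul_zero'], ?_, ?_⟩
  · simp only [prodM, h, fl.mul_zero', Matrix.cons_val', Matrix.cons_val_zero, Matrix.cons_val_one,
      Matrix.of_apply, Matrix.cons_val_fin_one]
    have e1 := rel_of_abs_sub_le hu (by linarith)
      (fl.add_err (fl.mul (fl.mul (C 0 0) (A 1 1)) (B 0 1)) 0)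
    rw [add_zero] at e1
    have e2 := rel_of_abs_sub_le hu (by linarith)
      (fl.sub_err (fl.add (fl.mul (fl.mul (C 0 0) (A 1 1)) (B 0 1)) 0) 0)
    rw [sub_zero] at e2
    exact e2.trans h0 (e1.trans h0 (key _))
  · simp only [prodM, Matrix.cons_val', Matrix.cons_val_zero,
      Matrix.of_apply, Matrix.cons_val_fin_one]
    exact (key _).mono h0 h1 (by norm_num)

end

/-! ### Cancellation in the rows of VᵀC and the columns of BU -/

/-- `(gh₁, gh₂)` approximates `(|c|, |s|) * |C|` for `C = !![c₁, c₂; 0, c₃]`. -/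
structure RowHat (u c s c₁ c₂ c₃ gh₁ gh₂ : ℝ) : Prop where
  fst : |gh₁ - (|c * c₁|)| ≤ 3 * u * |c * c₁|
  snd : |gh₂ - (|c * c₂| + |s * c₃|)| ≤ 3 * u * (|c * c₂| + |s * c₃|)

/-- `(g₁, g₂)` approximates `(c, s) * C` for `C = !![c₁, c₂; 0, c₃]`. -/
structure RowFwd (u c s c₁ c₂ c₃ g₁ g₂ : ℝ) : Prop where
  fst : |g₁ - c * c₁| ≤ 3 * u * |c * c₁|
  snd : |g₂ - (c * c₂ + s * c₃)| ≤ 3 * u * (|c * c₂| + |s * c₃|)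

/-- No cancellation occurred in the computation of `(g₁, g₂)`. -/
def NoCancel (g₁ g₂ gh₁ gh₂ : ℝ) : Prop := gh₁ ≤ 1.01 * |g₁| ∧ gh₂ ≤ 1.01 * |g₂|

/-- A nonzero vector in the computation of which no cancellation occurred. -/
def Fine (g₁ g₂ gh₁ gh₂ : ℝ) : Prop := NoCancel g₁ g₂ gh₁ gh₂ ∧ ¬ (g₁ = 0 ∧ g₂ = 0)

section Rows
variable {u c s c₁ c₂ c₃ g₁ g₂ gh₁ gh₂ g₁' g₂' gh₁' gh₂' : ℝ}

/-- Summands of equal sign add in absolute value, so vector and majorant differ only by rounding: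
1.003 / 0.997 < 1.01. -/
theorem noCancel_of_fwd (hu1 : u ≤ 1 / 1000) (H : RowHat u c s c₁ c₂ c₃ gh₁ gh₂)
    (F : RowFwd u c s c₁ c₂ c₃ g₁ g₂) (hs : 0 ≤ (c * c₂) * (s * c₃)) :
    NoCancel g₁ g₂ gh₁ gh₂ := by
  have key : ∀ {g gh w : ℝ}, |gh - (|w|)| ≤ 3 * u * |w| → |g - w| ≤ 3 * u * |w| →
      gh ≤ 1.01 * |g| := by
    intro g gh w h1 h2
    have := (abs_le.1 h1).2
    have := abs_sub_abs_le_abs_sub w g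
    rw [abs_sub_comm] at this
    have hw := abs_nonneg w
    have := mul_le_mul_of_nonneg_right hu1 hw
    linarith
  have e := abs_add_eq_add_abs_iff (c * c₂) (s * c₃)
  have e2 : |c * c₂ + s * c₃| = |c * c₂| + |s * c₃| := e.2 (mul_nonneg_iff.1 hs)
  exact ⟨key H.fst F.fst, key (by rw [e2]; exact H.snd) (by rw [e2]; exact F.snd)⟩

theorem fine_of_fwd (hu1 : u ≤ 1 / 1000) (H : RowHat u c s c₁ c₂ c₃ gh₁ gh₂)
    (F : RowFwd u c s c₁ c₂ c₃ g₁ g₂) (hs : 0 ≤ (c * c₂) * (s * c₃))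
    (h0 : c * c₁ ≠ 0 ∨ c * c₂ ≠ 0 ∨ s * c₃ ≠ 0) : Fine g₁ g₂ gh₁ gh₂ := by
  have h := noCancel_of_fwd hu1 H F hs
  refine ⟨h, ?_⟩
  rintro ⟨rfl, rfl⟩
  simp only [NoCancel, abs_zero, mul_zero] at h
  have h1 := (abs_le.1 H.fst).1
  have h2 := (abs_le.1 H.snd).1
  have p1 := abs_nonneg (c * c₁)
  have p2 := abs_nonneg (c * c₂)
  have p3 := abs_nonneg (s * c₃)
  have q1 := mul_le_mul_of_nonneg_right hu1 p1
  have q2 := mul_le_mul_of_nonneg_right hu1 (add_nonneg p2 p3)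
  rcases h0 with h0 | h0 | h0 <;> · have := abs_pos.2 h0; linarith

/-- Cancellation occurs in at most one of two vectors. -/
structure RowPair (nz : Prop) (g₁ g₂ gh₁ gh₂ g₁' g₂' gh₁' gh₂' : ℝ) : Prop where
  fst : NoCancel g₁ g₂ gh₁ gh₂ ∨ Fine g₁' g₂' gh₁' gh₂'
  snd : NoCancel g₁' g₂' gh₁' gh₂' ∨ Fine g₁ g₂ gh₁ gh₂
  exists_fine : nz → Fine g₁ g₂ gh₁ gh₂ ∨ Fine g₁' g₂' gh₁' gh₂'

theorem RowPair.symm {nz : Prop} (H : RowPair nz g₁ g₂ gh₁ gh₂ g₁' g₂' gh₁' gh₂') :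
    RowPair nz g₁' g₂' gh₁' gh₂' g₁ g₂ gh₁ gh₂ :=
  ⟨H.snd, H.fst, fun h => (H.exists_fine h).symm⟩

/-- The two rows come from `(c, s)` and, up to sign, `(s, -c)`. The product of the summands `c * c₂`
and `s * c₃` changes sign between them, so one row adds where the other subtracts. If the product is
zero, neither cancels, and a nonzero `c₁` makes at least one row nonzero. -/
theorem rowPair_of_fwd (hu1 : u ≤ 1 / 1000) {c' s' : ℝ} (H : RowHat u c s c₁ c₂ c₃ gh₁ gh₂)
    (F : RowFwd u c s c₁ c₂ c₃ g₁ g₂) (H' : RowHat u c' s' c₁ c₂ c₃ gh₁' gh₂')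
    (F' : RowFwd u c' s' c₁ c₂ c₃ g₁' g₂') (hcs : c ≠ 0 ∨ s ≠ 0) (hc' : s ≠ 0 → c' ≠ 0)
    (hcs' : c' * s' = -(c * s)) :
    RowPair (c₁ ≠ 0) g₁ g₂ gh₁ gh₂ g₁' g₂' gh₁' gh₂' := by
  have e : c' * c₂ * (s' * c₃) = -(c * c₂ * (s * c₃)) := by linear_combination c₂ * c₃ * hcs'
  rcases lt_trichotomy (c * c₂ * (s * c₃)) 0 with h | h | h
  · have : c * c₂ * (s * c₃) ≠ 0 := h.ne
    have h2 : c' * c₂ ≠ 0 := by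
      simp only [ne_eq, mul_eq_zero, not_or] at this
      exact mul_ne_zero (hc' this.2.1) this.1.2
    have f := fine_of_fwd hu1 H' F' (by rw [e]; linarith) (Or.inr (Or.inl h2))
    exact ⟨Or.inr f, Or.inl f.1, fun _ => Or.inr f⟩
  · have n := noCancel_of_fwd hu1 H F h.ge
    have n' := noCancel_of_fwd hu1 H' F' (by rw [e]; linarith)
    refine ⟨Or.inl n, Or.inl n', fun h1 => ?_⟩
    rcases hcs with hc | hs
    · exact Or.inl (fine_of_fwd hu1 H F h.ge (Or.inl (mul_ne_zero hc h1)))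
    · exact Or.inr (fine_of_fwd hu1 H' F' (by rw [e]; linarith)
        (Or.inl (mul_ne_zero (hc' hs) h1)))
  · have : c * c₂ * (s * c₃) ≠ 0 := h.ne'
    have f := fine_of_fwd hu1 H F h.le (Or.inr (Or.inl (left_ne_zero_of_mul this)))
    exact ⟨Or.inl f.1, Or.inr f, fun _ => Or.inl f⟩

/-- Nothing is assumed about the primed row, which has been zeroed: the sign condition from xLASV2
protects the other row, which is nonzero unless all of `C` vanishes. -/
theorem rowPair_of_cleared (hu1 : u ≤ 1 / 1000) {c' s' : ℝ}
    (H : RowHat u c s c₁ c₂ c₃ gh₁ gh₂) (F : RowFwd u c s c₁ c₂ c₃ g₁ g₂)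
    (H' : RowHat u c' s' c₁ c₂ c₃ gh₁' gh₂') (h1 : c₁ = 0)
    (hs : 0 ≤ c * c₂ * (s * c₃)) (h2 : c₂ ≠ 0 → c ≠ 0) (h3 : c₃ ≠ 0 → s ≠ 0) :
    RowPair (c₁ ≠ 0) g₁ g₂ gh₁ gh₂ g₁' g₂' gh₁' gh₂' := by
  refine ⟨Or.inl (noCancel_of_fwd hu1 H F hs), ?_, fun h => absurd h1 h⟩
  by_cases h : c₂ = 0 ∧ c₃ = 0
  · left
    obtain ⟨rfl, rfl⟩ := h
    subst h1
    have e1 := (abs_le.1 H'.fst).2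
    have e2 := (abs_le.1 H'.snd).2
    simp only [mul_zero, abs_zero, add_zero, sub_zero] at e1 e2
    exact ⟨e1.trans (by positivity), e2.trans (by positivity)⟩
  · right
    refine fine_of_fwd hu1 H F hs (Or.inr ?_)
    rw [not_and_or] at h
    rcases h with h | h
    · exact Or.inl (mul_ne_zero (h2 h) h)
    · exact Or.inr (mul_ne_zero (h3 h) h)

end Rows

/-! ### Products with adj(A) and the quotients η -/

/-- `(k₁, k₂)` approximates `(g₁, g₂) * adj(A)` for `A = !![a, b; 0, d]`. -/
structure AdjMul (u a b d g₁ g₂ k₁ k₂ : ℝ) : Prop where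
  fst : |k₁ - g₁ * d| ≤ 3 * u * |g₁ * d|
  snd : |k₂ - (-(g₁ * b) + g₂ * a)| ≤ 3 * u * (|g₁ * b| + |g₂ * a|)

/-- `η` approximates the quotient `n / d`, which is `∞` for `d = 0`. -/
structure IsEta (η : EReal) (n d : ℝ) : Prop where
  le_mul : ∀ x : ℝ, 0 ≤ x → η ≤ x → n ≤ 1.01 * x * d
  le_of : ∀ x : ℝ, 0 ≤ x → 0 < d → n ≤ x * d → η ≤ ((1.01 * x : ℝ) : EReal)
  top : d = 0 → η = ⊤

theorem isEta_eta {u : ℝ} (fl : FlArith u) (hu : 0 ≤ u) (hu1 : u ≤ 1 / 1000) {n₁ n₂ : ℝ}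
    (h1 : 0 ≤ n₁) (h2 : 0 ≤ n₂) (d₁ d₂ : ℝ) :
    IsEta (eta fl n₁ n₂ d₁ d₂) (n₁ + n₂) (|d₁| + |d₂|) := by
  have hd : 0 ≤ |d₁| + |d₂| := by positivity
  rcases hd.eq_or_lt with hd | hd
  · have : eta fl n₁ n₂ d₁ d₂ = ⊤ := if_pos ((fl.add_eq_zero_iff (by linarith) _ _).2 hd.symm)
    rw [this, ← hd]
    exact ⟨fun x _ hx => absurd hx (by simp), fun x _ h => absurd h (lt_irrefl _), fun _ => rfl⟩
  · have : eta fl n₁ n₂ d₁ d₂ = ((fl.div (fl.add n₁ n₂) (fl.add |d₁| |d₂|) : ℝ) : EReal) :=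
      if_neg ((fl.add_eq_zero_iff (by linarith) _ _).not.2 hd.ne')
    rw [this]
    have r : Rel (1 - u) 3 (fl.div (fl.add n₁ n₂) (fl.add |d₁| |d₂|))
        ((n₁ + n₂) / (|d₁| + |d₂|)) :=
      fl.rel_div hu (by linarith) hd.ne' (rel_of_abs_sub_le hu (by linarith) (fl.add_err _ _))
        (rel_of_abs_sub_le hu (by linarith) (fl.add_err _ _))
    obtain ⟨e, he, hl, hr, hq⟩ := r
    -- Two sums and one quotient give three factors, which the margin 1.01 absorbs.
    have hρ : 0.99 * 1.01 ≤ (1 - u) ^ 3 * 1.01 ∧ 1 ≤ 1.01 * (1 - u) ^ 3 := by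
      constructor <;> nlinarith [pow_nonneg hu 3, mul_nonneg hu hu]
    have hn : 0 ≤ (n₁ + n₂) / (|d₁| + |d₂|) := by positivity
    refine ⟨fun x hx h => ?_, fun x hx _ h => ?_, fun h => absurd h hd.ne'⟩
    · rw [EReal.coe_le_coe_iff, hq] at h
      rw [← div_le_iff₀ hd]
      nlinarith [mul_le_mul_of_nonneg_right hl hn]
    · rw [EReal.coe_le_coe_iff, hq]
      rw [← div_le_iff₀ hd] at h
      have e1 : e ≤ 1.01 := by nlinarith
      nlinarith

/-- The quantities attached to one of the two indices: a row `g` of `VᵀC`, the row `k = g adj(A)`,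
and their majorants and quotients. -/
structure Half (u a b d g₁ g₂ gh₁ gh₂ k₁ k₂ kh₁ kh₂ : ℝ) (ηg ηk : EReal) : Prop where
  nonneg₁ : 0 ≤ gh₁
  nonneg₂ : 0 ≤ gh₂
  adj : AdjMul u a b d g₁ g₂ k₁ k₂
  adjh : AdjMul u |a| (-|b|) |d| gh₁ gh₂ kh₁ kh₂
  etag : IsEta ηg (gh₁ + gh₂) (|g₁| + |g₂|)
  etak : IsEta ηk (kh₁ + kh₂) (|k₁| + |k₂|)

section
variable {u κ a b d g₁ g₂ gh₁ gh₂ k₁ k₂ kh₁ kh₂ : ℝ} {ηg ηk : EReal}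

/-- The hypothesis `hab` amounts to `|b| ≤ κ |d|`. Hence `k₁` controls `g₁ d` and, at the cost of
`κ`, also `g₁ b`; then `k₂` controls `g₂ a`. Cancellation in `k` thus loses at most a factor of
order `κ`. -/
theorem AdjMul.sum_le (hκ : 1 ≤ κ) (huκ : u * κ ≤ 1 / 1000) (ha : a ≠ 0) (hd : d ≠ 0)
    (hab : |a| * |b| ≤ κ * |a * d|) (H : AdjMul u a b d g₁ g₂ k₁ k₂) :
    |g₁ * d| + |g₁ * b| + |g₂ * a| ≤ 3.1 * κ * (|k₁| + |k₂|) := by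
  obtain ⟨h1, h2⟩ := H
  set S := |g₁ * d| + |g₁ * b| + |g₂ * a| with hS
  have hS0 : 0 ≤ S := by positivity
  have had : 0 < |a * d| := abs_pos.2 (mul_ne_zero ha hd)
  have k1 : |g₁ * d| ≤ |k₁| + |k₁ - g₁ * d| := by
    have := abs_sub_abs_le_abs_sub (g₁ * d) k₁
    rw [abs_sub_comm] at this; linarith
  have k2 : |g₂ * a| ≤ |k₂| + |k₂ - (-(g₁ * b) + g₂ * a)| + |g₁ * b| := by
    have e : g₂ * a = k₂ - (k₂ - (-(g₁ * b) + g₂ * a)) + g₁ * b := by ring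
    calc |g₂ * a| = |k₂ - (k₂ - (-(g₁ * b) + g₂ * a)) + g₁ * b| := congrArg _ e
      _ ≤ |k₂ - (k₂ - (-(g₁ * b) + g₂ * a))| + |g₁ * b| := abs_add_le _ _
      _ ≤ _ := by gcongr; exact abs_sub _ _
  have hT : |k₁ - g₁ * d| + |k₂ - (-(g₁ * b) + g₂ * a)| ≤ 3 * u * S := by
    rw [hS]; linarith
  have hgb : |a * d| * |g₁ * b| ≤ |g₁ * d| * (κ * |a * d|) := by
    calc _ = |g₁ * d| * (|a| * |b|) := by simp only [abs_mul]; ring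
      _ ≤ _ := by gcongr
  have hgb' : |g₁ * b| ≤ κ * |g₁ * d| := by
    refine le_of_mul_le_mul_left (hgb.trans_eq ?_) had
    ring
  have hk0 := abs_nonneg k₁
  have hk0' := abs_nonneg k₂
  have e0 := abs_nonneg (k₂ - (-(g₁ * b) + g₂ * a))
  have e0' := abs_nonneg (k₁ - g₁ * d)
  have s1 : S ≤ (1 + 2 * κ) * (|k₁| + |k₁ - g₁ * d|) + |k₂| +
      |k₂ - (-(g₁ * b) + g₂ * a)| := by
    nlinarith
  have s2 : S ≤ 3 * κ * (|k₁| + |k₂| + 3 * u * S) := by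
    nlinarith
  nlinarith

/-- Without cancellation in `g`, the only loss in `k` is the one bounded by `AdjMul.sum_le`;
rounding raises its constant 3.1 to at most 4. -/
theorem Half.fine_le (hu : 0 ≤ u) (hκ : 1 ≤ κ) (huκ : u * κ ≤ 1 / 1000)
    (ha : a ≠ 0) (hd : d ≠ 0) (hab : |a| * |b| ≤ κ * |a * d|)
    (H : Half u a b d g₁ g₂ gh₁ gh₂ k₁ k₂ kh₁ kh₂ ηg ηk) (F : Fine g₁ g₂ gh₁ gh₂) :
    ηg ≤ ((1.03 : ℝ) : EReal) ∧ ηk ≤ ((4 * κ : ℝ) : EReal) := by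
  obtain ⟨⟨f1, f2⟩, f3⟩ := F
  have hu1 : u ≤ 1 / 1000 := by nlinarith
  have hg : 0 < |g₁| + |g₂| := by
    rcases not_and_or.1 f3 with h | h <;> have := abs_pos.2 h <;> positivity
  constructor
  · refine (H.etag.le_of 1.01 (by norm_num) hg (by linarith)).trans ?_
    rw [EReal.coe_le_coe_iff]; norm_num
  · have hS := H.adj.sum_le hκ huκ ha hd hab
    have hpos : 0 < |g₁ * d| + |g₁ * b| + |g₂ * a| := by
      rcases not_and_or.1 f3 with h | h
      · have := abs_pos.2 (mul_ne_zero h hd); positivity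
      · have := abs_pos.2 (mul_ne_zero h ha); positivity
    have hk : 0 < |k₁| + |k₂| := by
      by_contra h
      have : |k₁| + |k₂| = 0 := le_antisymm (not_lt.1 h) (by positivity)
      rw [this] at hS; linarith
    have h1 := (abs_le.1 H.adjh.fst).2
    have h2 := (abs_le.1 H.adjh.snd).2
    rw [abs_mul, abs_abs, abs_of_nonneg H.nonneg₁] at h1
    rw [abs_mul, abs_mul, abs_neg, abs_abs, abs_abs, abs_of_nonneg H.nonneg₁,
      abs_of_nonneg H.nonneg₂] at h2
    have b1 : gh₁ * |d| ≤ 1.01 * |g₁ * d| := by rw [abs_mul, ← mul_assoc]; gcongr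
    have b2 : gh₁ * |b| ≤ 1.01 * |g₁ * b| := by rw [abs_mul, ← mul_assoc]; gcongr
    have b3 : gh₂ * |a| ≤ 1.01 * |g₂ * a| := by rw [abs_mul, ← mul_assoc]; gcongr
    have p1 := abs_nonneg (g₁ * d)
    have p2 := abs_nonneg (g₁ * b)
    have p3 := abs_nonneg (g₂ * a)
    have n1 : 0 ≤ gh₁ * |d| := mul_nonneg H.nonneg₁ (abs_nonneg _)
    have n2 : 0 ≤ gh₁ * |b| := mul_nonneg H.nonneg₁ (abs_nonneg _)
    have n3 : 0 ≤ gh₂ * |a| := mul_nonneg H.nonneg₂ (abs_nonneg _)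
    have m1 := mul_le_mul_of_nonneg_right hu1 n1
    have m2 := mul_le_mul_of_nonneg_right hu1 n2
    have m3 := mul_le_mul_of_nonneg_right hu1 n3
    have hsum : kh₁ + kh₂ ≤ 1.02 * (|g₁ * d| + |g₁ * b| + |g₂ * a|) := by linarith
    have hκk : 0 ≤ κ * (|k₁| + |k₂|) := by positivity
    refine (H.etak.le_of (3.2 * κ) (by linarith) hk (by linarith)).trans ?_
    rw [EReal.coe_le_coe_iff]; linarith

end

/-! ### Choice of the index -/

/-- The alternatives for the selected index: exactly one of the two vectors vanishes, or the
product of the two minima is of the order of the condition number. -/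
def Selected (κ : ℝ) (gz lz : Prop) (ηg ηh ηk ηl : EReal) : Prop :=
  (¬ gz ∧ lz) ∨ (gz ∧ ¬ lz) ∨ (¬ gz ∧ ¬ lz ∧ ∃ X Y : ℝ, 0 ≤ X ∧ 0 ≤ Y ∧ X * Y ≤ 10 * κ ∧
    min ηg ηh ≤ X ∧ min ηk ηl ≤ Y)

section
variable {κ : ℝ} {gz lz gf lf gf' lf' : Prop} {ηg ηh ηk ηl ηg' ηh' ηk' ηl' : EReal}

theorem etaMax_le_of_fine (hκ : 1 ≤ κ)
    (hg : gf → ηg ≤ ((1.03 : ℝ) : EReal) ∧ ηk ≤ ((4 * κ : ℝ) : EReal))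
    (hl : lf → ηl ≤ ((1.03 : ℝ) : EReal) ∧ ηh ≤ ((4 * κ : ℝ) : EReal)) (h : gf ∨ lf) :
    etaMax ηg ηh ηk ηl ≤ ((4 * κ : ℝ) : EReal) := by
  have e1 : (1 : EReal) ≤ ((4 * κ : ℝ) : EReal) := by
    rw [← EReal.coe_one, EReal.coe_le_coe_iff]; linarith
  have e2 : ((1.03 : ℝ) : EReal) ≤ ((4 * κ : ℝ) : EReal) := by
    rw [EReal.coe_le_coe_iff]; linarith
  rw [etaMax, max_le_iff, max_le_iff]
  rcases h with h | h
  · obtain ⟨a, b⟩ := hg h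
    exact ⟨e1, (min_le_left _ _).trans (a.trans e2), (min_le_left _ _).trans b⟩
  · obtain ⟨a, b⟩ := hl h
    exact ⟨e1, (min_le_right _ _).trans b, (min_le_right _ _).trans (a.trans e2)⟩

theorem etaMax_le_of_fine_of_fine
    (hg : ηg ≤ ((1.03 : ℝ) : EReal)) (hl : ηl ≤ ((1.03 : ℝ) : EReal)) :
    etaMax ηg ηh ηk ηl ≤ ((1.03 : ℝ) : EReal) := by
  have e1 : (1 : EReal) ≤ ((1.03 : ℝ) : EReal) := by
    rw [← EReal.coe_one, EReal.coe_le_coe_iff]; norm_num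
  rw [etaMax, max_le_iff, max_le_iff]
  exact ⟨e1, (min_le_left _ _).trans hg, (min_le_right _ _).trans hl⟩

/-- Primed quantities belong to the rejected index. Minimality of η_max is needed only if both
selected vectors suffer cancellation; then neither rejected vector does. -/
theorem selected_of_le (hκ : 1 ≤ κ) (hm : etaMax ηg ηh ηk ηl ≤ etaMax ηg' ηh' ηk' ηl')
    (hm' : etaMax ηg ηh ηk ηl ≤ ((4 * κ : ℝ) : EReal))
    (hgz : gz → ηg = ⊤) (hlz : lz → ηh = ⊤)
    (hg : gf → ηg ≤ ((1.03 : ℝ) : EReal) ∧ ηk ≤ ((4 * κ : ℝ) : EReal))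
    (hl : lf → ηl ≤ ((1.03 : ℝ) : EReal) ∧ ηh ≤ ((4 * κ : ℝ) : EReal))
    (hg' : gf' → ηg' ≤ ((1.03 : ℝ) : EReal) ∧ ηk' ≤ ((4 * κ : ℝ) : EReal))
    (hl' : lf' → ηl' ≤ ((1.03 : ℝ) : EReal) ∧ ηh' ≤ ((4 * κ : ℝ) : EReal))
    (pg : (¬ gz → gf) ∨ gf') (pl : (¬ lz → lf) ∨ lf') : Selected κ gz lz ηg ηh ηk ηl := by
  by_cases z1 : gz
  · by_cases z2 : lz
    -- Two vanishing vectors would give `η_g = η_h = ⊤`, contrary to the finite bound on η_max.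
    · exfalso
      have : min ηg ηh ≤ ((4 * κ : ℝ) : EReal) :=
        ((le_max_left _ _).trans (le_max_right _ _)).trans hm'
      rw [hgz z1, hlz z2, min_self] at this
      exact EReal.coe_ne_top _ (top_le_iff.1 this)
    · exact Or.inr (Or.inl ⟨z1, z2⟩)
  by_cases z2 : lz
  · exact Or.inl ⟨z1, z2⟩
  refine Or.inr (Or.inr ⟨z1, z2, ?_⟩)
  by_cases f1 : gf
  · obtain ⟨a, b⟩ := hg f1
    exact ⟨1.03, 4 * κ, by norm_num, by linarith, by linarith, (min_le_left _ _).trans a,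
      (min_le_left _ _).trans b⟩
  by_cases f2 : lf
  · obtain ⟨a, b⟩ := hl f2
    exact ⟨4 * κ, 1.03, by linarith, by norm_num, by linarith, (min_le_right _ _).trans b,
      (min_le_right _ _).trans a⟩
  have f3 : gf' := pg.resolve_left fun h => f1 (h z1)
  have f4 : lf' := pl.resolve_left fun h => f2 (h z2)
  have := hm.trans (etaMax_le_of_fine_of_fine (hg' f3).1 (hl' f4).1)
  rw [etaMax, max_le_iff, max_le_iff] at this
  exact ⟨1.03, 1.03, by norm_num, by norm_num, by linarith, this.2.1, this.2.2⟩

end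

/-! ### The rotation generator -/

/-- The rotation generator returns approximately the normalized vector, up to sign. -/
theorem lartg_spec {u : ℝ} (fl : FlArith u) (hu : 0 ≤ u) (hu1 : u ≤ 1 / 1000) {f g : ℝ}
    (hfg : ¬ (f = 0 ∧ g = 0)) :
    ∃ σ : ℝ, |σ| = 1 ∧ |(lartg fl f g).1 - σ * (f / √(f ^ 2 + g ^ 2))| ≤ 10 * u ∧
      |(lartg fl f g).2 - σ * (g / √(f ^ 2 + g ^ 2))| ≤ 10 * u := by
  have h10 : 0 ≤ 10 * u := by linarith
  unfold lartg
  by_cases hg : g = 0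
  · have hf : f ≠ 0 := fun h => hfg ⟨h, hg⟩
    have hf' := abs_pos.2 hf
    refine ⟨|f| / f, ?_, ?_, ?_⟩
    -- The generator returns `(1, 0)` whatever the sign of `f`; hence the sign `σ = |f| / f`.
    · rw [abs_div, abs_abs, div_self hf'.ne']
    · have : |f| / f * (f / √(f ^ 2 + g ^ 2)) = 1 := by
        rw [hg]; simp only [ne_eq, OfNat.ofNat_ne_zero, not_false_eq_true, zero_pow, add_zero]
        rw [Real.sqrt_sq_eq_abs]; field_simp
      rw [if_pos hg, this]; simpa using h10
    · simpa [hg] using h10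
  by_cases hf : f = 0
  · have hg' := abs_pos.2 hg
    refine ⟨|g| / g, ?_, ?_, ?_⟩
    · rw [abs_div, abs_abs, div_self hg'.ne']
    · simpa [hf, hg] using h10
    · have : |g| / g * (g / √(f ^ 2 + g ^ 2)) = 1 := by
        rw [hf]; simp only [ne_eq, OfNat.ofNat_ne_zero, not_false_eq_true, zero_pow, zero_add]
        rw [Real.sqrt_sq_eq_abs]; field_simp
      rw [if_neg hg, if_pos hf, this]; simpa using h10
  rw [if_neg hg, if_neg hf]
  have h0 : 0 < 1 - u := by linarith
  have h1 : 1 - u ≤ 1 := by linarith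
  have r := fun x : ℝ => Rel.refl h1 h0 0 x
  have hpos : 0 < f * f + g * g := by
    have := mul_self_pos.2 hf
    have := mul_self_pos.2 hg
    positivity
  have hs : f ^ 2 + g ^ 2 = f * f + g * g := by ring
  have hr : Rel (1 - u) 3 (fl.sqrt (fl.add (fl.mul f f) (fl.mul g g))) (√(f ^ 2 + g ^ 2)) := by
    rw [hs]
    exact fl.rel_sqrt hu (by linarith) hpos.le (fl.rel_add hu (by linarith)
      (mul_nonneg (mul_self_nonneg f) (mul_self_nonneg g))
      (fl.rel_mul hu (by linarith) (r f) (r f)) (fl.rel_mul hu (by linarith) (r g) (r g)))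
  have hR : 0 < √(f ^ 2 + g ^ 2) := Real.sqrt_pos.2 (by rw [hs]; exact hpos)
  have key : ∀ x, |x| ≤ √(f ^ 2 + g ^ 2) →
      |fl.div x (fl.sqrt (fl.add (fl.mul f f) (fl.mul g g))) - x / √(f ^ 2 + g ^ 2)| ≤ 10 * u := by
    intro x hx
    have hc := (fl.rel_div hu (by linarith) hR.ne' (r x) hr).abs_sub_le hu (by norm_num; linarith)
    have hx1 : |x / √(f ^ 2 + g ^ 2)| ≤ 1 := by
      rw [abs_div, abs_of_pos hR, div_le_one hR]; exact hx
    push_cast at hc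
    generalize fl.div x (fl.sqrt (fl.add (fl.mul f f) (fl.mul g g))) = X at *
    generalize x / √(f ^ 2 + g ^ 2) = Y at *
    have := abs_sub_abs_le_abs_sub X Y
    have hX : |X| ≤ 1.1 := by nlinarith [abs_nonneg X]
    nlinarith
  have kf := key f (Real.abs_le_sqrt (by nlinarith [sq_nonneg g]))
  have kg := key g (Real.abs_le_sqrt (by nlinarith [sq_nonneg f]))
  dsimp only
  split_ifs
  · refine ⟨-1, by simp, ?_, ?_⟩
    · rw [neg_one_mul, neg_sub_neg, abs_sub_comm]; exact kf
    · rw [neg_one_mul, neg_sub_neg, abs_sub_comm]; exact kg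
  · exact ⟨1, by simp, by rwa [one_mul], by rwa [one_mul]⟩

/-! ### Bilinear bounds for the (1,2) entry of PᵀAQ -/

section
variable {u κ χ a b d g₁ g₂ gh₁ gh₂ k₁ k₂ kh₁ kh₂ l₁ l₂ lh₁ lh₂ h₁ h₂ hh₁ hh₂ : ℝ}
  {ηg ηh ηk ηl : EReal}

theorem AdjMul.err_le (H : AdjMul u a b d g₁ g₂ k₁ k₂) (hu : 0 ≤ u) :
    |k₁ - g₁ * d| + |k₂ - (-(g₁ * b) + g₂ * a)| ≤
      3 * u * ((|a| + |b| + |d|) * (|g₁| + |g₂|)) := by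
  have h1 := H.fst
  have h2 := H.snd
  have h3 : |g₁ * d| + (|g₁ * b| + |g₂ * a|) ≤ (|a| + |b| + |d|) * (|g₁| + |g₂|) := by
    simp only [abs_mul]
    nlinarith [mul_nonneg (abs_nonneg a) (abs_nonneg g₁), mul_nonneg (abs_nonneg b) (abs_nonneg g₂),
      mul_nonneg (abs_nonneg d) (abs_nonneg g₂)]
  calc _ ≤ 3 * u * (|g₁ * d| + (|g₁ * b| + |g₂ * a|)) := by linarith
    _ ≤ _ := by gcongr

/-- A lower bound for `(g₁, g₂) * adj(A)`. -/
theorem AdjMul.lower (H : AdjMul u a b d g₁ g₂ k₁ k₂) (hu : 0 ≤ u)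
    (hχ : (|a| + |b| + |d|) ^ 2 ≤ χ * |a * d|) (huχ : u * χ ≤ 1 / 1000) :
    |a * d| * (|g₁| + |g₂|) ≤ 4 * (|a| + |b| + |d|) * (|k₁| + |k₂|) := by
  have he := H.err_le hu
  set N := |a| + |b| + |d| with hN
  have hN0 : 0 ≤ N := by positivity
  have a0 := abs_nonneg a
  have b0 := abs_nonneg b
  have d0 := abs_nonneg d
  set e₁ := k₁ - g₁ * d with h₁
  set e₂ := k₂ - (-(g₁ * b) + g₂ * a) with h₂
  have x1 : |a * d| * |g₁| ≤ (|k₁| + |e₁|) * N := by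
    have : a * d * g₁ = (k₁ - e₁) * a := by rw [h₁]; ring
    calc |a * d| * |g₁| = |k₁ - e₁| * |a| := by rw [← abs_mul, this, abs_mul]
      _ ≤ (|k₁| + |e₁|) * N := by
        gcongr
        · exact abs_sub _ _
        · linarith
  have x2 : |a * d| * |g₂| ≤ (|k₁| + |e₁| + (|k₂| + |e₂|)) * N := by
    have : a * d * g₂ = (k₁ - e₁) * b + (k₂ - e₂) * d := by rw [h₁, h₂]; ring
    calc |a * d| * |g₂| = |(k₁ - e₁) * b + (k₂ - e₂) * d| := by rw [← abs_mul, this]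
      _ ≤ |k₁ - e₁| * |b| + |k₂ - e₂| * |d| := by
        rw [← abs_mul, ← abs_mul]; exact abs_add_le _ _
      _ ≤ (|k₁| + |e₁|) * N + (|k₂| + |e₂|) * N := by
        gcongr
        · exact abs_sub _ _
        · linarith
        · exact abs_sub _ _
        · linarith
      _ = _ := by ring
  have g0 : 0 ≤ |g₁| + |g₂| := by positivity
  -- Inverting `adj(A)` amplifies the rounding errors by `N ^ 2 / |a * d| ≤ χ`; as `u * χ` is small,
  -- they can be absorbed on the left.
  have y : (|e₁| + |e₂|) * N ≤ 3 * (1 / 1000) * (|a * d| * (|g₁| + |g₂|)) := by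
    calc (|e₁| + |e₂|) * N ≤ 3 * u * (N * (|g₁| + |g₂|)) * N := by gcongr
      _ = 3 * u * (N ^ 2) * (|g₁| + |g₂|) := by ring
      _ ≤ 3 * u * (χ * |a * d|) * (|g₁| + |g₂|) := by gcongr
      _ = 3 * (u * χ) * (|a * d| * (|g₁| + |g₂|)) := by ring
      _ ≤ _ := by gcongr
  have z := mul_nonneg (abs_nonneg e₂) hN0
  have z1 := mul_nonneg (abs_nonneg k₁) hN0
  have z2 := mul_nonneg (abs_nonneg k₂) hN0
  nlinarith

/-- Combining the forward error with `AdjMul.lower` makes the error relative to `k` itself, with `χ`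
as the price of possible cancellation. -/
theorem AdjMul.err_le' (H : AdjMul u a b d g₁ g₂ k₁ k₂) (hu : 0 ≤ u)
    (had : a * d ≠ 0) (hχ : (|a| + |b| + |d|) ^ 2 ≤ χ * |a * d|) (huχ : u * χ ≤ 1 / 1000) :
    |k₁ - g₁ * d| + |k₂ - (-(g₁ * b) + g₂ * a)| ≤ 12 * (u * χ) * (|k₁| + |k₂|) := by
  have h := H.lower hu hχ huχ
  have had' := abs_pos.2 had
  refine (H.err_le hu).trans (le_of_mul_le_mul_left ?_ had')
  set N := |a| + |b| + |d|
  calc |a * d| * (3 * u * (N * (|g₁| + |g₂|)))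
      = 3 * u * N * (|a * d| * (|g₁| + |g₂|)) := by ring
    _ ≤ 3 * u * N * (4 * N * (|k₁| + |k₂|)) := by gcongr
    _ = 12 * u * N ^ 2 * (|k₁| + |k₂|) := by ring
    _ ≤ 12 * u * (χ * |a * d|) * (|k₁| + |k₂|) := by gcongr
    _ = _ := by ring

theorem AdjMul.ne_zero (H : AdjMul u a b d g₁ g₂ k₁ k₂) (hu : 0 ≤ u)
    (had : a * d ≠ 0) (hχ : (|a| + |b| + |d|) ^ 2 ≤ χ * |a * d|) (huχ : u * χ ≤ 1 / 1000)
    (hg : ¬ (g₁ = 0 ∧ g₂ = 0)) : ¬ (k₁ = 0 ∧ k₂ = 0) := by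
  rintro ⟨rfl, rfl⟩
  have h := H.lower hu hχ huχ
  have had' := abs_pos.2 had
  simp only [abs_zero, add_zero, mul_zero] at h
  have : |g₁| + |g₂| ≤ 0 := nonpos_of_mul_nonpos_right h had'
  exact hg ⟨abs_nonpos_iff.1 (by linarith [abs_nonneg g₂]),
    abs_nonpos_iff.1 (by linarith [abs_nonneg g₁])⟩

theorem AdjMul.eq_zero (H : AdjMul u a b d g₁ g₂ k₁ k₂) (hg : g₁ = 0 ∧ g₂ = 0) :
    k₁ = 0 ∧ k₂ = 0 := by
  obtain ⟨rfl, rfl⟩ := hg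
  have h1 := H.fst
  have h2 := H.snd
  simp only [zero_mul, neg_zero, add_zero, abs_zero, mul_zero, sub_zero] at h1 h2
  exact ⟨abs_nonpos_iff.1 h1, abs_nonpos_iff.1 h2⟩

/-- `Q` computed from a row and `P` from its product with `adj(A)`. -/
theorem bilin_row (H : AdjMul u a b d g₁ g₂ k₁ k₂) (hu : 0 ≤ u)
    (had : a * d ≠ 0) (hχ : (|a| + |b| + |d|) ^ 2 ≤ χ * |a * d|) (huχ : u * χ ≤ 1 / 1000) :
    |k₁ * (a * -g₂ + b * g₁) + k₂ * (d * g₁)| ≤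
      12 * (u * χ) * (|a| + |b| + |d|) * ((|k₁| + |k₂|) * (|g₁| + |g₂|)) := by
  have h := H.err_le' hu had hχ huχ
  set e₁ := k₁ - g₁ * d with h₁
  set e₂ := k₂ - (-(g₁ * b) + g₂ * a) with h₂
  set N := |a| + |b| + |d| with hN
  have a0 := abs_nonneg a
  have b0 := abs_nonneg b
  have d0 := abs_nonneg d
  have i1 := abs_nonneg g₁
  have i2 := abs_nonneg g₂
  have n1 : |a * -g₂ + b * g₁| ≤ N * (|g₁| + |g₂|) := by
    refine (abs_add_le _ _).trans ?_
    rw [abs_mul, abs_mul, abs_neg, hN]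
    nlinarith [mul_nonneg a0 i1, mul_nonneg b0 i2, mul_nonneg d0 i1, mul_nonneg d0 i2]
  have n2 : |d * g₁| ≤ N * (|g₁| + |g₂|) := by
    rw [abs_mul, hN]
    nlinarith [mul_nonneg a0 i1, mul_nonneg b0 i2, mul_nonneg d0 i2, mul_nonneg a0 i2,
      mul_nonneg b0 i1]
  calc _ = |e₁ * (a * -g₂ + b * g₁) + e₂ * (d * g₁)| := by
        congr 1; rw [h₁, h₂]; ring
    _ ≤ |e₁| * |a * -g₂ + b * g₁| + |e₂| * |d * g₁| := by
        rw [← abs_mul, ← abs_mul]; exact abs_add_le _ _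
    _ ≤ |e₁| * (N * (|g₁| + |g₂|)) + |e₂| * (N * (|g₁| + |g₂|)) := by gcongr
    _ = (|e₁| + |e₂|) * (N * (|g₁| + |g₂|)) := by ring
    _ ≤ 12 * (u * χ) * (|k₁| + |k₂|) * (N * (|g₁| + |g₂|)) := by gcongr
    _ = _ := by ring

theorem bilin_majorant_le {a b d : ℝ} (h1 : 0 ≤ gh₁) (h2 : 0 ≤ gh₂) (h3 : 0 ≤ lh₁) (h4 : 0 ≤ lh₂) :
    gh₁ * |d| * lh₁ + gh₁ * |b| * lh₂ + gh₂ * |a| * lh₂ ≤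
      (|a| + |b| + |d|) * ((gh₁ + gh₂) * (lh₁ + lh₂)) := by
  have key : 0 ≤ |a| * (gh₁ * lh₁ + gh₁ * lh₂ + gh₂ * lh₁) +
      |b| * (gh₁ * lh₁ + gh₂ * lh₂ + gh₂ * lh₁) +
      |d| * (gh₁ * lh₂ + gh₂ * lh₁ + gh₂ * lh₂) := by positivity
  nlinarith [key]

/-- The majorant of `k` already contains the products of that of `g` with `|adj(A)|`. The majorant
of `l` is recovered from that of `h` by `AdjMul.lower`, since `|adj(A)|` is the adjugate of the
matrix with entries `|a|`, `-|b|`, `|d|`. -/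
theorem majorant_adj_le (Hkh : AdjMul u |a| (-|b|) |d| gh₁ gh₂ kh₁ kh₂)
    (Hhh : AdjMul u |d| (-|b|) |a| lh₂ lh₁ hh₂ hh₁) (hu : 0 ≤ u)
    (n1 : 0 ≤ gh₁) (n2 : 0 ≤ gh₂) (n3 : 0 ≤ lh₁) (n4 : 0 ≤ lh₂)
    (hκ : 1 ≤ κ) (hκχ : κ ≤ χ)
    (hχ : (|a| + |b| + |d|) ^ 2 ≤ χ * |a * d|) (huχ : u * χ ≤ 1 / 1000) {X Y kk hhs : ℝ}
    (hY : 0 ≤ Y) (hXY : X * Y ≤ 10 * κ) (hkk : 0 ≤ kk) (hhhs : 0 ≤ hhs)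
    (hk : kh₁ + kh₂ ≤ 1.01 * Y * kk) (hh : hh₂ + hh₁ ≤ 1.01 * X * hhs) :
    |a * d| * (gh₁ * |d| * lh₁ + gh₁ * |b| * lh₂ + gh₂ * |a| * lh₂) ≤
      41.5 * κ * (|a| + |b| + |d|) * (kk * hhs) := by
  have eN : |(|d|)| + |(-|b|)| + |(|a|)| = |a| + |b| + |d| := by
    rw [abs_neg, abs_abs, abs_abs, abs_abs]; ring
  have ead : |(|d| * |a|)| = |a * d| := by rw [← abs_mul, abs_abs, mul_comm]
  have lowlh := Hhh.lower hu (by rw [eN, ead]; exact hχ) huχ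
  rw [eN, ead, abs_of_nonneg n3, abs_of_nonneg n4] at lowlh
  have hkh1 := (abs_le.1 Hkh.fst).1
  have hkh2 := (abs_le.1 Hkh.snd).1
  have hhh1 := (abs_le.1 Hhh.fst).1
  have hhh2 := (abs_le.1 Hhh.snd).1
  have hu1 : u ≤ 1 / 1000 := by nlinarith
  have c1 : 0 ≤ gh₁ * |d| := by positivity
  have c2 : 0 ≤ gh₁ * |b| := by positivity
  have c3 : 0 ≤ gh₂ * |a| := by positivity
  have c4 : 0 ≤ lh₂ * |a| := by positivity
  have c5 : 0 ≤ lh₂ * |b| := by positivity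
  have c6 : 0 ≤ lh₁ * |d| := by positivity
  have t1 := mul_le_mul_of_nonneg_right hu1 c1
  have t2 := mul_le_mul_of_nonneg_right hu1 c2
  have t3 := mul_le_mul_of_nonneg_right hu1 c3
  have t4 := mul_le_mul_of_nonneg_right hu1 c4
  have t5 := mul_le_mul_of_nonneg_right hu1 c5
  have t6 := mul_le_mul_of_nonneg_right hu1 c6
  rw [mul_neg, neg_neg, abs_neg, abs_of_nonneg c2, abs_of_nonneg c3] at hkh2
  rw [abs_of_nonneg c1] at hkh1
  rw [mul_neg, neg_neg, abs_neg, abs_of_nonneg c5, abs_of_nonneg c6] at hhh2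
  rw [abs_of_nonneg c4] at hhh1
  have khs1 : gh₁ * |d| ≤ 1.01 * kh₁ := by linarith
  have khs2 : gh₁ * |b| + gh₂ * |a| ≤ 1.01 * kh₂ := by linarith
  have hhn1 : 0 ≤ hh₁ := by linarith
  have hhn2 : 0 ≤ hh₂ := by linarith
  have khn1 : 0 ≤ kh₁ := by linarith
  have khn2 : 0 ≤ kh₂ := by linarith
  rw [abs_of_nonneg hhn1, abs_of_nonneg hhn2] at lowlh
  clear hkh1 hkh2 hhh1 hhh2 t1 t2 t3 t4 t5 t6
  have N0 : 0 ≤ |a| + |b| + |d| := by positivity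
  generalize |a| + |b| + |d| = N at *
  have W1 : gh₁ * |d| * lh₁ + gh₁ * |b| * lh₂ + gh₂ * |a| * lh₂ ≤
      1.01 * (kh₁ + kh₂) * (lh₂ + lh₁) := by
    have w1 := mul_le_mul_of_nonneg_right khs1 n3
    have w2 := mul_le_mul_of_nonneg_right khs2 n4
    have w3 := mul_nonneg khn1 n4
    have w4 := mul_nonneg khn2 n3
    linarith
  calc |a * d| * _ ≤ |a * d| * (1.01 * (kh₁ + kh₂) * (lh₂ + lh₁)) := by gcongr
    _ = 1.01 * (kh₁ + kh₂) * (|a * d| * (lh₂ + lh₁)) := by ring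
    _ ≤ 1.01 * (kh₁ + kh₂) * (4 * N * (hh₂ + hh₁)) := by gcongr
    _ ≤ 1.01 * (1.01 * Y * kk) * (4 * N * (1.01 * X * hhs)) := by gcongr
    _ = 1.01 ^ 3 * 4 * (X * Y) * N * (kk * hhs) := by ring
    _ ≤ 1.01 ^ 3 * 4 * (10 * κ) * N * (kk * hhs) := by gcongr
    _ ≤ _ := by
      have : 0 ≤ κ * N * (kk * hhs) := by positivity
      linarith

/-- Both `P` and `Q` computed from vectors multiplied by `adj(A)`. -/
theorem bilin_adj (Hk : AdjMul u a b d g₁ g₂ k₁ k₂) (Hh : AdjMul u d b a l₂ l₁ h₂ h₁)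
    (hu : 0 ≤ u) (had : a * d ≠ 0) (hκ : 1 ≤ κ) (hκχ : κ ≤ χ)
    (hχ : (|a| + |b| + |d|) ^ 2 ≤ χ * |a * d|) (huχ : u * χ ≤ 1 / 1000) {W : ℝ}
    (res : |g₁ * d * l₁ - g₁ * b * l₂ + g₂ * a * l₂| ≤ 550 * u * W)
    (hW : |a * d| * W ≤
      41.5 * κ * (|a| + |b| + |d|) * ((|k₁| + |k₂|) * (|h₂| + |h₁|))) :
    |k₁ * (a * h₁ + b * h₂) + k₂ * (d * h₂)| ≤
      30000 * (u * χ) * (|a| + |b| + |d|) * ((|k₁| + |k₂|) * (|h₁| + |h₂|)) := by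
  have hda : d * a ≠ 0 := by rwa [mul_comm]
  have eN : |d| + |b| + |a| = |a| + |b| + |d| := by ring
  have ead : |d * a| = |a * d| := by rw [mul_comm]
  have hχ' : (|d| + |b| + |a|) ^ 2 ≤ χ * |d * a| := by rw [eN, ead]; exact hχ
  have errk := Hk.err_le' hu had hχ huχ
  have errh := Hh.err_le' hu hda hχ' huχ
  have lowg := Hk.lower hu hχ huχ
  have lowl := Hh.lower hu hχ' huχ
  rw [eN, ead] at lowl
  -- With exact `k` and `h` only the first term remains, by A adj(A) = det(A) I. The next two are
  -- linear in the rounding errors of `k` and `h`, the last is quadratic.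
  have id : k₁ * (a * h₁ + b * h₂) + k₂ * (d * h₂) =
      a * d * (g₁ * d * l₁ - g₁ * b * l₂ + g₂ * a * l₂) +
      a * d * ((k₁ - g₁ * d) * l₁ + (k₂ - (-(g₁ * b) + g₂ * a)) * l₂) +
      a * d * (g₁ * (h₁ - (-(l₂ * b) + l₁ * d)) + g₂ * (h₂ - l₂ * a)) +
      ((k₁ - g₁ * d) * (a * (h₁ - (-(l₂ * b) + l₁ * d)) + b * (h₂ - l₂ * a)) +
        (k₂ - (-(g₁ * b) + g₂ * a)) * (d * (h₂ - l₂ * a))) := by ring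
  rw [id, add_comm |h₁|]
  generalize k₁ - g₁ * d = e₁ at *
  generalize k₂ - (-(g₁ * b) + g₂ * a) = e₂ at *
  generalize h₂ - l₂ * a = f₂ at *
  generalize h₁ - (-(l₂ * b) + l₁ * d) = f₁ at *
  have two : ∀ p q r s : ℝ, |p * r + q * s| ≤ (|p| + |q|) * (|r| + |s|) := fun p q r s => by
    refine (abs_add_le _ _).trans ?_
    rw [abs_mul, abs_mul]
    nlinarith [mul_nonneg (abs_nonneg p) (abs_nonneg s), mul_nonneg (abs_nonneg q) (abs_nonneg r)]
  have m1 : |a * f₁ + b * f₂| + |d * f₂| ≤ (|a| + |b| + |d|) * (|f₂| + |f₁|) := by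
    have := abs_add_le (a * f₁) (b * f₂)
    rw [abs_mul, abs_mul] at this
    rw [abs_mul]
    nlinarith [mul_nonneg (abs_nonneg a) (abs_nonneg f₂), mul_nonneg (abs_nonneg b) (abs_nonneg f₁),
      mul_nonneg (abs_nonneg d) (abs_nonneg f₁)]
  have N0 : 0 ≤ |a| + |b| + |d| := by positivity
  generalize |a| + |b| + |d| = N at *
  have kk0 : 0 ≤ |k₁| + |k₂| := by positivity
  generalize |k₁| + |k₂| = kk at *
  have hs0 : 0 ≤ |h₂| + |h₁| := by positivity
  generalize |h₂| + |h₁| = hhs at *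
  have χ0 : 0 ≤ χ := by linarith
  have uχ0 : 0 ≤ u * χ := mul_nonneg hu χ0
  have T1 : |a * d * (g₁ * d * l₁ - g₁ * b * l₂ + g₂ * a * l₂)| ≤
      22825 * (u * χ) * N * (kk * hhs) := by
    rw [abs_mul]
    calc |a * d| * _ ≤ |a * d| * (550 * u * W) := by gcongr
      _ = 550 * u * (|a * d| * W) := by ring
      _ ≤ 550 * u * (41.5 * κ * N * (kk * hhs)) := by gcongr
      _ ≤ 550 * u * (41.5 * χ * N * (kk * hhs)) := by gcongr
      _ = _ := by ring
  have T2 : |a * d * (e₁ * l₁ + e₂ * l₂)| ≤ 48 * (u * χ) * N * (kk * hhs) := by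
    rw [abs_mul]
    calc |a * d| * _ ≤ |a * d| * ((|e₁| + |e₂|) * (|l₁| + |l₂|)) := by gcongr; exact two _ _ _ _
      _ = (|e₁| + |e₂|) * (|a * d| * (|l₂| + |l₁|)) := by ring
      _ ≤ (12 * (u * χ) * kk) * (4 * N * hhs) := by gcongr
      _ = _ := by ring
  have T3 : |a * d * (g₁ * f₁ + g₂ * f₂)| ≤ 48 * (u * χ) * N * (kk * hhs) := by
    rw [abs_mul]
    calc |a * d| * _ ≤ |a * d| * ((|g₁| + |g₂|) * (|f₁| + |f₂|)) := by gcongr; exact two _ _ _ _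
      _ = (|a * d| * (|g₁| + |g₂|)) * (|f₂| + |f₁|) := by ring
      _ ≤ (4 * N * kk) * (12 * (u * χ) * hhs) := by gcongr
      _ = _ := by ring
  have S0 : 0 ≤ (u * χ) * N * (kk * hhs) := by positivity
  have T4 : |e₁ * (a * f₁ + b * f₂) + e₂ * (d * f₂)| ≤ 1 * (u * χ) * N * (kk * hhs) := by
    calc _ ≤ (|e₁| + |e₂|) * (|a * f₁ + b * f₂| + |d * f₂|) := two _ _ _ _
      _ ≤ (|e₁| + |e₂|) * (N * (|f₂| + |f₁|)) := by gcongr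
      _ ≤ (12 * (u * χ) * kk) * (N * (12 * (u * χ) * hhs)) := by gcongr
      _ = 144 * (u * χ) * ((u * χ) * N * (kk * hhs)) := by ring
      _ ≤ 144 * (1 / 1000) * ((u * χ) * N * (kk * hhs)) := by gcongr
      _ ≤ _ := by linarith
  refine (abs_add_le _ _).trans ?_
  have := abs_add_three (a * d * (g₁ * d * l₁ - g₁ * b * l₂ + g₂ * a * l₂))
    (a * d * (e₁ * l₁ + e₂ * l₂)) (a * d * (g₁ * f₁ + g₂ * f₂))
  linarith

/-- Both `P` and `Q` computed from the original vectors. -/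
theorem bilin_orig (n1 : 0 ≤ gh₁) (n2 : 0 ≤ gh₂) (n3 : 0 ≤ lh₁) (n4 : 0 ≤ lh₂) (hu : 0 ≤ u)
    (hκ : 1 ≤ κ) (hκχ : κ ≤ χ)
    (res : |g₁ * d * l₁ - g₁ * b * l₂ + g₂ * a * l₂| ≤
      550 * u * (gh₁ * |d| * lh₁ + gh₁ * |b| * lh₂ + gh₂ * |a| * lh₂)) {X Y : ℝ}
    (hX : 0 ≤ X) (hXY : X * Y ≤ 10 * κ)
    (hg : gh₁ + gh₂ ≤ 1.01 * X * (|g₁| + |g₂|)) (hl : lh₂ + lh₁ ≤ 1.01 * Y * (|l₂| + |l₁|)) :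
    |l₂ * (a * -g₂ + b * g₁) + -l₁ * (d * g₁)| ≤
      30000 * (u * χ) * (|a| + |b| + |d|) * ((|l₂| + |l₁|) * (|g₁| + |g₂|)) := by
  set N := |a| + |b| + |d| with hN
  have N0 : 0 ≤ N := by positivity
  have W := bilin_majorant_le (a := a) (b := b) (d := d) n1 n2 n3 n4
  rw [← hN] at W
  calc _ = |g₁ * d * l₁ - g₁ * b * l₂ + g₂ * a * l₂| := by rw [← abs_neg]; congr 1; ring
    _ ≤ 550 * u * (N * ((gh₁ + gh₂) * (lh₂ + lh₁))) := by
        refine res.trans ?_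
        rw [add_comm lh₂]; gcongr
    _ ≤ 550 * u * (N * ((1.01 * X * (|g₁| + |g₂|)) * (1.01 * Y * (|l₂| + |l₁|)))) := by gcongr
    _ = 550 * 1.01 ^ 2 * u * (X * Y) * (N * ((|l₂| + |l₁|) * (|g₁| + |g₂|))) := by ring
    _ ≤ 550 * 1.01 ^ 2 * u * (10 * χ) * (N * ((|l₂| + |l₁|) * (|g₁| + |g₂|))) := by
        have : X * Y ≤ 10 * χ := by linarith
        gcongr
    _ ≤ _ := by
        have χ0 : 0 ≤ χ := by linarith
        have : 0 ≤ u * χ * (N * ((|l₂| + |l₁|) * (|g₁| + |g₂|))) := by positivity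
        linarith

end

/-- Passing from a bilinear bound to normalized vectors. -/
theorem bilin_normalize {a b d E v₁ v₂ w₁ w₂ σ τ : ℝ} (hE : 0 ≤ E)
    (H : |v₁ * (a * w₁ + b * w₂) + v₂ * (d * w₂)| ≤ E * ((|v₁| + |v₂|) * (|w₁| + |w₂|)))
    (hv : ¬ (v₁ = 0 ∧ v₂ = 0)) (hw : ¬ (w₁ = 0 ∧ w₂ = 0)) (hσ : |σ| = 1) (hτ : |τ| = 1)
    {ρ r : ℝ} (hρ : ρ = √(v₁ ^ 2 + v₂ ^ 2)) (hr : r = √(w₁ ^ 2 + w₂ ^ 2)) :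
    |σ * (v₁ / ρ) * (a * (τ * (w₁ / r)) + b * (τ * (w₂ / r))) +
      σ * (v₂ / ρ) * (d * (τ * (w₂ / r)))| ≤ 2 * E := by
  have pos : ∀ {x y : ℝ}, ¬ (x = 0 ∧ y = 0) → 0 < x ^ 2 + y ^ 2 := by
    intro x y h
    rcases not_and_or.1 h with h | h <;> positivity
  have hρ0 : 0 < ρ := by rw [hρ]; exact Real.sqrt_pos.2 (pos hv)
  have hr0 : 0 < r := by rw [hr]; exact Real.sqrt_pos.2 (pos hw)
  have hρ2 : ρ ^ 2 = v₁ ^ 2 + v₂ ^ 2 := by rw [hρ, Real.sq_sqrt (pos hv).le]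
  have hr2 : r ^ 2 = w₁ ^ 2 + w₂ ^ 2 := by rw [hr, Real.sq_sqrt (pos hw).le]
  -- The 1-norm is at most √2 times the Euclidean norm; two such factors produce the 2 in the
  -- conclusion.
  have cs : ∀ {x y z : ℝ}, 0 < z → z ^ 2 = x ^ 2 + y ^ 2 → (|x| + |y|) ^ 2 ≤ 2 * z ^ 2 := by
    intro x y z _ h
    rw [h, ← sq_abs x, ← sq_abs y]
    nlinarith [sq_nonneg (|x| - |y|)]
  have m : (|v₁| + |v₂|) * (|w₁| + |w₂|) ≤ 2 * (ρ * r) := by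
    refine abs_le_of_sq_le_sq' ?_ (by positivity) |>.2
    calc ((|v₁| + |v₂|) * (|w₁| + |w₂|)) ^ 2 = (|v₁| + |v₂|) ^ 2 * (|w₁| + |w₂|) ^ 2 := by ring
      _ ≤ (2 * ρ ^ 2) * (2 * r ^ 2) := by gcongr; exacts [cs hρ0 hρ2, cs hr0 hr2]
      _ = _ := by ring
  have e : σ * (v₁ / ρ) * (a * (τ * (w₁ / r)) + b * (τ * (w₂ / r))) +
      σ * (v₂ / ρ) * (d * (τ * (w₂ / r))) =
      σ * τ * ((v₁ * (a * w₁ + b * w₂) + v₂ * (d * w₂)) / (ρ * r)) := by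
    field_simp
  rw [e, abs_mul, abs_mul, hσ, hτ, one_mul, one_mul, abs_div,
    abs_of_pos (mul_pos hρ0 hr0), div_le_iff₀ (mul_pos hρ0 hr0)]
  calc _ ≤ E * ((|v₁| + |v₂|) * (|w₁| + |w₂|)) := H
    _ ≤ E * (2 * (ρ * r)) := by gcongr
    _ = _ := by ring


/-! ### Entries, spectral norm and condition number -/

theorem abs_entry_le_norm (A : Mat2) (i j : Fin 2) : |A i j| ≤ ‖A‖ := by
  have h := Matrix.l2_opNorm_mulVec A (EuclideanSpace.single j (1 : ℝ))
  rw [PiLp.norm_single, norm_one, mul_one] at h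
  refine le_trans ?_ h
  have h2 := PiLp.norm_apply_le ((EuclideanSpace.equiv (Fin 2) ℝ).symm
    (A.mulVec (EuclideanSpace.single j (1 : ℝ)))) i
  refine le_trans (le_of_eq ?_) h2
  simp [Matrix.mulVec_single]

theorem rot_mem {c s : ℝ} (h : c ^ 2 + s ^ 2 = 1) :
    rot c s ∈ Matrix.orthogonalGroup (Fin 2) ℝ := by
  rw [Matrix.mem_orthogonalGroup_iff]
  ext i j
  fin_cases i <;> fin_cases j <;> simp [rot, Matrix.mul_apply] <;> linarith

/-- Both the diagonal part and the antidiagonal part, a diagonal matrix times a quarter turn, have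
norm at most `m`. -/
theorem norm_le_of_entries {X : Mat2} {m : ℝ} (h : ∀ i j, |X i j| ≤ m) : ‖X‖ ≤ 2 * m := by
  have hm : 0 ≤ m := (abs_nonneg _).trans (h 0 0)
  have e : X = Matrix.diagonal ![X 0 0, X 1 1] +
      Matrix.diagonal ![-X 0 1, X 1 0] * rot 0 1 := by
    ext i j
    fin_cases i <;> fin_cases j <;> simp [rot, Matrix.mul_apply, Matrix.diagonal]
  have hd : ∀ x y : ℝ, |x| ≤ m → |y| ≤ m → ‖(Matrix.diagonal ![x, y] : Mat2)‖ ≤ m := by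
    intro x y hx hy
    rw [Matrix.l2_opNorm_diagonal, pi_norm_le_iff_of_nonneg hm]
    intro i
    fin_cases i <;> simpa
  have hJ : rot 0 1 ∈ unitary Mat2 := rot_mem (by norm_num)
  rw [e]
  refine (norm_add_le _ _).trans ?_
  rw [CStarRing.norm_mul_mem_unitary _ hJ, two_mul]
  exact add_le_add (hd _ _ (h 0 0) (h 1 1)) (hd _ _ (by rw [abs_neg]; exact h 0 1) (h 1 0))

section
variable {A : Mat2}

theorem det_of_upper (hA : A 1 0 = 0) : A.det = A 0 0 * A 1 1 := by
  rw [Matrix.det_fin_two, hA, mul_zero, sub_zero]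

/-- In dimension two the adjugate has the entries of `A` up to order and sign, so each entry is
bounded by `‖A⁻¹‖ |det A|` as well as by `‖A‖`. -/
theorem entry_mul_entry_le (hA : A 1 0 = 0) (hdet : A.det ≠ 0) {x y : ℝ}
    (hx : ∃ i j, |x| = |A i j|) (hy : ∃ i j, |y| = |A i j|) :
    |x| * |y| ≤ cond A * |A 0 0 * A 1 1| := by
  obtain ⟨i, j, hx⟩ := hx
  have key : |y| ≤ ‖A⁻¹‖ * |A 0 0 * A 1 1| := by
    rw [← det_of_upper hA]
    have hd := abs_pos.2 hdet
    have hadj : ∃ i j, |y| = |A.adjugate i j| := by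
      obtain ⟨i, j, hy⟩ := hy
      rw [Matrix.adjugate_fin_two]
      fin_cases i <;> fin_cases j
      · exact ⟨1, 1, by simpa using hy⟩
      · exact ⟨0, 1, by simpa using hy⟩
      · exact ⟨1, 0, by simpa using hy⟩
      · exact ⟨0, 0, by simpa using hy⟩
    obtain ⟨i, j, hy⟩ := hadj
    have h := abs_entry_le_norm A⁻¹ i j
    rw [Matrix.inv_def, Matrix.smul_apply, Ring.inverse_eq_inv', smul_eq_mul, abs_mul, ← hy,
      abs_inv, inv_mul_le_iff₀ hd] at h
    rwa [← Ring.inverse_eq_inv', ← Matrix.inv_def, mul_comm] at h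
  rw [cond, mul_assoc, hx]
  exact mul_le_mul (abs_entry_le_norm A i j) key (abs_nonneg _) (norm_nonneg _)

theorem one_le_cond (hA : A 1 0 = 0) (hdet : A.det ≠ 0) : 1 ≤ cond A := by
  have h := entry_mul_entry_le hA hdet (x := A 0 0) (y := A 1 1) ⟨0, 0, rfl⟩ ⟨1, 1, rfl⟩
  rw [← abs_mul] at h
  rw [det_of_upper hA] at hdet
  have := abs_pos.2 hdet
  by_contra hc
  nlinarith

theorem sum_sq_le (hA : A 1 0 = 0) (hdet : A.det ≠ 0) :
    (|A 0 0| + |A 0 1| + |A 1 1|) ^ 2 ≤ 9 * cond A * |A 0 0 * A 1 1| := by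
  have key := fun x y => entry_mul_entry_le hA hdet (x := x) (y := y)
  have e0 : ∃ i j, |A 0 0| = |A i j| := ⟨0, 0, rfl⟩
  have e1 : ∃ i j, |A 0 1| = |A i j| := ⟨0, 1, rfl⟩
  have e2 : ∃ i j, |A 1 1| = |A i j| := ⟨1, 1, rfl⟩
  have := key _ _ e0 e0
  have := key _ _ e0 e1
  have := key _ _ e0 e2
  have := key _ _ e1 e1
  have := key _ _ e1 e2
  have := key _ _ e2 e2
  nlinarith

end

/-! ### From a small (1,2) entry to backward stability -/

/-- A matrix is within `δ ‖A‖` of an exact orthogonal transformation of `A` by matrices close to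
the computed ones. -/
def BackwardStable (δ : ℝ) (A : Mat2) (o : Output) : Prop :=
  ∃ P ∈ Matrix.orthogonalGroup (Fin 2) ℝ, ∃ Q ∈ Matrix.orthogonalGroup (Fin 2) ℝ, ∃ δA : Mat2,
    ‖o.P - P‖ ≤ δ ∧ ‖o.Q - Q‖ ≤ δ ∧ o.A' = Pᵀ * (A + δA) * Q ∧ ‖δA‖ ≤ δ * ‖A‖

/-- Applied with `p = 0` to PᵀA and then with `p = 28` to its product with Q, whence the error
constants 28 and 2.2 · 28 + 28 ≤ 90. -/
theorem dot_near {u N p v x y z w x₀ y₀ z₀ w₀ : ℝ} (hu : 0 ≤ u) (hu1 : u ≤ 1 / 100000)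
    (hp : 0 ≤ p) (hp1 : p ≤ 100) (hN : 0 ≤ N)
    (hv : |v - (x * y + z * w)| ≤ 3 * u * (|x * y| + |z * w|))
    (hx : |x - x₀| ≤ p * u * N) (hz : |z - z₀| ≤ p * u * N) (hx₀ : |x₀| ≤ N) (hz₀ : |z₀| ≤ N)
    (hy : |y - y₀| ≤ 10 * u) (hw : |w - w₀| ≤ 10 * u) (hy₀ : |y₀| ≤ 1) (hw₀ : |w₀| ≤ 1) :
    |v - (x₀ * y₀ + z₀ * w₀)| ≤ (2.2 * p + 28) * u * N := by
  have bd : ∀ {x y x₀ y₀ : ℝ}, |x - x₀| ≤ p * u * N → |x₀| ≤ N → |y - y₀| ≤ 10 * u → |y₀| ≤ 1 →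
      |x * y| ≤ 1.1 * N ∧ |x * y - x₀ * y₀| ≤ (1.1 * p + 10) * u * N := by
    intro x y x₀ y₀ hx hx₀ hy hy₀
    have y1 : |y| ≤ 1.001 := by
      have := abs_sub_abs_le_abs_sub y y₀
      linarith
    have hpu : p * u ≤ 100 * (1 / 100000) := mul_le_mul hp1 hu1 hu (by norm_num)
    have x1 : |x| ≤ 1.001 * N := by
      have := abs_sub_abs_le_abs_sub x x₀
      have := mul_le_mul_of_nonneg_right hpu hN
      linarith
    constructor
    · rw [abs_mul]
      calc |x| * |y| ≤ 1.001 * N * 1.001 := by gcongr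
        _ ≤ _ := by linarith
    · have e : x * y - x₀ * y₀ = (x - x₀) * y + x₀ * (y - y₀) := by ring
      rw [e]
      calc _ ≤ |x - x₀| * |y| + |x₀| * |y - y₀| := by
            rw [← abs_mul, ← abs_mul]; exact abs_add_le _ _
        _ ≤ p * u * N * 1.001 + N * (10 * u) := by gcongr
        _ ≤ _ := by
          have : 0 ≤ p * u * N := by positivity
          linarith
  obtain ⟨a1, a2⟩ := bd hx hx₀ hy hy₀
  obtain ⟨b1, b2⟩ := bd hz hz₀ hw hw₀
  calc _ = |(v - (x * y + z * w)) + (x * y - x₀ * y₀) + (z * w - z₀ * w₀)| := by congr 1; ring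
    _ ≤ |v - (x * y + z * w)| + |x * y - x₀ * y₀| + |z * w - z₀ * w₀| := abs_add_three _ _ _
    _ ≤ 3 * u * (1.1 * N + 1.1 * N) + (1.1 * p + 10) * u * N + (1.1 * p + 10) * u * N := by
        gcongr
        exact hv.trans (by gcongr)
    _ ≤ _ := by
        have : 0 ≤ u * N := by positivity
        linarith

/-- Backward stability of the computed `PᵀAQ` with its `(1,2)` entry set to zero, provided that
this entry is small for exact rotations close to the computed ones. -/
theorem backwardStable_of_small {u : ℝ} (fl : FlArith u) (hu : 0 ≤ u) (hu1 : u ≤ 1 / 100000)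
    {A : Mat2} (hA : A 1 0 = 0) {p₁ p₂ q₁ q₂ c s x y E : ℝ} (hcs : c ^ 2 + s ^ 2 = 1)
    (hxy : x ^ 2 + y ^ 2 = 1) (hp₁ : |p₁ - c| ≤ 10 * u) (hp₂ : |p₂ - s| ≤ 10 * u)
    (hq₁ : |q₁ - x| ≤ 10 * u) (hq₂ : |q₂ - y| ≤ 10 * u)
    (hE : |c * (A 0 0 * -y + A 0 1 * x) + s * (A 1 1 * x)| ≤ E)
    (hE1 : 90 * u * (|A 0 0| + |A 0 1| + |A 1 1|) ≤ E) {o : Output} (ho1 : o.P = rot p₁ p₂)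
    (ho2 : o.Q = rot q₁ q₂)
    (ho3 : o.A' = clear12 (fl.mmul (fl.mmul (rot p₁ p₂)ᵀ A) (rot q₁ q₂))) {δ : ℝ}
    (h20 : 20 * u ≤ δ) (hδ : 2 * E ≤ δ * ‖A‖) : BackwardStable δ A o := by
  have hP := rot_mem hcs
  have hQ := rot_mem hxy
  have hP1 := (Matrix.mem_orthogonalGroup_iff (n := Fin 2) (R := ℝ)).1 hP
  have hP2 := (Matrix.mem_orthogonalGroup_iff' (n := Fin 2) (R := ℝ)).1 hP
  have hQ1 := (Matrix.mem_orthogonalGroup_iff (n := Fin 2) (R := ℝ)).1 hQ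
  have hQ2 := (Matrix.mem_orthogonalGroup_iff' (n := Fin 2) (R := ℝ)).1 hQ
  have c1 : |c| ≤ 1 := abs_le_one_iff_mul_self_le_one.2 (by nlinarith [sq_nonneg s])
  have s1 : |s| ≤ 1 := abs_le_one_iff_mul_self_le_one.2 (by nlinarith [sq_nonneg c])
  have x1 : |x| ≤ 1 := abs_le_one_iff_mul_self_le_one.2 (by nlinarith [sq_nonneg y])
  have y1 : |y| ≤ 1 := abs_le_one_iff_mul_self_le_one.2 (by nlinarith [sq_nonneg x])
  have rnear : ∀ {p q c s : ℝ}, |p - c| ≤ 10 * u → |q - s| ≤ 10 * u →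
      ∀ i j, |rot p q i j - rot c s i j| ≤ 10 * u := by
    intro p q c s h1 h2 i j
    have h3 : |s - q| ≤ 10 * u := by rw [abs_sub_comm]; exact h2
    fin_cases i <;> fin_cases j <;> simpa [rot, neg_add_eq_sub] using by assumption
  have rle : ∀ {c s : ℝ}, |c| ≤ 1 → |s| ≤ 1 → ∀ i j, |rot c s i j| ≤ 1 := by
    intro c s h1 h2 i j
    fin_cases i <;> fin_cases j <;> simpa [rot] using by assumption
  have nP := rnear hp₁ hp₂
  have nQ := rnear hq₁ hq₂
  have lP := rle c1 s1
  have lQ := rle x1 y1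
  set N := |A 0 0| + |A 0 1| + |A 1 1| with hN
  have N0 : 0 ≤ N := by positivity
  have AN : ∀ i j, |A i j| ≤ N := by
    intro i j
    have a0 := abs_nonneg (A 0 0)
    have a1 := abs_nonneg (A 0 1)
    have a2 := abs_nonneg (A 1 1)
    fin_cases i <;> fin_cases j <;> simp [hA] <;> linarith
  have col : ∀ j, |A 0 j| + |A 1 j| ≤ N := by
    intro j
    have a0 := abs_nonneg (A 0 0)
    have a1 := abs_nonneg (A 0 1)
    have a2 := abs_nonneg (A 1 1)
    fin_cases j <;> simp [hA] <;> linarith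
  have nT : ∀ i j, |fl.mmul (rot p₁ p₂)ᵀ A i j - ((rot c s)ᵀ * A) i j| ≤ 28 * u * N := by
    intro i j
    have hv := fl.dot_err hu (by linarith) (rot p₁ p₂ 0 i) (A 0 j) (rot p₁ p₂ 1 i) (A 1 j)
    rw [mul_comm (rot p₁ p₂ 0 i) (A 0 j), mul_comm (rot p₁ p₂ 1 i) (A 1 j)] at hv
    have := dot_near (p := 0) hu hu1 le_rfl (by norm_num) N0 hv (x₀ := A 0 j) (z₀ := A 1 j)
      (by simp) (by simp) (AN _ _) (AN _ _) (nP 0 i) (nP 1 i) (lP 0 i) (lP 1 i)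
    rw [Matrix.mul_apply, Fin.sum_univ_two, Matrix.transpose_apply, Matrix.transpose_apply,
      mul_comm (rot c s 0 i), mul_comm (rot c s 1 i)]
    refine this.trans_eq (by ring)
  have lT : ∀ i j, |((rot c s)ᵀ * A) i j| ≤ N := by
    intro i j
    rw [Matrix.mul_apply, Fin.sum_univ_two, Matrix.transpose_apply, Matrix.transpose_apply]
    refine (abs_add_le _ _).trans (le_trans ?_ (col j))
    rw [abs_mul, abs_mul]
    exact add_le_add (mul_le_of_le_one_left (abs_nonneg _) (lP 0 i))
      (mul_le_of_le_one_left (abs_nonneg _) (lP 1 i))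
  have nA : ∀ i j, |fl.mmul (fl.mmul (rot p₁ p₂)ᵀ A) (rot q₁ q₂) i j -
      ((rot c s)ᵀ * A * rot x y) i j| ≤ 90 * u * N := by
    intro i j
    have hv := fl.dot_err hu (by linarith) (fl.mmul (rot p₁ p₂)ᵀ A i 0) (rot q₁ q₂ 0 j)
      (fl.mmul (rot p₁ p₂)ᵀ A i 1) (rot q₁ q₂ 1 j)
    have := dot_near (p := 28) hu hu1 (by norm_num) (by norm_num) N0 hv (nT i 0) (nT i 1)
      (lT i 0) (lT i 1) (nQ 0 j) (nQ 1 j) (lQ 0 j) (lQ 1 j)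
    rw [Matrix.mul_apply (M := (rot c s)ᵀ * A), Fin.sum_univ_two]
    refine this.trans ?_
    have : 0 ≤ u * N := by positivity
    linarith
  -- At the cleared position the difference is minus the exact entry, bounded through `hE`;
  -- elsewhere only rounding contributes. The backward error is this difference carried back by the
  -- exact rotations.
  have hD : ∀ i j, |(o.A' - (rot c s)ᵀ * A * rot x y) i j| ≤ E := by
    intro i j
    rw [Matrix.sub_apply, ho3]
    by_cases hij : i = 0 ∧ j = 1
    · obtain ⟨rfl, rfl⟩ := hij
      rw [← abs_neg]
      convert hE using 2
      simp [clear12, rot, Matrix.mul_apply, hA]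
      ring
    · have : clear12 (fl.mmul (fl.mmul (rot p₁ p₂)ᵀ A) (rot q₁ q₂)) i j =
          fl.mmul (fl.mmul (rot p₁ p₂)ᵀ A) (rot q₁ q₂) i j := by
        fin_cases i <;> fin_cases j <;> simp [clear12] at hij ⊢
      rw [this]
      exact (nA i j).trans hE1
  have hPt : (rot c s) ∈ unitary Mat2 := hP
  have hQt : (rot x y)ᵀ ∈ unitary Mat2 := by
    have : (rot x y)ᵀ ∈ Matrix.orthogonalGroup (Fin 2) ℝ := by
      rw [Matrix.mem_orthogonalGroup_iff, Matrix.transpose_transpose]; exact hQ2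
    exact this
  refine ⟨rot c s, hP, rot x y, hQ,
    rot c s * (o.A' - (rot c s)ᵀ * A * rot x y) * (rot x y)ᵀ, ?_, ?_, ?_, ?_⟩
  · rw [ho1]
    refine (norm_le_of_entries (m := 10 * u) fun i j => ?_).trans (by linarith)
    exact nP i j
  · rw [ho2]
    refine (norm_le_of_entries (m := 10 * u) fun i j => ?_).trans (by linarith)
    exact nQ i j
  · set R := rot c s
    set S := rot x y
    rw [Matrix.mul_add, Matrix.add_mul]
    have : Rᵀ * (R * (o.A' - Rᵀ * A * S) * Sᵀ) * S =
        (Rᵀ * R) * (o.A' - Rᵀ * A * S) * (Sᵀ * S) := by simp only [Matrix.mul_assoc]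
    rw [this, hP2, hQ2, Matrix.one_mul, Matrix.mul_one, add_sub_cancel]
  · rw [CStarRing.norm_mul_mem_unitary _ hQt, CStarRing.norm_mem_unitary_mul _ hPt]
    exact (norm_le_of_entries hD).trans hδ


section
variable {u : ℝ} (fl : FlArith u)

theorem sq_div_sqrt_add {σ v₁ v₂ : ℝ} (hσ : |σ| = 1) (hv : ¬ (v₁ = 0 ∧ v₂ = 0)) :
    (σ * (v₁ / √(v₁ ^ 2 + v₂ ^ 2))) ^ 2 + (σ * (v₂ / √(v₁ ^ 2 + v₂ ^ 2))) ^ 2 = 1 := by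
  have h : 0 < v₁ ^ 2 + v₂ ^ 2 := by
    rcases not_and_or.1 hv with h | h <;> positivity
  have hs : σ ^ 2 = 1 := by rw [← sq_abs, hσ, one_pow]
  rw [mul_pow, mul_pow, hs, one_mul, one_mul, div_pow, div_pow, Real.sq_sqrt h.le, ← add_div,
    div_self h.ne']

/-- `R` is close to a rotation with first column parallel to `(v₁, v₂)`. -/
def NearFirstCol (u : ℝ) (R : Mat2) (v₁ v₂ : ℝ) : Prop :=
  ∃ p₁ p₂ σ, R = rot p₁ p₂ ∧ |σ| = 1 ∧ |p₁ - σ * (v₁ / √(v₁ ^ 2 + v₂ ^ 2))| ≤ 10 * u ∧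
    |p₂ - σ * (v₂ / √(v₁ ^ 2 + v₂ ^ 2))| ≤ 10 * u

/-- `R` is close to a rotation with second column parallel to `(w₁, w₂)`. -/
def NearSecondCol (u : ℝ) (R : Mat2) (w₁ w₂ : ℝ) : Prop :=
  ∃ q₁ q₂ τ, R = rot q₁ q₂ ∧ |τ| = 1 ∧ |q₁ - τ * (w₂ / √(w₁ ^ 2 + w₂ ^ 2))| ≤ 10 * u ∧
    |q₂ - -(τ * (w₁ / √(w₁ ^ 2 + w₂ ^ 2)))| ≤ 10 * u

theorem nearFirstCol_lartg {f g : ℝ} (hu : 0 ≤ u) (hu1 : u ≤ 1 / 1000)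
    (hfg : ¬ (f = 0 ∧ g = 0)) :
    NearFirstCol u !![(lartg fl f g).1, -(lartg fl f g).2; (lartg fl f g).2, (lartg fl f g).1]
      f g := by
  obtain ⟨σ, h1, h2, h3⟩ := lartg_spec fl hu hu1 hfg
  exact ⟨_, _, σ, rfl, h1, h2, h3⟩

theorem nearFirstCol_lartg_neg {f g : ℝ} (hu : 0 ≤ u) (hu1 : u ≤ 1 / 1000)
    (hfg : ¬ (f = 0 ∧ g = 0)) :
    NearFirstCol u !![(lartg fl f g).1, (lartg fl f g).2; -(lartg fl f g).2, (lartg fl f g).1]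
      f (-g) := by
  obtain ⟨σ, h1, h2, h3⟩ := lartg_spec fl hu hu1 hfg
  refine ⟨(lartg fl f g).1, -(lartg fl f g).2, σ, by rw [rot, neg_neg], h1, ?_, ?_⟩
  · rw [neg_sq]; exact h2
  · rw [neg_sq, neg_div, mul_neg, neg_sub_neg, abs_sub_comm]; exact h3

theorem nearSecondCol_lartg {f g : ℝ} (hu : 0 ≤ u) (hu1 : u ≤ 1 / 1000)
    (hfg : ¬ (f = 0 ∧ g = 0)) :
    NearSecondCol u !![(lartg fl f g).1, -(lartg fl f g).2; (lartg fl f g).2, (lartg fl f g).1]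
      (-g) f := by
  obtain ⟨τ, h1, h2, h3⟩ := lartg_spec fl hu hu1 hfg
  refine ⟨(lartg fl f g).1, (lartg fl f g).2, τ, rfl, h1, ?_, ?_⟩
  · rw [neg_sq, add_comm]; exact h2
  · rw [neg_sq, add_comm, neg_div, mul_neg, neg_neg]; exact h3

theorem nearSecondCol_lartg_neg {f g : ℝ} (hu : 0 ≤ u) (hu1 : u ≤ 1 / 1000)
    (hfg : ¬ (f = 0 ∧ g = 0)) :
    NearSecondCol u !![(lartg fl f g).1, (lartg fl f g).2; -(lartg fl f g).2, (lartg fl f g).1]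
      g f := by
  obtain ⟨τ, h1, h2, h3⟩ := lartg_spec fl hu hu1 hfg
  refine ⟨(lartg fl f g).1, -(lartg fl f g).2, τ, by rw [rot, neg_neg], h1, ?_, ?_⟩
  · rw [add_comm]; exact h2
  · rw [add_comm, neg_sub_neg, abs_sub_comm]; exact h3

/-- Normalization doubles the bilinear bound, the passage from entries to the norm doubles it again,
and `N ≤ 3 ‖A‖`: altogether 30000 · 9 · 2 · 2 · 3 = 3240000, within the stated 4000000. -/
theorem backwardStable_of_bilin (hu : 0 ≤ u) (hu1 : u ≤ 1 / 100000) {A : Mat2}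
    (hA : A 1 0 = 0) (hdet : A.det ≠ 0) {v₁ v₂ w₁ w₂ : ℝ} {o : Output}
    (hP : NearFirstCol u o.P v₁ v₂) (hQ : NearSecondCol u o.Q w₁ w₂) (hv : ¬ (v₁ = 0 ∧ v₂ = 0)) (hw : ¬ (w₁ = 0 ∧ w₂ = 0))
    (H : |v₁ * (A 0 0 * w₁ + A 0 1 * w₂) + v₂ * (A 1 1 * w₂)| ≤
      30000 * (u * (9 * cond A)) * (|A 0 0| + |A 0 1| + |A 1 1|) *
        ((|v₁| + |v₂|) * (|w₁| + |w₂|)))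
    (ho3 : o.A' = clear12 (fl.mmul (fl.mmul o.Pᵀ A) o.Q)) :
    BackwardStable (4000000 * (u * cond A)) A o := by
  obtain ⟨p₁, p₂, σ, ho1, hσ, hp₁, hp₂⟩ := hP
  obtain ⟨q₁, q₂, τ, ho2, hτ, hq₁, hq₂⟩ := hQ
  have hc := one_le_cond hA hdet
  have hc0 : 0 ≤ cond A := by linarith
  have huc : u ≤ u * cond A := le_mul_of_one_le_right hu hc
  set N := |A 0 0| + |A 0 1| + |A 1 1| with hN
  have N0 : 0 ≤ N := by positivity
  have hNA : N ≤ 3 * ‖A‖ := by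
    have := abs_entry_le_norm A 0 0
    have := abs_entry_le_norm A 0 1
    have := abs_entry_le_norm A 1 1
    linarith
  have hE := bilin_normalize (by positivity) H hv hw hσ hτ rfl rfl
  have hw' := sq_div_sqrt_add hτ hw
  refine backwardStable_of_small fl hu hu1 hA (sq_div_sqrt_add hσ hv)
    (x := τ * (w₂ / √(w₁ ^ 2 + w₂ ^ 2))) (y := -(τ * (w₁ / √(w₁ ^ 2 + w₂ ^ 2))))
    (E := 2 * (30000 * (u * (9 * cond A)) * N))
    (by rw [neg_sq]; linarith) hp₁ hp₂ hq₁ hq₂ (by rw [neg_neg]; exact hE) ?_ ho1 ho2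
    (by rw [ho3, ho1, ho2]) ?_ ?_
  · have := mul_le_mul_of_nonneg_right huc N0
    have : 0 ≤ u * cond A * N := by positivity
    rw [← hN]
    linarith
  · linarith
  · have h1 : 0 ≤ u * cond A := by positivity
    have := mul_le_mul_of_nonneg_left hNA h1
    have : 0 ≤ u * cond A * ‖A‖ := by positivity
    linarith

/-- Backward stability once an index has been selected; `cQ` and `cP` are the conditions that
decide from which vectors `Q` and `P` are computed. -/
theorem backwardStable_of_selected (hu : 0 ≤ u) {A : Mat2} (hA : A 1 0 = 0) (hdet : A.det ≠ 0)
    (huκ : u * cond A ≤ 1 / 1000000) {ηg ηh ηk ηl : EReal}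
    {g₁ g₂ k₁ k₂ l₁ l₂ h₁ h₂ gh₁ gh₂ kh₁ kh₂ lh₁ lh₂ hh₁ hh₂ : ℝ}
    (Hg : Half u (A 0 0) (A 0 1) (A 1 1) g₁ g₂ gh₁ gh₂ k₁ k₂ kh₁ kh₂ ηg ηk)
    (Hl : Half u (A 1 1) (A 0 1) (A 0 0) l₂ l₁ lh₂ lh₁ h₂ h₁ hh₂ hh₁ ηl ηh)
    (res : ¬ (g₁ = 0 ∧ g₂ = 0) → ¬ (l₂ = 0 ∧ l₁ = 0) →
      |g₁ * A 1 1 * l₁ - g₁ * A 0 1 * l₂ + g₂ * A 0 0 * l₂| ≤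
      550 * u * (gh₁ * |A 1 1| * lh₁ + gh₁ * |A 0 1| * lh₂ + gh₂ * |A 0 0| * lh₂))
    (Sel : Selected (cond A) (g₁ = 0 ∧ g₂ = 0) (l₂ = 0 ∧ l₁ = 0) ηg ηh ηk ηl)
    {cQ cP : Prop} {o : Output} (ho : o.A' = clear12 (fl.mmul (fl.mmul o.Pᵀ A) o.Q))
    (hcQ : cQ ↔ (h₁ = 0 ∧ h₂ = 0) ∨ (¬ (g₁ = 0 ∧ g₂ = 0) ∧ ηg ≤ ηh))
    (hcP : cP ↔ (k₁ = 0 ∧ k₂ = 0) ∨ (¬ (l₁ = 0 ∧ l₂ = 0) ∧ ηl ≤ ηk))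
    (Q1 : cQ → ¬ (g₁ = 0 ∧ g₂ = 0) → NearSecondCol u o.Q (-g₂) g₁)
    (Q2 : ¬ cQ → ¬ (h₂ = 0 ∧ h₁ = 0) → NearSecondCol u o.Q h₁ h₂)
    (P1 : cP → ¬ (l₂ = 0 ∧ l₁ = 0) → NearFirstCol u o.P l₂ (-l₁))
    (P2 : ¬ cP → ¬ (k₁ = 0 ∧ k₂ = 0) → NearFirstCol u o.P k₁ k₂) :
    BackwardStable (4000000 * (u * cond A)) A o := by
  have hc := one_le_cond hA hdet
  have huc : u ≤ u * cond A := le_mul_of_one_le_right hu hc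
  have hu1 : u ≤ 1 / 100000 := by linarith
  have had : A 0 0 * A 1 1 ≠ 0 := by rwa [← det_of_upper hA]
  have hda : A 1 1 * A 0 0 ≠ 0 := by rwa [mul_comm]
  have hχ := sum_sq_le hA hdet
  have hχ' : (|A 1 1| + |A 0 1| + |A 0 0|) ^ 2 ≤ 9 * cond A * |A 1 1 * A 0 0| := by
    rw [mul_comm (A 1 1)]
    convert hχ using 2
    ring
  have huχ : u * (9 * cond A) ≤ 1 / 1000 := by linarith
  have hκχ : cond A ≤ 9 * cond A := by linarith
  have kz := Hg.adj.ne_zero hu had hχ huχ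
  have hz := Hl.adj.ne_zero hu hda hχ' huχ
  have stable := fun {v₁ v₂ w₁ w₂ : ℝ} => backwardStable_of_bilin fl hu hu1 hA hdet
    (v₁ := v₁) (v₂ := v₂) (w₁ := w₁) (w₂ := w₂) (o := o)
  have uc0 : 0 ≤ u * (9 * cond A) := by positivity
  have swapN : |A 1 1| + |A 0 1| + |A 0 0| = |A 0 0| + |A 0 1| + |A 1 1| := by ring
  have N0 : 0 ≤ |A 0 0| + |A 0 1| + |A 1 1| := by positivity
  -- With `Q` from `g` and `P` from `k` no information on the quotients or the residual is needed;
  -- the same holds for `h` and `l` below.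
  have GK : cQ → ¬ cP → ¬ (g₁ = 0 ∧ g₂ = 0) → BackwardStable (4000000 * (u * cond A)) A o := by
    intro h1 h2 hg
    refine stable (P2 h2 (kz hg)) (Q1 h1 hg) (kz hg)
      (fun h => hg ⟨h.2, neg_eq_zero.1 h.1⟩) ((bilin_row Hg.adj hu had hχ huχ).trans ?_) ho
    rw [abs_neg, add_comm |g₂|]
    gcongr
    norm_num
  have HL : ¬ cQ → cP → ¬ (l₂ = 0 ∧ l₁ = 0) → BackwardStable (4000000 * (u * cond A)) A o := by
    intro h1 h2 hl
    refine stable (P1 h2 hl) (Q2 h1 (hz hl)) (by rw [neg_eq_zero]; exact hl)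
      (fun h => hz hl h.symm) ?_ ho
    have h := bilin_row Hl.adj hu hda hχ' huχ
    rw [swapN] at h
    calc |l₂ * (A 0 0 * h₁ + A 0 1 * h₂) + -l₁ * (A 1 1 * h₂)|
        = |h₂ * (A 1 1 * -l₁ + A 0 1 * l₂) + h₁ * (A 0 0 * l₂)| := by congr 1; ring
      _ ≤ _ := h
      _ = 12 * (u * (9 * cond A)) * (|A 0 0| + |A 0 1| + |A 1 1|) *
          ((|l₂| + |l₁|) * (|h₁| + |h₂|)) := by ring
      _ ≤ _ := by
          rw [abs_neg]
          gcongr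
          norm_num
  rcases Sel with ⟨hg, hl⟩ | ⟨hg, hl⟩ | ⟨hg, hl, X, Y, hX, hY, hXY, hmX, hmY⟩
  -- A vanishing `l` makes `h` vanish exactly, and the algorithm then turns to `g` and `k`. The case
  -- of vanishing `g` is symmetric.
  · refine GK (hcQ.2 (Or.inl (Hl.adj.eq_zero hl).symm)) (fun h => ?_) hg
    rcases hcP.1 h with h | h
    · exact kz hg h
    · exact h.1 hl.symm
  · refine HL (fun h => ?_) (hcP.2 (Or.inl (Hg.adj.eq_zero hg))) hl
    rcases hcQ.1 h with h | h
    · exact hz hl h.symm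
    · exact h.1 hg
  · have cQ1 : cQ ↔ ηg ≤ ηh :=
      hcQ.trans ⟨fun h => h.elim (fun h => absurd h.symm (hz hl)) (fun h => h.2),
        fun h => Or.inr ⟨hg, h⟩⟩
    have cP1 : cP ↔ ηl ≤ ηk :=
      hcP.trans ⟨fun h => h.elim (fun h => absurd h (kz hg)) (fun h => h.2),
        fun h => Or.inr ⟨fun h => hl h.symm, h⟩⟩
    by_cases h1 : cQ <;> by_cases h2 : cP
    -- Each selection rule picks the vector with the smaller quotient, so the two minima are the
    -- quotients of the vectors in use.
    · rw [min_eq_left (cQ1.1 h1)] at hmX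
      rw [min_eq_right (cP1.1 h2)] at hmY
      refine stable (P1 h2 hl) (Q1 h1 hg) (by rw [neg_eq_zero]; exact hl)
        (fun h => hg ⟨h.2, neg_eq_zero.1 h.1⟩) ?_ ho
      rw [abs_neg, abs_neg, add_comm |g₂|]
      exact bilin_orig Hg.nonneg₁ Hg.nonneg₂ Hl.nonneg₂ Hl.nonneg₁ hu hc hκχ (res hg hl) hX hXY
        (Hg.etag.le_mul X hX hmX) (Hl.etag.le_mul Y hY hmY)
    · exact GK h1 h2 hg
    · exact HL h1 h2 hl
    · rw [min_eq_right (not_le.1 (cQ1.not.1 h1)).le] at hmX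
      rw [min_eq_left (not_le.1 (cP1.not.1 h2)).le] at hmY
      refine stable (P2 h2 (kz hg)) (Q2 h1 (hz hl)) (kz hg) (fun h => hz hl h.symm) ?_ ho
      refine bilin_adj Hg.adj Hl.adj hu had hc hκχ hχ huχ (res hg hl) ?_
      exact majorant_adj_le Hg.adjh Hl.adjh hu Hg.nonneg₁ Hg.nonneg₂ Hl.nonneg₂ Hl.nonneg₁ hc hκχ
        hχ huχ hY hXY (by positivity) (by positivity) (Hg.etak.le_mul Y hY hmY)
        (Hl.etak.le_mul X hX hmX)

theorem rsvdFinish_stable (hu : 0 ≤ u) {A : Mat2} (hA : A 1 0 = 0) (hdet : A.det ≠ 0)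
    (huκ : u * cond A ≤ 1 / 1000000) {U V G H K L : Mat2} {ηg ηh ηk ηl : EReal}
    {gh₁ gh₂ kh₁ kh₂ lh₁ lh₂ hh₁ hh₂ : ℝ}
    (Hg : Half u (A 0 0) (A 0 1) (A 1 1) (G 0 0) (G 0 1) gh₁ gh₂ (K 0 0) (K 0 1) kh₁ kh₂ ηg ηk)
    (Hl : Half u (A 1 1) (A 0 1) (A 0 0) (L 1 1) (L 0 1) lh₂ lh₁ (H 1 1) (H 0 1) hh₂ hh₁ ηl ηh)
    (res : ¬ (G 0 0 = 0 ∧ G 0 1 = 0) → ¬ (L 1 1 = 0 ∧ L 0 1 = 0) →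
      |G 0 0 * A 1 1 * L 0 1 - G 0 0 * A 0 1 * L 1 1 + G 0 1 * A 0 0 * L 1 1| ≤
      550 * u * (gh₁ * |A 1 1| * lh₁ + gh₁ * |A 0 1| * lh₂ + gh₂ * |A 0 0| * lh₂))
    (Sel : Selected (cond A) (G 0 0 = 0 ∧ G 0 1 = 0) (L 1 1 = 0 ∧ L 0 1 = 0) ηg ηh ηk ηl) :
    BackwardStable (4000000 * (u * cond A)) A (rsvdFinish fl A U V G H K L ηg ηh ηk ηl) := by
  have huc : u ≤ u * cond A := le_mul_of_one_le_right hu (one_le_cond hA hdet)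
  have hu1 : u ≤ 1 / 1000 := by linarith
  have add0 : ∀ x y : ℝ, fl.add |x| |y| = 0 ↔ x = 0 ∧ y = 0 := by
    intro x y
    rw [fl.add_eq_zero_iff (by linarith), add_eq_zero_iff_of_nonneg (abs_nonneg _) (abs_nonneg _),
      abs_eq_zero, abs_eq_zero]
  refine backwardStable_of_selected fl hu hA hdet huκ Hg Hl res Sel rfl
    (cQ := fl.add |H 0 1| |H 1 1| = 0 ∨ (fl.add |G 0 0| |G 0 1| ≠ 0 ∧ ηg ≤ ηh))
    (cP := fl.add |K 0 0| |K 0 1| = 0 ∨ (fl.add |L 0 1| |L 1 1| ≠ 0 ∧ ηl ≤ ηk))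
    (by rw [add0, ne_eq, add0]) (by rw [add0, ne_eq, add0]) (fun h hz => ?_) (fun h hz => ?_)
    (fun h hz => ?_) (fun h hz => ?_) <;>
    unfold rsvdFinish <;> dsimp only
  · rw [if_pos h]; exact nearSecondCol_lartg fl hu hu1 hz
  · rw [if_neg h]; exact nearSecondCol_lartg_neg fl hu hu1 hz
  · rw [if_pos h]; exact nearFirstCol_lartg_neg fl hu hu1 hz
  · rw [if_neg h]; exact nearFirstCol_lartg fl hu hu1 hz

end

/-! ### The computed matrices -/

section
variable {u : ℝ} (fl : FlArith u)

theorem FlArith.mul_nonneg' (hu1 : u ≤ 1 / 5) {x y : ℝ} (hx : 0 ≤ x) (hy : 0 ≤ y) :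
    0 ≤ fl.mul x y := by
  have h := (abs_le.1 (fl.mul_err x y)).1
  rw [abs_of_nonneg (mul_nonneg hx hy)] at h
  nlinarith [mul_nonneg hx hy]

theorem FlArith.add_nonneg' (hu1 : u ≤ 1 / 5) {x y : ℝ} (hx : 0 ≤ x) (hy : 0 ≤ y) :
    0 ≤ fl.add x y := by
  have h := (abs_le.1 (fl.add_err x y)).1
  rw [abs_of_nonneg (add_nonneg hx hy)] at h
  nlinarith

theorem FlArith.mmul_nonneg (hu1 : u ≤ 1 / 5) {X Y : Mat2} (hX : ∀ i j, 0 ≤ X i j)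
    (hY : ∀ i j, 0 ≤ Y i j) (i j : Fin 2) : 0 ≤ fl.mmul X Y i j :=
  fl.add_nonneg' hu1 (fl.mul_nonneg' hu1 (hX _ _) (hY _ _)) (fl.mul_nonneg' hu1 (hX _ _) (hY _ _))

theorem mabs_nonneg (X : Mat2) (i j : Fin 2) : 0 ≤ mabs X i j := abs_nonneg _

theorem IsEta.congr {η : EReal} {n d n' d' : ℝ} (h : IsEta η n d) (hn : n = n') (hd : d = d') :
    IsEta η n' d' := hn ▸ hd ▸ h

/-- The quantities attached to a row of `G`. -/
theorem half_row (hu : 0 ≤ u) (hu1 : u ≤ 1 / 1000) (A G Gh : Mat2) (hG : ∀ i j, 0 ≤ Gh i j)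
    (i : Fin 2) :
    Half u (A 0 0) (A 0 1) (A 1 1) (G i 0) (G i 1) (Gh i 0) (Gh i 1)
      (fl.mmul G (adjU A) i 0) (fl.mmul G (adjU A) i 1)
      (fl.mmul Gh (mabs (adjU A)) i 0) (fl.mmul Gh (mabs (adjU A)) i 1)
      (eta fl (Gh i 0) (Gh i 1) (G i 0) (G i 1))
      (eta fl (fl.mmul Gh (mabs (adjU A)) i 0) (fl.mmul Gh (mabs (adjU A)) i 1)
        (fl.mmul G (adjU A) i 0) (fl.mmul G (adjU A) i 1)) := by
  have hK := fl.mmul_nonneg (by linarith) hG (mabs_nonneg (adjU A))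
  have e := fun X Y : Mat2 => fun j =>
    fl.dot_err hu (by linarith) (X i 0) (Y 0 j) (X i 1) (Y 1 j)
  refine ⟨hG _ _, hG _ _, ⟨?_, ?_⟩, ⟨?_, ?_⟩, isEta_eta fl hu hu1 (hG _ _) (hG _ _) _ _,
    isEta_eta fl hu hu1 (hK _ _) (hK _ _) _ _⟩
  · simpa [adjU, FlArith.mmul] using e G (adjU A) 0
  · simpa [adjU, FlArith.mmul] using e G (adjU A) 1
  · simpa [adjU, mabs, FlArith.mmul] using e Gh (mabs (adjU A)) 0
  · simpa [adjU, mabs, FlArith.mmul] using e Gh (mabs (adjU A)) 1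

/-- The quantities attached to a column of `L`. -/
theorem half_col (hu : 0 ≤ u) (hu1 : u ≤ 1 / 1000) (A L Lh : Mat2) (hL : ∀ i j, 0 ≤ Lh i j)
    (j : Fin 2) :
    Half u (A 1 1) (A 0 1) (A 0 0) (L 1 j) (L 0 j) (Lh 1 j) (Lh 0 j)
      (fl.mmul (adjU A) L 1 j) (fl.mmul (adjU A) L 0 j)
      (fl.mmul (mabs (adjU A)) Lh 1 j) (fl.mmul (mabs (adjU A)) Lh 0 j)
      (eta fl (Lh 0 j) (Lh 1 j) (L 0 j) (L 1 j))
      (eta fl (fl.mmul (mabs (adjU A)) Lh 0 j) (fl.mmul (mabs (adjU A)) Lh 1 j)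
        (fl.mmul (adjU A) L 0 j) (fl.mmul (adjU A) L 1 j)) := by
  have hH := fl.mmul_nonneg (by linarith) (mabs_nonneg (adjU A)) hL
  have e := fun X Y : Mat2 => fun i =>
    fl.dot_err hu (by linarith) (X i 0) (Y 0 j) (X i 1) (Y 1 j)
  refine ⟨hL _ _, hL _ _, ⟨?_, ?_⟩, ⟨?_, ?_⟩,
    (isEta_eta fl hu hu1 (hL _ _) (hL _ _) _ _).congr (add_comm _ _) (add_comm _ _),
    (isEta_eta fl hu hu1 (hH _ _) (hH _ _) _ _).congr (add_comm _ _) (add_comm _ _)⟩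
  · simpa [adjU, FlArith.mmul, mul_comm] using e (adjU A) L 1
  · simpa [adjU, FlArith.mmul, mul_comm, add_comm] using e (adjU A) L 0
  · simpa [adjU, mabs, FlArith.mmul, mul_comm] using e (mabs (adjU A)) Lh 1
  · simpa [adjU, mabs, FlArith.mmul, mul_comm, add_comm] using e (mabs (adjU A)) Lh 0

theorem AdjMul.neg {a b d g₁ g₂ k₁ k₂ : ℝ} (H : AdjMul u a b d g₁ g₂ k₁ k₂) :
    AdjMul u a b d (-g₁) (-g₂) (-k₁) (-k₂) := by
  constructor
  · rw [neg_mul, abs_neg, neg_sub_neg, abs_sub_comm]; exact H.fst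
  · rw [neg_mul, neg_mul, abs_neg, abs_neg, ← neg_add, neg_sub_neg, abs_sub_comm]; exact H.snd

theorem Half.neg {a b d g₁ g₂ gh₁ gh₂ k₁ k₂ kh₁ kh₂ : ℝ} {ηg ηk : EReal}
    (H : Half u a b d g₁ g₂ gh₁ gh₂ k₁ k₂ kh₁ kh₂ ηg ηk) :
    Half u a b d (-g₁) (-g₂) gh₁ gh₂ (-k₁) (-k₂) kh₁ kh₂ ηg ηk :=
  ⟨H.nonneg₁, H.nonneg₂, H.adj.neg, H.adjh, by rw [abs_neg, abs_neg]; exact H.etag,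
    by rw [abs_neg, abs_neg]; exact H.etak⟩

/-- The residual bound in terms of the computed vectors. -/
theorem residual_of_fwd (hu : 0 ≤ u) (hu1 : u ≤ 1 / 1000)
    {a b d c s x y c₁ c₂ c₃ b₁ b₂ b₃ g₁ g₂ l₁ l₂ gh₁ gh₂ lh₁ lh₂ : ℝ}
    (G : RowFwd u c s c₁ c₂ c₃ g₁ g₂) (Gh : RowHat u c s c₁ c₂ c₃ gh₁ gh₂)
    (L : RowFwd u x (-y) b₃ b₂ b₁ l₂ l₁) (Lh : RowHat u x (-y) b₃ b₂ b₁ lh₂ lh₁)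
    (H : |c * c₁ * d * (b₂ * x - b₁ * y) - c * c₁ * b * (b₃ * x) +
        (c * c₂ + s * c₃) * a * (b₃ * x)| ≤
      500 * u * (|c * c₁| * |d| * (|b₂ * x| + |b₁ * y|) + |c * c₁| * |b| * |b₃ * x| +
        (|c * c₂| + |s * c₃|) * |a| * |b₃ * x|)) :
    |g₁ * d * l₁ - g₁ * b * l₂ + g₂ * a * l₂| ≤
      550 * u * (gh₁ * |d| * lh₁ + gh₁ * |b| * lh₂ + gh₂ * |a| * lh₂) := by
  have el1 : x * b₂ + -y * b₁ = b₂ * x - b₁ * y := by ring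
  have el2 : x * b₃ = b₃ * x := by ring
  have el3 : |x * b₂| + |-y * b₁| = |b₂ * x| + |b₁ * y| := by
    rw [neg_mul, abs_neg, mul_comm x, mul_comm y]
  obtain ⟨G1, G2⟩ := G
  obtain ⟨Gh1, Gh2⟩ := Gh
  obtain ⟨L2, L1⟩ := L
  obtain ⟨Lh2, Lh1⟩ := Lh
  rw [el1, el3] at L1
  rw [el3] at Lh1
  rw [el2] at L2 Lh2
  have m1 : |c * c₁| ≤ |c * c₁| := le_rfl
  have m2 := abs_add_le (c * c₂) (s * c₃)
  have m3 := abs_sub (b₂ * x) (b₁ * y)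
  have m4 : |b₃ * x| ≤ |b₃ * x| := le_rfl
  have p1 := abs_nonneg (c * c₁)
  have p2 := add_nonneg (abs_nonneg (c * c₂)) (abs_nonneg (s * c₃))
  have p3 := add_nonneg (abs_nonneg (b₂ * x)) (abs_nonneg (b₁ * y))
  have p4 := abs_nonneg (b₃ * x)
  generalize |c * c₂| + |s * c₃| = N2 at *
  generalize c * c₂ + s * c₃ = n2 at *
  generalize |b₂ * x| + |b₁ * y| = N3 at *
  generalize b₂ * x - b₁ * y = n3 at *
  generalize hN1 : |c * c₁| = N1 at *
  have m1 : |c * c₁| ≤ N1 := hN1.le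
  generalize c * c₁ = n1 at *
  generalize hN4 : |b₃ * x| = N4 at *
  have m4 : |b₃ * x| ≤ N4 := hN4.le
  generalize b₃ * x = n4 at *
  -- The error in replacing exact by computed vectors adds 7 to the constant 500; passing to
  -- computed majorants costs another 1.01, which stays below 550.
  have pert : ∀ {g n N l m M z : ℝ}, |g - n| ≤ 3 * u * N → |n| ≤ N → 0 ≤ N →
      |l - m| ≤ 3 * u * M → |m| ≤ M → 0 ≤ M →
      |g * z * l - n * z * m| ≤ 7 * u * (N * |z| * M) := by
    intro g n N l m M z h1 h2 hN h3 h4 hM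
    have hl : |l| ≤ 1.003 * M := by
      have := abs_sub_abs_le_abs_sub l m
      have := mul_le_mul_of_nonneg_right hu1 hM
      linarith
    have : g * z * l - n * z * m = (g - n) * (z * l) + n * z * (l - m) := by ring
    rw [this]
    calc _ ≤ |g - n| * (|z| * |l|) + |n| * |z| * |l - m| := by
          rw [← abs_mul, ← abs_mul, ← abs_mul, ← abs_mul]; exact abs_add_le _ _
      _ ≤ 3 * u * N * (|z| * (1.003 * M)) + N * |z| * (3 * u * M) := by gcongr
      _ = 6.009 * u * (N * |z| * M) := by ring
      _ ≤ _ := by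
        have : 0 ≤ u * (N * |z| * M) := by positivity
        linarith
  have hat : ∀ {n N : ℝ}, |n - N| ≤ 3 * u * N → 0 ≤ N → N ≤ 1.004 * n ∧ 0 ≤ n := by
    intro n N h hN
    have := (abs_le.1 h).1
    have := mul_le_mul_of_nonneg_right hu1 hN
    constructor <;> linarith
  have hatmul : ∀ {n N m M z : ℝ}, |n - N| ≤ 3 * u * N → 0 ≤ N → |m - M| ≤ 3 * u * M → 0 ≤ M →
      N * |z| * M ≤ 1.01 * (n * |z| * m) := by
    intro n N m M z h1 hN h2 hM
    obtain ⟨a1, a2⟩ := hat h1 hN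
    obtain ⟨b1, b2⟩ := hat h2 hM
    calc N * |z| * M ≤ (1.004 * n) * |z| * (1.004 * m) := by gcongr
      _ = 1.004 ^ 2 * (n * |z| * m) := by ring
      _ ≤ _ := by
        have : 0 ≤ n * |z| * m := by positivity
        linarith
  have t1 := pert (z := d) G1 m1 p1 L1 m3 p3
  have t2 := pert (z := b) G1 m1 p1 L2 m4 p4
  have t3 := pert (z := a) G2 m2 p2 L2 m4 p4
  have w1 := hatmul (z := d) Gh1 p1 Lh1 p3
  have w2 := hatmul (z := b) Gh1 p1 Lh2 p4
  have w3 := hatmul (z := a) Gh2 p2 Lh2 p4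
  calc _ = |(n1 * d * n3 - n1 * b * n4 + n2 * a * n4) + ((g₁ * d * l₁ - n1 * d * n3) -
        (g₁ * b * l₂ - n1 * b * n4) + (g₂ * a * l₂ - n2 * a * n4))| := by congr 1; ring
    _ ≤ |n1 * d * n3 - n1 * b * n4 + n2 * a * n4| + (|g₁ * d * l₁ - n1 * d * n3| +
        |g₁ * b * l₂ - n1 * b * n4| + |g₂ * a * l₂ - n2 * a * n4|) := by
        refine (abs_add_le _ _).trans ?_
        gcongr
        exact (abs_add_le _ _).trans (by gcongr; exact abs_sub _ _)
    _ ≤ 507 * u * (N1 * |d| * N3 + N1 * |b| * N4 + N2 * |a| * N4) := by linarith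
    _ ≤ 507 * u * (1.01 * (gh₁ * |d| * lh₁) + 1.01 * (gh₁ * |b| * lh₂) +
        1.01 * (gh₂ * |a| * lh₂)) := by gcongr
    _ ≤ _ := by
        have q1 := (hat Gh1 p1).2
        have q2 := (hat Gh2 p2).2
        have q3 := (hat Lh1 p3).2
        have q4 := (hat Lh2 p4).2
        have : 0 ≤ u * (gh₁ * |d| * lh₁ + gh₁ * |b| * lh₂ + gh₂ * |a| * lh₂) := by positivity
        linarith

/-- The facts about the rotations `U`, `V` computed from `C adj(A) B` that the choice of the index
relies on. -/
theorem exists_rot_of_lasv2 (hu : 0 < u) (hu1 : u ≤ 1 / 1000) {A B C : Mat2} (hA : A 1 0 = 0)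
    (hdet : A.det ≠ 0) (hCB : ¬ (C 0 0 = 0 ∧ B 1 1 = 0)) {M V₀ U₀ V U : Mat2}
    (hM : M = prodM fl A B C)
    (hVU : lasv2 fl (M 0 0) (M 0 1) (M 1 1) = (V₀, U₀)) (hf : (V = V₀ ∧ U = U₀) ∨
      (V = V₀ * J ∧ U = U₀ * J ∧ C 0 0 ≠ 0 ∧ B 1 1 ≠ 0)) :
    ∃ c s x y, V = rot c s ∧ U = rot x y ∧
      SmallOffDiag (480 * u) (prodM fl A B C 0 0) (prodM fl A B C 0 1) (prodM fl A B C 1 1)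
        c s x y ∧ (c ≠ 0 ∨ s ≠ 0) ∧ (x ≠ 0 ∨ y ≠ 0) ∧
      (C 0 0 = 0 → 0 ≤ c * C 0 1 * (s * C 1 1) ∧ (C 0 1 ≠ 0 → c ≠ 0) ∧ (C 1 1 ≠ 0 → s ≠ 0)) ∧
      (B 1 1 = 0 → 0 ≤ y * B 0 1 * (x * B 0 0) ∧ (B 0 1 ≠ 0 → y ≠ 0) ∧ (B 0 0 ≠ 0 → x ≠ 0)) := by
  rw [hM] at hVU
  obtain ⟨c, s, x, y, h, hS, hcs, hxy, hC, hB⟩ :=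
    lasv2_spec fl hu hu1 (prodM fl A B C 0 0) (prodM fl A B C 0 1) (prodM fl A B C 1 1)
  rw [hVU, Prod.mk.injEq] at h
  obtain ⟨rfl, rfl⟩ := h
  rw [det_of_upper hA] at hdet
  rcases hf with ⟨rfl, rfl⟩ | ⟨rfl, rfl, h1, h2⟩
  · refine ⟨c, s, x, y, rfl, rfl, hS, hcs, hxy, fun h0 => ?_, fun h0 => ?_⟩
    · obtain ⟨m1, m2, m3⟩ := prodM_rel_of_C_eq_zero fl hu.le hu1 (A := A) (B := B) h0
      have hb : A 0 0 * B 1 1 ≠ 0 :=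
        mul_ne_zero (left_ne_zero_of_mul hdet) fun h => hCB ⟨h0, h⟩
      obtain ⟨i1, i2, i3⟩ := hC m1
      refine ⟨?_, fun h => i2 (m2.ne_zero_iff.2 (mul_ne_zero h hb)),
        fun h => i3 (m3.ne_zero_iff.2 (mul_ne_zero h hb))⟩
      obtain ⟨e, he, -, -, e1⟩ := m2
      obtain ⟨e', he', -, -, e2⟩ := m3
      rw [e1, e2] at i1
      -- The computed entries are those of `C` times a common factor and positive error factors, so
      -- the sign condition passes to `C`.
      have hpos : 0 < e * e' * (A 0 0 * B 1 1) ^ 2 := by positivity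
      exact (mul_nonneg_iff_of_pos_left hpos).1 (by linarith)
    · obtain ⟨m1, m2, m3⟩ := prodM_rel_of_B_eq_zero fl hu.le hu1 (A := A) (C := C) h0
      have hb : C 0 0 * A 1 1 ≠ 0 :=
        mul_ne_zero (fun h => hCB ⟨h, h0⟩) (right_ne_zero_of_mul hdet)
      obtain ⟨i1, i2, i3⟩ := hB m1
      refine ⟨?_, fun h => i3 (m2.ne_zero_iff.2 (mul_ne_zero hb h)),
        fun h => i2 (m3.ne_zero_iff.2 (mul_ne_zero hb h))⟩
      obtain ⟨e, he, -, -, e1⟩ := m2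
      obtain ⟨e', he', -, -, e2⟩ := m3
      rw [e1, e2] at i1
      have hpos : 0 < e * e' * (C 0 0 * A 1 1) ^ 2 := by positivity
      exact (mul_nonneg_iff_of_pos_left hpos).1 (by linarith)
  -- After a flip `c₁₁` and `b₂₂` are nonzero, so the two sign conditions are vacuous.
  · exact ⟨s, -c, y, -x, rot_mul_J c s, rot_mul_J x y, hS.rot, by rw [neg_ne_zero]; exact hcs.symm,
      by rw [neg_ne_zero]; exact hxy.symm, fun h => absurd h h1, fun h => absurd h h2⟩

end

section
variable {u : ℝ} (fl : FlArith u)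

section Forward
variable {c s x y : ℝ} {B C : Mat2}

theorem rowFwd_fst (hu : 0 ≤ u) (hu1 : u ≤ 1 / 1000) (hC : C 1 0 = 0) :
    RowFwd u c s (C 0 0) (C 0 1) (C 1 1) (fl.mmul (rot c s)ᵀ C 0 0)
      (fl.mmul (rot c s)ᵀ C 0 1) := by
  have e := fun j => fl.dot_err hu (by linarith) c (C 0 j) s (C 1 j)
  exact ⟨by simpa [rot, FlArith.mmul, hC] using e 0, by simpa [rot, FlArith.mmul] using e 1⟩

theorem rowFwd_snd (hu : 0 ≤ u) (hu1 : u ≤ 1 / 1000) (hC : C 1 0 = 0) :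
    RowFwd u s (-c) (C 0 0) (C 0 1) (C 1 1) (-fl.mmul (rot c s)ᵀ C 1 0)
      (-fl.mmul (rot c s)ᵀ C 1 1) := by
  have e := fun j => fl.dot_err hu (by linarith) (-s) (C 0 j) c (C 1 j)
  constructor
  · rw [← abs_neg, neg_sub, sub_neg_eq_add, add_comm]
    simpa [rot, FlArith.mmul, hC] using e 0
  · rw [← abs_neg, neg_sub, sub_neg_eq_add, add_comm]
    simpa [rot, FlArith.mmul, sub_eq_add_neg, add_comm, add_left_comm] using e 1

theorem rowHat_fst (hu : 0 ≤ u) (hu1 : u ≤ 1 / 1000) (hC : C 1 0 = 0) :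
    RowHat u c s (C 0 0) (C 0 1) (C 1 1) (fl.mmul (mabs (rot c s))ᵀ (mabs C) 0 0)
      (fl.mmul (mabs (rot c s))ᵀ (mabs C) 0 1) := by
  have e := fun j => fl.dot_err hu (by linarith) |c| |C 0 j| |s| |C 1 j|
  exact ⟨by simpa [rot, mabs, FlArith.mmul, hC] using e 0,
    by simpa [rot, mabs, FlArith.mmul] using e 1⟩

theorem rowHat_snd (hu : 0 ≤ u) (hu1 : u ≤ 1 / 1000) (hC : C 1 0 = 0) :
    RowHat u s (-c) (C 0 0) (C 0 1) (C 1 1) (fl.mmul (mabs (rot c s))ᵀ (mabs C) 1 0)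
      (fl.mmul (mabs (rot c s))ᵀ (mabs C) 1 1) := by
  have e := fun j => fl.dot_err hu (by linarith) |s| |C 0 j| |c| |C 1 j|
  exact ⟨by simpa [rot, mabs, FlArith.mmul, hC] using e 0,
    by simpa [rot, mabs, FlArith.mmul] using e 1⟩

theorem colFwd_snd (hu : 0 ≤ u) (hu1 : u ≤ 1 / 1000) (hB : B 1 0 = 0) :
    RowFwd u x (-y) (B 1 1) (B 0 1) (B 0 0) (fl.mmul B (rot x y) 1 1)
      (fl.mmul B (rot x y) 0 1) := by
  have e := fun i => fl.dot_err hu (by linarith) (B i 0) (-y) (B i 1) x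
  exact ⟨by simpa [rot, FlArith.mmul, hB, mul_comm] using e 1,
    by simpa [rot, FlArith.mmul, mul_comm, add_comm] using e 0⟩

theorem colFwd_fst (hu : 0 ≤ u) (hu1 : u ≤ 1 / 1000) (hB : B 1 0 = 0) :
    RowFwd u y x (B 1 1) (B 0 1) (B 0 0) (fl.mmul B (rot x y) 1 0)
      (fl.mmul B (rot x y) 0 0) := by
  have e := fun i => fl.dot_err hu (by linarith) (B i 0) x (B i 1) y
  exact ⟨by simpa [rot, FlArith.mmul, hB, mul_comm] using e 1,
    by simpa [rot, FlArith.mmul, mul_comm, add_comm] using e 0⟩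

theorem colHat_snd (hu : 0 ≤ u) (hu1 : u ≤ 1 / 1000) (hB : B 1 0 = 0) :
    RowHat u x (-y) (B 1 1) (B 0 1) (B 0 0) (fl.mmul (mabs B) (mabs (rot x y)) 1 1)
      (fl.mmul (mabs B) (mabs (rot x y)) 0 1) := by
  have e := fun i => fl.dot_err hu (by linarith) |B i 0| |y| |B i 1| |x|
  exact ⟨by simpa [rot, mabs, FlArith.mmul, hB, mul_comm] using e 1,
    by simpa [rot, mabs, FlArith.mmul, mul_comm, add_comm] using e 0⟩

theorem colHat_fst (hu : 0 ≤ u) (hu1 : u ≤ 1 / 1000) (hB : B 1 0 = 0) :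
    RowHat u y x (B 1 1) (B 0 1) (B 0 0) (fl.mmul (mabs B) (mabs (rot x y)) 1 0)
      (fl.mmul (mabs B) (mabs (rot x y)) 0 0) := by
  have e := fun i => fl.dot_err hu (by linarith) |B i 0| |x| |B i 1| |y|
  exact ⟨by simpa [rot, mabs, FlArith.mmul, hB, mul_comm] using e 1,
    by simpa [rot, mabs, FlArith.mmul, mul_comm, add_comm] using e 0⟩

end Forward

section Cleared
variable {c s x y : ℝ} {B C G L : Mat2}

/-- For `c₁₁ = 0` the (2,1) entry is computed as exactly zero, so clearing (2,2) annihilates the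
whole second row. Its forward bound is then lost, but it is needed only for a nonzero row. -/
theorem cleared_G (hu : 0 ≤ u) (hu1 : u ≤ 1 / 1000) (hC : C 1 0 = 0) (hcs : c ≠ 0 ∨ s ≠ 0)
    (hsign : C 0 0 = 0 →
      0 ≤ c * C 0 1 * (s * C 1 1) ∧ (C 0 1 ≠ 0 → c ≠ 0) ∧ (C 1 1 ≠ 0 → s ≠ 0))
    (hG : G = fl.mmul (rot c s)ᵀ C ∨ (C 0 0 = 0 ∧ G = clear22 (fl.mmul (rot c s)ᵀ C))) :
    RowFwd u c s (C 0 0) (C 0 1) (C 1 1) (G 0 0) (G 0 1) ∧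
    (¬ (-G 1 0 = 0 ∧ -G 1 1 = 0) →
      RowFwd u s (-c) (C 0 0) (C 0 1) (C 1 1) (-G 1 0) (-G 1 1)) ∧
    RowPair (C 0 0 ≠ 0) (G 0 0) (G 0 1) (fl.mmul (mabs (rot c s))ᵀ (mabs C) 0 0)
      (fl.mmul (mabs (rot c s))ᵀ (mabs C) 0 1) (-G 1 0) (-G 1 1)
      (fl.mmul (mabs (rot c s))ᵀ (mabs C) 1 0) (fl.mmul (mabs (rot c s))ᵀ (mabs C) 1 1) := by
  have f1 := rowFwd_fst fl hu hu1 hC (c := c) (s := s)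
  have f2 := rowFwd_snd fl hu hu1 hC (c := c) (s := s)
  have h1 := rowHat_fst fl hu hu1 hC (c := c) (s := s)
  have h2 := rowHat_snd fl hu hu1 hC (c := c) (s := s)
  rcases hG with rfl | ⟨h0, rfl⟩
  · exact ⟨f1, fun _ => f2, rowPair_of_fwd hu1 h1 f1 h2 f2 hcs id (by ring)⟩
  · have z0 : fl.mmul (rot c s)ᵀ C 1 0 = 0 := by
      have := f2.fst
      rw [h0, mul_zero, abs_zero, mul_zero, sub_zero, abs_neg] at this
      exact abs_nonpos_iff.1 this
    obtain ⟨s1, s2, s3⟩ := hsign h0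
    have e1 : clear22 (fl.mmul (rot c s)ᵀ C) 0 0 = fl.mmul (rot c s)ᵀ C 0 0 := rfl
    have e2 : clear22 (fl.mmul (rot c s)ᵀ C) 0 1 = fl.mmul (rot c s)ᵀ C 0 1 := rfl
    have e3 : clear22 (fl.mmul (rot c s)ᵀ C) 1 0 = 0 := z0
    have e4 : clear22 (fl.mmul (rot c s)ᵀ C) 1 1 = 0 := rfl
    rw [e1, e2, e3, e4]
    exact ⟨f1, fun h => absurd ⟨neg_zero, neg_zero⟩ h,
      rowPair_of_cleared hu1 h1 f1 h2 h0 s1 s2 s3⟩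

theorem cleared_L (hu : 0 ≤ u) (hu1 : u ≤ 1 / 1000) (hB : B 1 0 = 0) (hxy : x ≠ 0 ∨ y ≠ 0)
    (hsign : B 1 1 = 0 →
      0 ≤ y * B 0 1 * (x * B 0 0) ∧ (B 0 1 ≠ 0 → y ≠ 0) ∧ (B 0 0 ≠ 0 → x ≠ 0))
    (hL : L = fl.mmul B (rot x y) ∨ (B 1 1 = 0 ∧ L = clear12 (fl.mmul B (rot x y)))) :
    (¬ (L 1 1 = 0 ∧ L 0 1 = 0) →
      RowFwd u x (-y) (B 1 1) (B 0 1) (B 0 0) (L 1 1) (L 0 1)) ∧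
    RowFwd u y x (B 1 1) (B 0 1) (B 0 0) (L 1 0) (L 0 0) ∧
    RowPair (B 1 1 ≠ 0) (L 1 1) (L 0 1) (fl.mmul (mabs B) (mabs (rot x y)) 1 1)
      (fl.mmul (mabs B) (mabs (rot x y)) 0 1) (L 1 0) (L 0 0)
      (fl.mmul (mabs B) (mabs (rot x y)) 1 0) (fl.mmul (mabs B) (mabs (rot x y)) 0 0) := by
  have f1 := colFwd_snd fl hu hu1 hB (x := x) (y := y)
  have f2 := colFwd_fst fl hu hu1 hB (x := x) (y := y)
  have h1 := colHat_snd fl hu hu1 hB (x := x) (y := y)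
  have h2 := colHat_fst fl hu hu1 hB (x := x) (y := y)
  rcases hL with rfl | ⟨h0, rfl⟩
  · exact ⟨fun _ => f1, f2, rowPair_of_fwd hu1 h1 f1 h2 f2 (by rwa [neg_ne_zero])
      (by rw [neg_ne_zero]; exact id) (by ring)⟩
  · have z0 : fl.mmul B (rot x y) 1 1 = 0 := by
      have := f1.fst
      rw [h0, mul_zero, abs_zero, mul_zero, sub_zero] at this
      exact abs_nonpos_iff.1 this
    obtain ⟨s1, s2, s3⟩ := hsign h0
    have e1 : clear12 (fl.mmul B (rot x y)) 0 0 = fl.mmul B (rot x y) 0 0 := rfl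
    have e2 : clear12 (fl.mmul B (rot x y)) 1 0 = fl.mmul B (rot x y) 1 0 := rfl
    have e3 : clear12 (fl.mmul B (rot x y)) 1 1 = 0 := z0
    have e4 : clear12 (fl.mmul B (rot x y)) 0 1 = 0 := rfl
    rw [e1, e2, e3, e4]
    exact ⟨fun h => absurd ⟨rfl, rfl⟩ h, f2, (rowPair_of_cleared hu1 h2 f2 h1 h0 s1 s2 s3).symm⟩

end Cleared

/-! ### Assembly of the theorem -/

/-- The quarter turns make the (1,2) entry exactly zero even in floating-point arithmetic, so
explicit clearing would change nothing and the general backward error lemma applies. -/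
theorem rsvdZero_stable (hu : 0 ≤ u) {A : Mat2} (hA : A 1 0 = 0) (hdet : A.det ≠ 0)
    (huκ : u * cond A ≤ 1 / 1000000) (B C : Mat2) :
    BackwardStable (4000000 * (u * cond A)) A (rsvdZero fl A B C) := by
  have huc : u ≤ u * cond A := le_mul_of_one_le_right hu (one_le_cond hA hdet)
  have hJ : J = rot 0 (-1) := by simp [J, rot]
  have h0 : fl.add 0 0 = 0 := (fl.add_eq_zero_iff (by linarith) 0 0).2 (add_zero 0)
  have hT : fl.mmul Jᵀ A 0 0 = 0 := by
    simp [FlArith.mmul, J, hA, fl.zero_mul', fl.mul_zero', h0]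
  have hz : fl.mmul (fl.mmul Jᵀ A) J 0 1 = 0 := by
    rw [FlArith.mmul, Matrix.of_apply, hT]
    simp [J, fl.zero_mul', fl.mul_zero', h0]
  have a0 := abs_entry_le_norm A 0 0
  have a1 := abs_entry_le_norm A 0 1
  have a2 := abs_entry_le_norm A 1 1
  have n0 := norm_nonneg A
  have hN : |A 0 0| + |A 0 1| + |A 1 1| ≤ 3 * ‖A‖ := by linarith
  refine backwardStable_of_small fl hu (by linarith) hA (p₁ := 0) (p₂ := -1) (q₁ := 0) (q₂ := -1)
    (c := 0) (s := -1) (x := 0) (y := -1) (E := 270 * u * ‖A‖) (by norm_num) (by norm_num)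
    (by simpa using hu) (by simpa using hu) (by simpa using hu) (by simpa using hu) ?_ ?_
    hJ hJ ?_ (by linarith) ?_
  · simp only [zero_mul, mul_zero, add_zero, abs_zero]; positivity
  · calc 90 * u * (|A 0 0| + |A 0 1| + |A 1 1|) ≤ 90 * u * (3 * ‖A‖) := by gcongr
      _ = _ := by ring
  · change fl.mmul (fl.mmul Jᵀ A) J = _
    rw [← hJ]
    ext i j
    fin_cases i <;> fin_cases j <;> first | exact hz | rfl
  · have := mul_le_mul_of_nonneg_right huc n0
    have : 0 ≤ u * cond A * ‖A‖ := mul_nonneg (hu.trans huc) n0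
    linarith

/-- The choice between the two indices always selects a suitable one. -/
theorem rsvd22_stable (hu : 0 < u) {A B C : Mat2} (hA : A 1 0 = 0) (hB : B 1 0 = 0)
    (hC : C 1 0 = 0) (hdet : A.det ≠ 0) (huκ : u * cond A ≤ 1 / 1000000) (zg zl : Bool) :
    BackwardStable (4000000 * (u * cond A)) A
      (rsvd22 fl zg zl ((8 * cond A : ℝ) : EReal) A B C) := by
  have hc := one_le_cond hA hdet
  have huc : u ≤ u * cond A := le_mul_of_one_le_right hu.le hc
  have hu1 : u ≤ 1 / 1000 := by linarith
  unfold rsvd22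
  by_cases h0 : C 0 0 = 0 ∧ B 1 1 = 0
  · rw [if_pos h0]; exact rsvdZero_stable fl hu.le hA hdet huκ B C
  rw [if_neg h0]
  extract_lets M VU V₀ U₀ cmax smax flip U V G₀ G L₀ L Gh Lh H Hh K Kh ηg₁ ηh₁ ηk₁ ηl₁ ηg₂ ηh₂ ηk₂
    ηl₂ m₁ m₂
  have hf : (V = V₀ ∧ U = U₀) ∨ (V = V₀ * J ∧ U = U₀ * J ∧ C 0 0 ≠ 0 ∧ B 1 1 ≠ 0) := by
    by_cases hfl : flip
    · exact Or.inr ⟨if_pos hfl, if_pos hfl, hfl.1, hfl.2.2.2.1⟩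
    · exact Or.inl ⟨if_neg hfl, if_neg hfl⟩
  obtain ⟨c, s, x, y, hV, hU, hS, hcs, hxy, hsC, hsB⟩ :=
    exists_rot_of_lasv2 fl hu hu1 hA hdet h0 (M := M) rfl (V₀ := V₀) (U₀ := U₀) rfl hf
  have hG : G = fl.mmul (rot c s)ᵀ C ∨ (C 0 0 = 0 ∧ G = clear22 (fl.mmul (rot c s)ᵀ C)) := by
    rw [← hV]
    by_cases h : zg = true ∧ C 0 0 = 0
    · exact Or.inr ⟨h.2, if_pos h⟩
    · exact Or.inl (if_neg h)
  have hL : L = fl.mmul B (rot x y) ∨ (B 1 1 = 0 ∧ L = clear12 (fl.mmul B (rot x y))) := by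
    rw [← hU]
    by_cases h : zl = true ∧ B 1 1 = 0
    · exact Or.inr ⟨h.2, if_pos h⟩
    · exact Or.inl (if_neg h)
  obtain ⟨G1, G2, GP⟩ := cleared_G fl hu.le hu1 hC hcs hsC hG
  obtain ⟨L1, L2, LP⟩ := cleared_L fl hu.le hu1 hB hxy hsB hL
  have Gh1 := rowHat_fst fl hu.le hu1 hC (c := c) (s := s)
  have Gh2 := rowHat_snd fl hu.le hu1 hC (c := c) (s := s)
  have Lh1 := colHat_snd fl hu.le hu1 hB (x := x) (y := y)
  have Lh2 := colHat_fst fl hu.le hu1 hB (x := x) (y := y)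
  rw [← hV] at GP Gh1 Gh2
  rw [← hU] at LP Lh1 Lh2
  have hGh : ∀ i j, 0 ≤ Gh i j :=
    fl.mmul_nonneg (by linarith) (fun i j => mabs_nonneg V j i) (mabs_nonneg C)
  have hLh : ∀ i j, 0 ≤ Lh i j :=
    fl.mmul_nonneg (by linarith) (mabs_nonneg B) (mabs_nonneg U)
  have Hg1 := half_row fl hu.le hu1 A G Gh hGh 0
  have Hg2 := (half_row fl hu.le hu1 A G Gh hGh 1).neg
  -- Columns of `L` are treated as rows read in reverse order, with `a₁₁` and `a₂₂` interchanged.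
  have Hl1 := half_col fl hu.le hu1 A L Lh hLh 1
  have Hl2 := half_col fl hu.le hu1 A L Lh hLh 0
  have res1 : ¬ (G 0 0 = 0 ∧ G 0 1 = 0) → ¬ (L 1 1 = 0 ∧ L 0 1 = 0) →
      |G 0 0 * A 1 1 * L 0 1 - G 0 0 * A 0 1 * L 1 1 + G 0 1 * A 0 0 * L 1 1| ≤
      550 * u * (Gh 0 0 * |A 1 1| * Lh 0 1 + Gh 0 0 * |A 0 1| * Lh 1 1 +
        Gh 0 1 * |A 0 0| * Lh 1 1) := fun _ hl =>
    residual_of_fwd hu.le hu1 G1 Gh1 (L1 hl) Lh1 (residual_of_smallOffDiag fl hu.le hu1 hS)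
  have res2 : ¬ (-G 1 0 = 0 ∧ -G 1 1 = 0) → ¬ (L 1 0 = 0 ∧ L 0 0 = 0) →
      |-G 1 0 * A 1 1 * L 0 0 - -G 1 0 * A 0 1 * L 1 0 + -G 1 1 * A 0 0 * L 1 0| ≤
      550 * u * (Gh 1 0 * |A 1 1| * Lh 0 0 + Gh 1 0 * |A 0 1| * Lh 1 0 +
        Gh 1 1 * |A 0 0| * Lh 1 0) := fun hg _ =>
    residual_of_fwd hu.le hu1 (G2 hg) Gh2 (by rwa [neg_neg]) (by rwa [neg_neg])
      (residual_of_smallOffDiag fl hu.le hu1 hS.rot)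
  have hd := hdet
  rw [det_of_upper hA] at hd
  have ha0 := left_ne_zero_of_mul hd
  have hd0 := right_ne_zero_of_mul hd
  have hab : |A 0 0| * |A 0 1| ≤ cond A * |A 0 0 * A 1 1| :=
    entry_mul_entry_le hA hdet ⟨0, 0, rfl⟩ ⟨0, 1, rfl⟩
  have hdb : |A 1 1| * |A 0 1| ≤ cond A * |A 1 1 * A 0 0| := by
    rw [mul_comm (A 1 1)]
    exact entry_mul_entry_le hA hdet ⟨1, 1, rfl⟩ ⟨0, 1, rfl⟩
  have fg1 := Hg1.fine_le hu.le hc (by linarith) ha0 hd0 hab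
  have fg2 := Hg2.fine_le hu.le hc (by linarith) ha0 hd0 hab
  have fl1 := Hl1.fine_le hu.le hc (by linarith) hd0 ha0 hdb
  have fl2 := Hl2.fine_le hu.le hc (by linarith) hd0 ha0 hdb
  have sum0 : ∀ {p q : ℝ}, p = 0 ∧ q = 0 → |p| + |q| = 0 := by rintro p q ⟨rfl, rfl⟩; simp
  -- Outside the special case `c₁₁` or `b₂₂` is nonzero, which guarantees a nonzero vector without
  -- cancellation at one of the indices.
  have some_fine : m₁ ≤ ((4 * cond A : ℝ) : EReal) ∨ m₂ ≤ ((4 * cond A : ℝ) : EReal) := by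
    rcases not_and_or.1 h0 with h | h
    · rcases GP.exists_fine h with f | f
      · exact Or.inl (etaMax_le_of_fine hc fg1 fl1 (Or.inl f))
      · exact Or.inr (etaMax_le_of_fine hc fg2 fl2 (Or.inl f))
    · rcases LP.exists_fine h with f | f
      · exact Or.inl (etaMax_le_of_fine hc fg1 fl1 (Or.inr f))
      · exact Or.inr (etaMax_le_of_fine hc fg2 fl2 (Or.inr f))
  have hτ : ((4 * cond A : ℝ) : EReal) ≤ ((8 * cond A : ℝ) : EReal) := by
    rw [EReal.coe_le_coe_iff]; linarith
  by_cases hsel : m₁ ≤ ((8 * cond A : ℝ) : EReal) ∧ m₁ ≤ m₂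
  · rw [if_pos hsel]
    have hm : m₁ ≤ ((4 * cond A : ℝ) : EReal) := some_fine.elim id hsel.2.trans
    refine rsvdFinish_stable fl hu.le hA hdet huκ Hg1 Hl1 res1 ?_
    exact selected_of_le hc hsel.2 hm (fun h => Hg1.etag.top (sum0 h))
      (fun h => Hl1.etak.top (sum0 (Hl1.adj.eq_zero h))) fg1 fl1 fg2 fl2
      (GP.fst.imp_left fun h hz => ⟨h, hz⟩) (LP.fst.imp_left fun h hz => ⟨h, hz⟩)
  · rw [if_neg hsel]
    -- If the first index had the smaller η_max, that value would be at most `4 * cond A`, hence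
    -- within the tolerance, and the first index would have been taken.
    have hlt : m₂ < m₁ := by
      by_contra hle
      rw [not_lt] at hle
      exact hsel ⟨(some_fine.elim id hle.trans).trans hτ, hle⟩
    have hm : m₂ ≤ ((4 * cond A : ℝ) : EReal) := some_fine.elim hlt.le.trans id
    -- The quarter turn brings the second row of `G` to the top with a minus sign, which is why its
    -- data were negated.
    have r0 : ∀ (X : Mat2) j, (Jᵀ * X) 0 j = -X 1 j := by
      intro X j; simp [J, Matrix.mul_apply]
    have c1 : ∀ (X : Mat2) i, (X * J) i 1 = X i 0 := by
      intro X i; simp [J, Matrix.mul_apply]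
    have Sel := selected_of_le hc hlt.le hm (fun h => Hg2.etag.top (sum0 h))
      (fun h => Hl2.etak.top (sum0 (Hl2.adj.eq_zero h))) fg2 fl2 fg1 fl1
      (GP.snd.imp_left fun h hz => ⟨h, hz⟩) (LP.snd.imp_left fun h hz => ⟨h, hz⟩)
    refine rsvdFinish_stable fl hu.le hA hdet huκ ?_ ?_ ?_ ?_ (gh₁ := Gh 1 0) (gh₂ := Gh 1 1)
      (kh₁ := Kh 1 0) (kh₂ := Kh 1 1) (lh₁ := Lh 0 0) (lh₂ := Lh 1 0) (hh₁ := Hh 0 0)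
      (hh₂ := Hh 1 0)
    · simp only [r0]; exact Hg2
    · simp only [c1]; exact Hl2
    · simp only [r0, c1]; exact res2
    · simp only [r0, c1]; exact Sel

end
end RSVD

theorem mainTheorem4 (c : ℝ) (hc : 0 < c) :
    ∃ ε₀ : ℝ, 0 < ε₀ ∧ ∃ K : ℝ, 0 < K ∧
      ∀ (ε : ℝ), 0 < ε → ε ≤ ε₀ →
      ∀ (A B C : RSVD.Mat2), A 1 0 = 0 → B 1 0 = 0 → C 1 0 = 0 → A.det ≠ 0 →
      ∀ (u : ℝ), 0 < u → u ≤ c * ε / RSVD.cond A →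
      ∀ (fl : RSVD.FlArith u) (zg zl : Bool),
        ∃ P ∈ Matrix.orthogonalGroup (Fin 2) ℝ, ∃ Q ∈ Matrix.orthogonalGroup (Fin 2) ℝ,
        ∃ δA : RSVD.Mat2,
          ‖(RSVD.rsvd22 fl zg zl ((8 * RSVD.cond A : ℝ) : EReal) A B C).P - P‖ ≤ K * ε ∧
          ‖(RSVD.rsvd22 fl zg zl ((8 * RSVD.cond A : ℝ) : EReal) A B C).Q - Q‖ ≤ K * ε ∧
          (RSVD.rsvd22 fl zg zl ((8 * RSVD.cond A : ℝ) : EReal) A B C).A' =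
            Pᵀ * (A + δA) * Q ∧
          ‖δA‖ ≤ K * ε * ‖A‖ := by
  -- This ε₀ forces `u * cond A ≤ 1 / 1000000`, and the bound of `rsvd22_stable` becomes `K * ε`.
  refine ⟨1 / (1000000 * c), by positivity, 4000000 * c, by positivity, ?_⟩
  intro ε hε hε₀ A B C hA hB hC hdet u hu huε fl zg zl
  have hcond := RSVD.one_le_cond hA hdet
  have huκ : u * RSVD.cond A ≤ c * ε := by rwa [le_div_iff₀ (by linarith)] at huε
  have hcε : c * ε ≤ 1 / 1000000 := by
    rw [le_div_iff₀ (by positivity)] at hε₀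
    linarith
  obtain ⟨P, hP, Q, hQ, δA, h1, h2, h3, h4⟩ :=
    RSVD.rsvd22_stable fl hu hA hB hC hdet (huκ.trans hcε) zg zl
  have hδ : 4000000 * (u * RSVD.cond A) ≤ 4000000 * c * ε := by linarith
  exact ⟨P, hP, Q, hQ, δA, h1.trans hδ, h2.trans hδ, h3,
    h4.trans (mul_le_mul_of_nonneg_right hδ (norm_nonneg A))⟩
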